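/- Let $\mathcal C$ be a rigid monoidal category with coequalizers. For $X\in\mathcal C$ let $X^*$ be its left dual, with $\mathrm{ev}_X:X^*\otimes X\to\mathbf 1$ and $\mathrm{coev}_X:\mathbf 1\to X\otimes X^*$. Let $(A,\sigma)$ be a commutative algebra in the Drinfeld centre $\mathcal Z(\mathcal C)$, with multiplication $\mu$ and half-braiding $\sigma_X:A\otimes X\to X\otimes A$ (commutativity means $\mu\circ\sigma_A=\mu$). Assume that the monoidal category ${}_A\mathcal C_A$ of $A$-bimodules in $\mathcal C$, with tensor product $\otimes_A$, is rigid. Write $\pi_{M,N}:M\otimes N\to M\otimes_A N$ for the canonical epimorphism. Let $\mathcal C_A^\sigma$ be the category of right $A$-modules in $\mathcal C$, regarded as the full monoidal subcategory of ${}_A\mathcal C_A$ of the bimodules $M$ whose actions satisfy $a^l_M=a^r_M\circ\sigma_M$. The Drinfeld isomorphism $u=\mathfrak u_{(A,\sigma)}:A\to A^{**}$ is $$u=(\mathrm{ev}_A\otimes\mathrm{id}_{A^{**}})\circ(c\otimes\mathrm{id}_{A^{**}})\circ(\mathrm{id}_A\otimes\mathrm{coev}_{A^*}),$$ where $c=\tau_A^{-1}:A\otimes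 A^*\to A^*\otimes A$ and $\tau$ is the half-braiding of the dual $(A^*,\tau)$ of $(A,\sigma)$ in $\mathcal Z(\mathcal C)$, that is, where the braiding of $\mathcal Z(\mathcal C)$ is $c_{(X,\sigma),(Y,\tau)}=\tau_X^{-1}$. Equivalently, $u$ is the inverse of $$\overline u=(\mathrm{id}_A\otimes\mathrm{ev}_{A^*})\circ(\sigma_{A^{**}}^{-1}\otimes\mathrm{id}_{A^*})\circ(\mathrm{id}_{A^{**}}\otimes\mathrm{coev}_A):A^{**}\to A.$$ It is an isomorphism of algebras. For $M\in\mathcal C_A^\sigma$ let $G(M)=(M^{**})_{(u)}$ be the $A^{**}$-module $M^{**}$ with its action restricted to $A$ along $u$; it again lies in $\mathcal C_A^\sigma$, and $f\mapsto f^{**}$ makes $G:\mathcal C_A^\sigma\to\mathcal C_A^\sigma$ a functor. It is a monoidal functor with the isomorphisms $g_0=u:A\to G(A)$ and $g_{M,N}:G(M)\otimes_A G(N)\to G(M\otimes_A N)$ determined by $g_{M,N}\circ\pi_{M^{**},N^{**}}=\pi_{M,N}^{**}$ (with $M^{**}\otimes N^{**}$ identified with $(M\otimes N)^{**}$). Then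 $\mathcal C_A^\sigma$ is a rigid monoidal category. The left dual of $M$ in $\mathcal C_A^\sigma$ is $M^\dagger=\underline{\mathrm{Hom}}_A(M,A)$: the morphism $i_M:M^\dagger\to A\otimes M^*$ of $\mathcal C$ that corresponds to the evaluation $M^\dagger\otimes M\to M^\dagger\otimes_A M\to A$ is an equalizer of $$\mathrm{id}_A\otimes(a^r_M)^*,\quad(\mu\otimes\mathrm{id})\circ(\mathrm{id}_A\otimes\mathrm{coev}_A\otimes\mathrm{id}_{M^*}):\ A\otimes M^*\rightrightarrows A\otimes A^*\otimes M^*.$$ Moreover, the double dual functor $(-)^{\dagger\dagger}$ on $\mathcal C_A^\sigma$, with its canonical monoidal structure, is isomorphic to $G$ as a monoidal functor. -/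

import Mathlib

open CategoryTheory MonoidalCategory Limits
universe v u
namespace BimodDual
noncomputable section
section Mates
variable {C : Type u} [Category.{v} C] [MonoidalCategory C]

/-- The dual `Y' ⟶ X'` of `f : X ⟶ Y` with respect to given left duals `X'`, `Y'`. -/
def mate {X X' Y Y' : C} (p : ExactPairing X X') (q : ExactPairing Y Y') (f : X ⟶ Y) : Y' ⟶ X' :=
  @rightAdjointMate C _ _ X Y ⟨X'⟩ ⟨Y'⟩ f

theorem ev_ext {X X' Z : C} (p : ExactPairing X X') {g h : Z ⟶ X'}
    (w : g ▷ X ≫ ε_ X X' = h ▷ X ≫ ε_ X X') : g = h := by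
  have key : ∀ k : Z ⟶ X', k = 𝟙 _ ⊗≫ Z ◁ η_ X X' ⊗≫ (k ▷ X ≫ ε_ X X') ▷ X' ⊗≫ 𝟙 _ := by
    intro k
    calc k = k ⊗≫ (X' ◁ η_ X X' ⊗≫ ε_ X X' ▷ X') ⊗≫ 𝟙 _ := by
          rw [ExactPairing.coevaluation_evaluation'']; monoidal
      _ = 𝟙 _ ⊗≫ (k ▷ _ ≫ X' ◁ η_ X X') ⊗≫ ε_ X X' ▷ X' ⊗≫ 𝟙 _ := by monoidal
      _ = _ := by rw [← whisker_exchange]; monoidal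
  rw [key g, key h, w]

theorem mate_ev {X X' Y Y' : C} (p : ExactPairing X X') (q : ExactPairing Y Y') (f : X ⟶ Y) :
    mate p q f ▷ X ≫ ε_ X X' = Y' ◁ f ≫ ε_ Y Y' :=
  @rightAdjointMate_comp_evaluation C _ _ X Y ⟨X'⟩ ⟨Y'⟩ f

theorem ev_ext' {X X' Z : C} (p : ExactPairing X X') {g h : Z ⟶ X}
    (w : X' ◁ g ≫ ε_ X X' = X' ◁ h ≫ ε_ X X') : g = h := by
  have key : ∀ k : Z ⟶ X, k = 𝟙 _ ⊗≫ η_ X X' ▷ Z ⊗≫ X ◁ (X' ◁ k ≫ ε_ X X') ⊗≫ 𝟙 _ := by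
    intro k
    calc k = k ⊗≫ (η_ X X' ▷ X ⊗≫ X ◁ ε_ X X') ⊗≫ 𝟙 _ := by
          rw [ExactPairing.evaluation_coevaluation'']; monoidal
      _ = 𝟙 _ ⊗≫ (𝟙_ C ◁ k ≫ η_ X X' ▷ _) ⊗≫ X ◁ ε_ X X' ⊗≫ 𝟙 _ := by monoidal
      _ = _ := by rw [whisker_exchange]; monoidal
  rw [key g, key h, w]

theorem mate_injective {X X' Y Y' : C} (p : ExactPairing X X') (q : ExactPairing Y Y')
    {f g : X ⟶ Y} (h : mate p q f = mate p q g) : f = g := by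
  apply ev_ext' q
  rw [← mate_ev p q, ← mate_ev p q, h]

theorem mate_surjective {X X' Y Y' : C} (p : ExactPairing X X') (q : ExactPairing Y Y')
    (g : Y' ⟶ X') : ∃ f : X ⟶ Y, mate p q f = g := by
  refine ⟨@leftAdjointMate C _ _ Y' X' ⟨Y⟩ ⟨X⟩ g, ev_ext p ?_⟩
  rw [mate_ev]
  exact @leftAdjointMate_comp_evaluation C _ _ Y' X' ⟨Y⟩ ⟨X⟩ g

theorem mate_id {X X' : C} (p : ExactPairing X X') : mate p p (𝟙 X) = 𝟙 X' :=
  @rightAdjointMate_id C _ _ X ⟨X'⟩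

theorem mate_comp {X X' Y Y' Z Z' : C} (p : ExactPairing X X') (q : ExactPairing Y Y')
    (r : ExactPairing Z Z') (f : X ⟶ Y) (g : Y ⟶ Z) :
    mate p r (f ≫ g) = mate q r g ≫ mate p q f :=
  @comp_rightAdjointMate C _ _ X Y Z ⟨X'⟩ ⟨Y'⟩ ⟨Z'⟩ f g

/-- The tensor product of two pairings. -/
abbrev pairTensor {X X' Y Y' : C} (p : ExactPairing X X') (q : ExactPairing Y Y') :
    ExactPairing (X ⊗ Y) (Y' ⊗ X') := ExactPairing.tensor

theorem pairTensor_ev {X X' Y Y' : C} (p : ExactPairing X X') (q : ExactPairing Y Y') :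
    @ExactPairing.evaluation _ _ _ (X ⊗ Y) (Y' ⊗ X') (pairTensor p q) =
      𝟙 _ ⊗≫ Y' ◁ (ε_ X X' ▷ Y) ⊗≫ ε_ Y Y' := rfl

theorem mate_tensor {X X' Y Y' Z Z' W W' : C} (p : ExactPairing X X') (q : ExactPairing Y Y')
    (r : ExactPairing Z Z') (s : ExactPairing W W') (f : X ⟶ Z) (g : Y ⟶ W) :
    mate (pairTensor p q) (pairTensor r s) (f ⊗ₘ g) = mate q s g ⊗ₘ mate p r f := by
  apply ev_ext (pairTensor p q)
  rw [mate_ev, pairTensor_ev, pairTensor_ev]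
  symm
  calc
    _ = 𝟙 _ ⊗≫ mate q s g ▷ (Z' ⊗ X ⊗ Y) ⊗≫ Y' ◁ (mate p r f ▷ X ≫ ε_ X X') ▷ Y ⊗≫ ε_ Y Y' := by
      rw [MonoidalCategory.tensorHom_def]; monoidal
    _ = 𝟙 _ ⊗≫ (mate q s g ▷ (Z' ⊗ X ⊗ Y) ≫ Y' ◁ (𝟙 _ ⊗≫ (Z' ◁ f ≫ ε_ Z Z') ▷ Y)) ⊗≫
        ε_ Y Y' := by
      rw [mate_ev]; monoidal
    _ = 𝟙 _ ⊗≫ W' ◁ (Z' ◁ f ≫ ε_ Z Z') ▷ Y ⊗≫ (mate q s g ▷ Y ≫ ε_ Y Y') := by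
      rw [← whisker_exchange]; monoidal
    _ = 𝟙 _ ⊗≫ W' ◁ Z' ◁ f ▷ Y ⊗≫ W' ◁ (ε_ Z Z' ▷ Y ≫ _ ◁ g) ⊗≫ ε_ W W' := by
      rw [mate_ev]; monoidal
    _ = _ := by
      rw [← whisker_exchange, MonoidalCategory.tensorHom_def]; monoidal

theorem mate_assoc {X X' Y Y' Z Z' : C} (p : ExactPairing X X') (q : ExactPairing Y Y')
    (r : ExactPairing Z Z') :
    mate (pairTensor (pairTensor p q) r) (pairTensor p (pairTensor q r)) (α_ X Y Z).hom =
      (α_ Z' Y' X').hom := by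
  apply ev_ext (pairTensor (pairTensor p q) r)
  rw [mate_ev, pairTensor_ev, pairTensor_ev, pairTensor_ev, pairTensor_ev]
  monoidal

theorem mate_leftUnitor {X X' : C} (p : ExactPairing X X') :
    mate (pairTensor exactPairingUnit p) p (λ_ X).hom = (ρ_ X').inv := by
  apply ev_ext (pairTensor exactPairingUnit p)
  have : ε_ (𝟙_ C) (𝟙_ C) = (ρ_ _).hom := rfl
  rw [mate_ev, pairTensor_ev, this]
  monoidal

theorem mate_rightUnitor {X X' : C} (p : ExactPairing X X') :
    mate (pairTensor p exactPairingUnit) p (ρ_ X).hom = (λ_ X').inv := by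
  apply ev_ext (pairTensor p exactPairingUnit)
  have : ε_ (𝟙_ C) (𝟙_ C) = (ρ_ _).hom := rfl
  rw [mate_ev, pairTensor_ev, this]
  monoidal

theorem mate_inv {X X' Y Y' : C} (p : ExactPairing X X') (q : ExactPairing Y Y') (f : X ≅ Y) :
    mate q p f.inv ≫ mate p q f.hom = 𝟙 X' := by
  rw [← mate_comp, f.hom_inv_id, mate_id]

theorem mate_assoc_inv {X X' Y Y' Z Z' : C} (p : ExactPairing X X') (q : ExactPairing Y Y')
    (r : ExactPairing Z Z') :
    mate (pairTensor p (pairTensor q r)) (pairTensor (pairTensor p q) r) (α_ X Y Z).inv =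
      (α_ Z' Y' X').inv := by
  rw [← cancel_mono (α_ Z' Y' X').hom, ← mate_assoc p q r, mate_inv, mate_assoc, Iso.inv_hom_id]

theorem mate_leftUnitor_inv {X X' : C} (p : ExactPairing X X') :
    mate p (pairTensor exactPairingUnit p) (λ_ X).inv = (ρ_ X').hom := by
  rw [← cancel_mono (ρ_ X').inv, ← mate_leftUnitor p, mate_inv, mate_leftUnitor, Iso.hom_inv_id]

theorem mate_rightUnitor_inv {X X' : C} (p : ExactPairing X X') :
    mate p (pairTensor p exactPairingUnit) (ρ_ X).inv = (λ_ X').hom := by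
  rw [← cancel_mono (λ_ X').inv, ← mate_rightUnitor p, mate_inv, mate_rightUnitor, Iso.hom_inv_id]

/-- A left dual of `X` together with a left dual of that left dual. -/
structure DDual (X : C) where
  X₁ : C
  X₂ : C
  p : ExactPairing X X₁
  q : ExactPairing X₁ X₂

namespace DDual

/-- The double dual `f** : X** ⟶ Y**` of `f : X ⟶ Y`. -/
def map {X Y : C} (d : DDual X) (e : DDual Y) (f : X ⟶ Y) : d.X₂ ⟶ e.X₂ :=
  mate e.q d.q (mate d.p e.p f)

/-- `X** ⊗ Y**` as a double dual of `X ⊗ Y`. -/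
abbrev tensor {X Y : C} (d : DDual X) (e : DDual Y) : DDual (X ⊗ Y) :=
  ⟨e.X₁ ⊗ d.X₁, d.X₂ ⊗ e.X₂, pairTensor d.p e.p, pairTensor e.q d.q⟩

/-- The unit object as its own double dual. -/
abbrev unit : DDual (𝟙_ C) := ⟨𝟙_ C, 𝟙_ C, exactPairingUnit, exactPairingUnit⟩

theorem map_id {X : C} (d : DDual X) : d.map d (𝟙 X) = 𝟙 _ := by
  simp [map, mate_id]

theorem map_comp {X Y Z : C} (d : DDual X) (e : DDual Y) (k : DDual Z) (f : X ⟶ Y) (g : Y ⟶ Z) :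
    d.map k (f ≫ g) = d.map e f ≫ e.map k g := by
  simp only [map]
  rw [mate_comp d.p e.p k.p, mate_comp _ e.q]

theorem map_tensor {X Y Z W : C} (d : DDual X) (e : DDual Y) (k : DDual Z) (l : DDual W)
    (f : X ⟶ Z) (g : Y ⟶ W) :
    (d.tensor e).map (k.tensor l) (f ⊗ₘ g) = d.map k f ⊗ₘ e.map l g := by
  simp only [map, tensor]
  rw [mate_tensor, mate_tensor]

theorem map_assoc {X Y Z : C} (d : DDual X) (e : DDual Y) (k : DDual Z) :
    ((d.tensor e).tensor k).map (d.tensor (e.tensor k)) (α_ X Y Z).hom = (α_ _ _ _).hom := by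
  simp only [map, tensor]
  rw [mate_assoc, mate_assoc]

theorem map_leftUnitor {X : C} (d : DDual X) :
    (unit.tensor d).map d (λ_ X).hom = (λ_ d.X₂).hom := by
  simp only [map, tensor, unit]
  rw [mate_leftUnitor, mate_rightUnitor_inv]

theorem map_rightUnitor {X : C} (d : DDual X) :
    (d.tensor unit).map d (ρ_ X).hom = (ρ_ d.X₂).hom := by
  simp only [map, tensor, unit]
  rw [mate_rightUnitor, mate_leftUnitor_inv]

theorem tensor_natural_left {X Y Z : C} (d : DDual X) (e : DDual Y) (k : DDual Z)
    (dk : DDual (X ⊗ Z)) (ek : DDual (Y ⊗ Z)) (f : X ⟶ Y) :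
    d.map e f ▷ k.X₂ ≫ (e.tensor k).map ek (𝟙 _) = (d.tensor k).map dk (𝟙 _) ≫ dk.map ek (f ▷ Z) := by
  rw [← map_comp, Category.id_comp, ← tensorHom_id, ← map_id, ← map_tensor, ← map_comp,
    Category.comp_id, tensorHom_id]

theorem tensor_natural_right {X Y Z : C} (d : DDual X) (e : DDual Y) (k : DDual Z)
    (kd : DDual (Z ⊗ X)) (ke : DDual (Z ⊗ Y)) (f : X ⟶ Y) :
    k.X₂ ◁ d.map e f ≫ (k.tensor e).map ke (𝟙 _) = (k.tensor d).map kd (𝟙 _) ≫ kd.map ke (Z ◁ f) := by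
  rw [← map_comp, Category.id_comp, ← id_tensorHom, ← map_id, ← map_tensor, ← map_comp,
    Category.comp_id, id_tensorHom]

theorem tensor_associativity {X Y Z : C} (d : DDual X) (e : DDual Y) (k : DDual Z)
    (de : DDual (X ⊗ Y)) (ek : DDual (Y ⊗ Z)) (l : DDual ((X ⊗ Y) ⊗ Z)) (r : DDual (X ⊗ Y ⊗ Z)) :
    (d.tensor e).map de (𝟙 _) ▷ k.X₂ ≫ (de.tensor k).map l (𝟙 _) ≫ l.map r (α_ X Y Z).hom =
      (α_ d.X₂ e.X₂ k.X₂).hom ≫ d.X₂ ◁ (e.tensor k).map ek (𝟙 _) ≫ (d.tensor ek).map r (𝟙 _) := by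
  rw [← map_comp, Category.id_comp, ← tensorHom_id, ← map_id, ← map_tensor, ← map_comp,
    ← id_tensorHom, ← map_id d, ← map_tensor, ← map_comp, ← map_assoc, ← map_comp]
  simp

theorem tensor_left_unitality {X : C} (d : DDual X) (e : DDual (𝟙_ C)) (k : DDual (𝟙_ C ⊗ X)) :
    (λ_ d.X₂).hom = unit.map e (𝟙 _) ▷ d.X₂ ≫ (e.tensor d).map k (𝟙 _) ≫ k.map d (λ_ X).hom := by
  rw [← map_comp, Category.id_comp, ← tensorHom_id, ← map_id, ← map_tensor, ← map_comp,
    ← map_leftUnitor]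
  simp

theorem tensor_right_unitality {X : C} (d : DDual X) (e : DDual (𝟙_ C)) (k : DDual (X ⊗ 𝟙_ C)) :
    (ρ_ d.X₂).hom = d.X₂ ◁ unit.map e (𝟙 _) ≫ (d.tensor e).map k (𝟙 _) ≫ k.map d (ρ_ X).hom := by
  rw [← map_comp, Category.id_comp, ← id_tensorHom, ← map_id, ← map_tensor, ← map_comp,
    ← map_rightUnitor]
  simp

/-- The comparison isomorphism between two double duals of the same object. -/
@[simps]
def comparison {X : C} (d e : DDual X) : d.X₂ ≅ e.X₂ where
  hom := d.map e (𝟙 X)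
  inv := e.map d (𝟙 X)
  hom_inv_id := by rw [← map_comp, Category.comp_id, map_id]
  inv_hom_id := by rw [← map_comp, Category.comp_id, map_id]

end DDual
end Mates

section DoubleDual
variable (C : Type u) [Category.{v} C] [MonoidalCategory C] [RightRigidCategory C]

variable {C} in
/-- The chosen left dual `X*`: it carries `X* ⊗ X ⟶ 𝟙` and `𝟙 ⟶ X ⊗ X*`. -/
abbrev ldual (X : C) : C := HasRightDual.rightDual X

variable {C} in
/-- The chosen double left dual `X**`. -/
abbrev dd (X : C) : C := ldual (ldual X)

variable {C} in
/-- The chosen double dual `X**`. -/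
def ddual (X : C) : DDual X := ⟨ldual X, dd X, HasRightDual.exact, HasRightDual.exact⟩

variable {C} in
/-- The double dual `f** : X** ⟶ Y**` of a morphism. -/
def ddMap {X Y : C} (f : X ⟶ Y) : dd X ⟶ dd Y := (ddual X).map (ddual Y) f

variable {C} in
@[simp] theorem ddMap_id (X : C) : ddMap (𝟙 X) = 𝟙 (dd X) := DDual.map_id _

variable {C} in
theorem ddMap_comp {X Y Z : C} (f : X ⟶ Y) (g : Y ⟶ Z) :
    ddMap (f ≫ g) = ddMap f ≫ ddMap g := DDual.map_comp _ _ _ f g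

variable {C} in
/-- The canonical isomorphism `X** ⊗ Y** ≅ (X ⊗ Y)**`. -/
def ddTensor (X Y : C) : dd X ⊗ dd Y ≅ dd (X ⊗ Y) :=
  ((ddual X).tensor (ddual Y)).comparison (ddual (X ⊗ Y))

variable {C} in
/-- The canonical isomorphism `𝟙 ≅ 𝟙**`. -/
def ddUnit : 𝟙_ C ≅ dd (𝟙_ C) := DDual.unit.comparison (ddual (𝟙_ C))

variable {C} in
theorem ddTensor_natural_left {X Y : C} (f : X ⟶ Y) (Z : C) :
    ddMap f ▷ dd Z ≫ (ddTensor Y Z).hom = (ddTensor X Z).hom ≫ ddMap (f ▷ Z) :=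
  DDual.tensor_natural_left (ddual X) (ddual Y) (ddual Z) (ddual _) (ddual _) f

variable {C} in
theorem ddTensor_natural_left_assoc {X Y : C} (f : X ⟶ Y) (Z : C) {W : C} (h : dd (Y ⊗ Z) ⟶ W) :
    ddMap f ▷ dd Z ≫ (ddTensor Y Z).hom ≫ h = (ddTensor X Z).hom ≫ ddMap (f ▷ Z) ≫ h := by
  rw [← Category.assoc, ddTensor_natural_left, Category.assoc]

variable {C} in
theorem ddTensor_natural_right {X Y : C} (Z : C) (f : X ⟶ Y) :
    dd Z ◁ ddMap f ≫ (ddTensor Z Y).hom = (ddTensor Z X).hom ≫ ddMap (Z ◁ f) :=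
  DDual.tensor_natural_right (ddual X) (ddual Y) (ddual Z) (ddual _) (ddual _) f

variable {C} in
theorem ddTensor_natural_right_assoc {X Y : C} (Z : C) (f : X ⟶ Y) {W : C}
    (h : dd (Z ⊗ Y) ⟶ W) :
    dd Z ◁ ddMap f ≫ (ddTensor Z Y).hom ≫ h = (ddTensor Z X).hom ≫ ddMap (Z ◁ f) ≫ h := by
  rw [← Category.assoc, ddTensor_natural_right, Category.assoc]

variable {C} in
theorem ddTensor_associativity (X Y Z : C) :
    (ddTensor X Y).hom ▷ dd Z ≫ (ddTensor (X ⊗ Y) Z).hom ≫ ddMap (α_ X Y Z).hom =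
      (α_ (dd X) (dd Y) (dd Z)).hom ≫ dd X ◁ (ddTensor Y Z).hom ≫ (ddTensor X (Y ⊗ Z)).hom :=
  DDual.tensor_associativity (ddual X) (ddual Y) (ddual Z) (ddual _) (ddual _) (ddual _) (ddual _)

variable {C} in
theorem dd_left_unitality (X : C) :
    (λ_ (dd X)).hom = ddUnit.hom ▷ dd X ≫ (ddTensor (𝟙_ C) X).hom ≫ ddMap (λ_ X).hom :=
  DDual.tensor_left_unitality (ddual X) (ddual _) (ddual _)

variable {C} in
theorem dd_right_unitality (X : C) :
    (ρ_ (dd X)).hom = dd X ◁ ddUnit.hom ≫ (ddTensor X (𝟙_ C)).hom ≫ ddMap (ρ_ X).hom :=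
  DDual.tensor_right_unitality (ddual X) (ddual _) (ddual _)

/-- The double left dual functor `X ↦ X**`. -/
def doubleDual : C ⥤ C where
  obj X := dd X
  map f := ddMap f
  map_id X := ddMap_id X
  map_comp f g := ddMap_comp f g

/-- The double left dual functor is a (strong) monoidal functor. -/
instance : (doubleDual C).Monoidal := Functor.CoreMonoidal.toMonoidal
  { εIso := ddUnit
    μIso := ddTensor
    μIso_hom_natural_left := ddTensor_natural_left
    μIso_hom_natural_right := ddTensor_natural_right
    associativity := ddTensor_associativity
    left_unitality := dd_left_unitality
    right_unitality := dd_right_unitality }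

instance : (doubleDual C).Faithful where
  map_injective h := mate_injective _ _ (mate_injective _ _ h)

instance : (doubleDual C).Full where
  map_surjective {X Y} g := by
    obtain ⟨f₁, h₁⟩ := mate_surjective (ddual Y).q (ddual X).q g
    obtain ⟨f, h⟩ := mate_surjective (ddual X).p (ddual Y).p f₁
    exact ⟨f, by rw [← h₁, ← h]; rfl⟩

end DoubleDual

section Rigid
variable (C : Type u) [Category.{v} C] [MonoidalCategory C] [RigidCategory C]

instance : (doubleDual C).EssSurj where
  mem_essImage Y := by
    let X : C := HasLeftDual.leftDual (HasLeftDual.leftDual Y)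
    let d : DDual X := ⟨HasLeftDual.leftDual Y, Y, HasLeftDual.exact, HasLeftDual.exact⟩
    exact ⟨X, ⟨(ddual X).comparison d⟩⟩

instance : (doubleDual C).IsEquivalence where

/-- In a rigid monoidal category, the tensor product preserves colimits in each variable. -/
instance (X : C) : PreservesColimitsOfSize.{0, 0} (tensorLeft X) :=
  (tensorLeftAdjunction (HasLeftDual.leftDual X) X).leftAdjoint_preservesColimits

instance (X : C) : PreservesColimitsOfSize.{0, 0} (tensorRight X) :=
  (tensorRightAdjunction X (HasRightDual.rightDual X)).leftAdjoint_preservesColimits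

end Rigid

section Bimodules
variable {C : Type u} [Category.{v} C] [MonoidalCategory C] [RigidCategory C] [HasCoequalizers C]

/-- The monoidal category of endomorphisms of `A` in the bicategory of algebras and bimodules. -/
abbrev bimodEnd (A : Mon C) : MonoidalCategory (Bimod A A) :=
  @CategoryTheory.instMonoidalCategoryHom (Mon C) Bimod.monBicategory A

/-- The monoidal category `_AC_A` of `A`-bimodules, with the tensor product over `A`. -/
instance bimodMonoidal (A : Mon C) : MonoidalCategory (Bimod A A) where
  tensorObj M N := M.tensorBimod N
  whiskerLeft M _ _ f := Bimod.whiskerLeft M f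
  whiskerRight f N := Bimod.whiskerRight f N
  tensorUnit := Bimod.regular A
  associator := Bimod.associatorBimod
  leftUnitor := Bimod.leftUnitorBimod
  rightUnitor := Bimod.rightUnitorBimod
  tensorHom_comp_tensorHom := (bimodEnd A).tensorHom_comp_tensorHom
  id_tensorHom_id := (bimodEnd A).id_tensorHom_id
  whiskerLeft_id _ _ := Bimod.whiskerLeft_id_bimod
  id_whiskerRight _ _ := Bimod.id_whiskerRight_bimod
  associator_naturality := (bimodEnd A).associator_naturality
  leftUnitor_naturality := (bimodEnd A).leftUnitor_naturality
  rightUnitor_naturality := (bimodEnd A).rightUnitor_naturality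
  pentagon M N P Q := Bimod.pentagon_bimod M N P Q
  triangle M N := Bimod.triangle_bimod M N


end Bimodules

section HalfBraidings
variable {C : Type u} [Category.{v} C] [MonoidalCategory C]

/-- The object of `C` underlying an object `(X, σ)` of the Drinfeld centre. -/
def ob (X : Center C) : C := X.1

/-- The half-braiding `σ_U : X ⊗ U ≅ U ⊗ X` of an object `(X, σ)` of the Drinfeld centre. -/
def halfBraiding (X : Center C) (U : C) : ob X ⊗ U ≅ U ⊗ ob X := X.2.β U

/-- The half-braiding `σ_U : X ⊗ U ⟶ U ⊗ X`. -/
abbrev hb (X : Center C) (U : C) : ob X ⊗ U ⟶ U ⊗ ob X := (halfBraiding X U).hom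

/-- The inverse of the half-braiding. -/
abbrev hbInv (X : Center C) (U : C) : U ⊗ ob X ⟶ ob X ⊗ U := (halfBraiding X U).inv

theorem hb_natural (X : Center C) {U V : C} (f : U ⟶ V) :
    ob X ◁ f ≫ hb X V = hb X U ≫ f ▷ ob X := X.2.naturality f

theorem hb_tensor (X : Center C) (U V : C) :
    hb X (U ⊗ V) = 𝟙 _ ⊗≫ hb X U ▷ V ⊗≫ U ◁ hb X V ⊗≫ 𝟙 _ := by
  have h : hb X (U ⊗ V) = (α_ _ _ _).inv ≫ hb X U ▷ V ≫ (α_ _ _ _).hom ≫ U ◁ hb X V ≫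
    (α_ _ _ _).inv := X.2.monoidal U V
  rw [h]; monoidal

theorem hb_unit (X : Center C) : hb X (𝟙_ C) = (ρ_ (ob X)).hom ≫ (λ_ (ob X)).inv := by
  have h1 := hb_natural X (λ_ (𝟙_ C)).hom
  rw [hb_tensor] at h1
  have h2 : ob X ◁ (λ_ (𝟙_ C)).hom ≫ hb X (𝟙_ C) =
      (𝟙 _ ⊗≫ hb X (𝟙_ C) ▷ 𝟙_ C ⊗≫ 𝟙 _) ≫ hb X (𝟙_ C) := by
    rw [h1]; monoidal
  rw [cancel_mono] at h2
  have h3 : hb X (𝟙_ C) ▷ 𝟙_ C = ((ρ_ (ob X)).hom ≫ (λ_ (ob X)).inv) ▷ 𝟙_ C := by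
    have h4 : hb X (𝟙_ C) ▷ 𝟙_ C = (α_ (ob X) (𝟙_ C) (𝟙_ C)).hom ≫
        (𝟙 _ ⊗≫ hb X (𝟙_ C) ▷ 𝟙_ C ⊗≫ 𝟙 (ob X ⊗ 𝟙_ C)) ≫
          (ρ_ (ob X)).hom ≫ (λ_ (ob X)).inv ≫ (ρ_ _).inv := by
      monoidal
    rw [h4, ← h2]
    monoidal
  exact (MonoidalCategory.whiskerRight_iff _ _).1 h3

/-- Naturality of the half-braiding for a morphism `𝟙 ⟶ U ⊗ V`. -/
theorem hb_point (X : Center C) {U V : C} (f : 𝟙_ C ⟶ U ⊗ V) :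
    ob X ◁ f ⊗≫ hb X U ▷ V ⊗≫ U ◁ hb X V = 𝟙 _ ⊗≫ f ▷ ob X ⊗≫ 𝟙 (U ⊗ V ⊗ ob X) := by
  have h := hb_natural X f
  rw [hb_tensor, hb_unit] at h
  calc
    _ = (ob X ◁ f ≫ 𝟙 _ ⊗≫ hb X U ▷ V ⊗≫ U ◁ hb X V ⊗≫ 𝟙 _) ≫ (α_ _ _ _).hom := by monoidal
    _ = _ := by rw [h]; monoidal

/-- Naturality of the half-braiding for a morphism `U ⊗ V ⟶ 𝟙`. -/
theorem hb_copoint (X : Center C) {U V : C} (f : U ⊗ V ⟶ 𝟙_ C) :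
    hb X U ▷ V ⊗≫ U ◁ hb X V ⊗≫ f ▷ ob X = 𝟙 _ ⊗≫ ob X ◁ f ⊗≫ 𝟙 (𝟙_ C ⊗ ob X) := by
  have h := hb_natural X f
  rw [hb_tensor, hb_unit] at h
  calc
    _ = (α_ _ _ _).hom ≫ ((𝟙 _ ⊗≫ hb X U ▷ V ⊗≫ U ◁ hb X V ⊗≫ 𝟙 _) ≫ f ▷ ob X) := by monoidal
    _ = _ := by rw [← h]; monoidal

/-- Naturality of the half-braiding with respect to itself (the Yang-Baxter equation). -/
theorem hb_yb (X Y : Center C) (U : C) :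
    ob X ◁ hb Y U ⊗≫ hb X U ▷ ob Y ⊗≫ U ◁ hb X (ob Y) =
      𝟙 _ ⊗≫ hb X (ob Y) ▷ U ⊗≫ ob Y ◁ hb X U ⊗≫ hb Y U ▷ ob X ⊗≫ 𝟙 _ := by
  have h := hb_natural X (hb Y U)
  rw [hb_tensor, hb_tensor] at h
  calc
    _ = (ob X ◁ hb Y U ≫ 𝟙 _ ⊗≫ hb X U ▷ ob Y ⊗≫ U ◁ hb X (ob Y) ⊗≫ 𝟙 _) ≫ (α_ _ _ _).hom := by
      monoidal
    _ = _ := by rw [h]; monoidal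

theorem hbInv_copoint (X : Center C) {U V : C} (f : U ⊗ V ⟶ 𝟙_ C) :
    𝟙 ((U ⊗ ob X) ⊗ V) ⊗≫ hbInv X U ▷ V ⊗≫ ob X ◁ f ⊗≫ 𝟙 (ob X) =
      𝟙 ((U ⊗ ob X) ⊗ V) ⊗≫ U ◁ hb X V ⊗≫ f ▷ ob X ⊗≫ 𝟙 (ob X) := by
  have h := hb_copoint X f
  calc
    _ = 𝟙 _ ⊗≫ hbInv X U ▷ V ⊗≫
          (𝟙 ((ob X ⊗ U) ⊗ V) ⊗≫ ob X ◁ f ⊗≫ 𝟙 (𝟙_ C ⊗ ob X)) ⊗≫ 𝟙 (ob X) := by monoidal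
    _ = 𝟙 _ ⊗≫ (hbInv X U ≫ hb X U) ▷ V ⊗≫ U ◁ hb X V ⊗≫ f ▷ ob X ⊗≫ 𝟙 (ob X) := by
      rw [← h]; monoidal
    _ = _ := by rw [Iso.inv_hom_id]; monoidal

end HalfBraidings

section Algebra
variable {C : Type u} [Category.{v} C] [MonoidalCategory C]

/-- The unit `𝟙 ⟶ A`. -/
def unitMor (A : Center C) [MonObj A] : 𝟙_ C ⟶ ob A := (MonObj.one (X := A)).f

/-- The multiplication `A ⊗ A ⟶ A`. -/
def mulMor (A : Center C) [MonObj A] : ob A ⊗ ob A ⟶ ob A := (MonObj.mul (X := A)).f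

/-- The algebra in `C` underlying an algebra `(A, σ)` in the Drinfeld centre. -/
abbrev alg (A : Center C) [MonObj A] : Mon C where
  X := ob A
  mon :=
    { one := unitMor A
      mul := mulMor A
      one_mul := congrArg Center.Hom.f (MonObj.one_mul A)
      mul_one := congrArg Center.Hom.f (MonObj.mul_one A)
      mul_assoc := congrArg Center.Hom.f (MonObj.mul_assoc A) }

theorem hb_mul_comm (A : Center C) [MonObj A] [IsCommMonObj A] :
    hb A (ob A) ≫ mulMor A = mulMor A :=
  congrArg Center.Hom.f (IsCommMonObj.mul_comm A)

theorem hb_mul (A : Center C) [MonObj A] (U : C) :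
    mulMor A ▷ U ≫ hb A U = 𝟙 _ ⊗≫ ob A ◁ hb A U ⊗≫ hb A U ▷ ob A ⊗≫ U ◁ mulMor A := by
  have h := (MonObj.mul (X := A)).comm U
  rw [Center.tensor_β] at h
  have h' : mulMor A ▷ U ≫ hb A U = ((α_ (ob A) (ob A) U).hom ≫ ob A ◁ hb A U ≫
    (α_ (ob A) U (ob A)).inv ≫ hb A U ▷ ob A ≫ (α_ U (ob A) (ob A)).hom) ≫ U ◁ mulMor A := h
  rw [h']
  monoidal

theorem hb_one (A : Center C) [MonObj A] (U : C) :
    unitMor A ▷ U ≫ hb A U = (λ_ U).hom ≫ (ρ_ U).inv ≫ U ◁ unitMor A := by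
  have h := (MonObj.one (X := A)).comm U
  refine h.trans ?_
  rw [Center.tensorUnit_β]
  exact Category.assoc _ _ _

end Algebra


section TensorOver
variable {C : Type u} [Category.{v} C] [MonoidalCategory C] [RigidCategory C] [HasCoequalizers C]
  {A : Mon C}

/-- The projection `π_{M,N} : M ⊗ N ⟶ M ⊗_A N`. -/
def tp (M N : Bimod A A) : M.X ⊗ N.X ⟶ (M ⊗ N).X :=
  coequalizer.π (M.actRight ▷ N.X) ((α_ _ _ _).hom ≫ M.X ◁ N.actLeft)

instance (M N : Bimod A A) : Epi (tp M N) :=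
  inferInstanceAs (Epi (coequalizer.π _ _))

instance {X Y : C} (f : X ⟶ Y) [Epi f] (Z : C) : Epi (Z ◁ f) :=
  inferInstanceAs (Epi ((tensorLeft Z).map f))

instance {X Y : C} (f : X ⟶ Y) [Epi f] (Z : C) : Epi (f ▷ Z) :=
  inferInstanceAs (Epi ((tensorRight Z).map f))

theorem tp_condition (M N : Bimod A A) :
    M.actRight ▷ N.X ≫ tp M N = (α_ _ _ _).hom ≫ M.X ◁ N.actLeft ≫ tp M N :=
  (coequalizer.condition _ _).trans (Category.assoc _ _ _)

theorem tp_actLeft (M N : Bimod A A) :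
    A.X ◁ tp M N ≫ (M ⊗ N).actLeft = (α_ _ _ _).inv ≫ M.actLeft ▷ N.X ≫ tp M N :=
  Bimod.TensorBimod.whiskerLeft_π_actLeft M N

theorem tp_actRight (M N : Bimod A A) :
    tp M N ▷ A.X ≫ (M ⊗ N).actRight = (α_ _ _ _).hom ≫ M.X ◁ N.actRight ≫ tp M N :=
  Bimod.TensorBimod.π_tensor_id_actRight M N

theorem tp_whiskerLeft (M : Bimod A A) {N N' : Bimod A A} (f : N ⟶ N') :
    tp M N ≫ (M ◁ f).hom = M.X ◁ f.hom ≫ tp M N' :=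
  ι_colimMap _ WalkingParallelPair.one

theorem tp_whiskerRight {M M' : Bimod A A} (f : M ⟶ M') (N : Bimod A A) :
    tp M N ≫ (f ▷ N).hom = f.hom ▷ N.X ≫ tp M' N :=
  ι_colimMap _ WalkingParallelPair.one

theorem tp_associator (M N P : Bimod A A) :
    tp M N ▷ P.X ≫ tp (M ⊗ N) P ≫ (α_ M N P).hom.hom =
      (α_ M.X N.X P.X).hom ≫ M.X ◁ tp N P ≫ tp M (N ⊗ P) := by
  have h : tp (M ⊗ N) P ≫ (α_ M N P).hom.hom = Bimod.AssociatorBimod.homAux M N P :=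
    coequalizer.π_desc _ _
  rw [h]
  exact π_tensor_id_preserves_coequalizer_inv_desc _ _ _ _

theorem tp_leftUnitor (M : Bimod A A) :
    tp (𝟙_ (Bimod A A)) M ≫ (λ_ M).hom.hom = M.actLeft :=
  coequalizer.π_desc _ _

theorem tp_rightUnitor (M : Bimod A A) :
    tp M (𝟙_ (Bimod A A)) ≫ (ρ_ M).hom.hom = M.actRight :=
  coequalizer.π_desc _ _

/-- `π_{M,N}` is a coequalizer. -/
def tpIsColimit (M N : Bimod A A) : IsColimit (Cofork.ofπ (tp M N)
    ((tp_condition M N).trans (Category.assoc _ _ _).symm)) :=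
  coequalizerIsCoequalizer _ _

end TensorOver

section CSigma
variable {C : Type u} [Category.{v} C] [MonoidalCategory C] [RigidCategory C] [HasCoequalizers C]
  (A : Center C) [MonObj A]

/-- The bimodules whose left action is `a^l = a^r ∘ σ_M`. -/
def sigmaProp : ObjectProperty (Bimod (alg A) (alg A)) :=
  fun M => M.actLeft = hb A M.X ≫ M.actRight

theorem sigmaProp_iff (M : Bimod (alg A) (alg A)) :
    sigmaProp A M ↔ M.actLeft = hb A M.X ≫ M.actRight := Iff.rfl

instance [IsCommMonObj A] : (sigmaProp A).IsMonoidal where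
  prop_unit := (hb_mul_comm A).symm
  prop_tensor M N hM hN := by
    rw [sigmaProp_iff] at *
    rw [← cancel_epi ((alg A).X ◁ tp M N), tp_actLeft]
    have h1 : (alg A).X ◁ tp M N ≫ hb A (M ⊗ N).X = hb A (M.X ⊗ N.X) ≫ tp M N ▷ ob A :=
      hb_natural A (tp M N)
    rw [reassoc_of% h1]
    have h2 : tp M N ▷ ob A ≫ (M ⊗ N).actRight = _ := tp_actRight M N
    rw [h2, hM, comp_whiskerRight, Category.assoc, tp_condition, hN, hb_tensor]
    simp only [whiskerLeft_comp]
    monoidal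

/-- The monoidal category `C_A^σ` of right `A`-modules `M`, seen as `A`-bimodules with left
action `a^l = a^r ∘ σ_M`; a full monoidal subcategory of `_AC_A`. -/
abbrev CSigma [IsCommMonObj A] := (sigmaProp A).FullSubcategory

end CSigma

section Drinfeld
variable {C : Type u} [Category.{v} C] [MonoidalCategory C]

/-- The chosen pairing of `X` and `X*`. -/
abbrev exL [RightRigidCategory C] (X : C) : ExactPairing X (ldual X) := HasRightDual.exact

/-- The composite `𝟙 ⟶ X ⊗ X* ⟶ X* ⊗ X` of the coevaluation and the half-braiding. -/
def coevHat [RightRigidCategory C] (X : Center C) : 𝟙_ C ⟶ ldual (ob X) ⊗ ob X :=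
  η_ (ob X) (ldual (ob X)) ≫ hb X (ldual (ob X))

/-- The inverse `X** ⟶ X** ⊗ X ⊗ X* ⟶ X ⊗ X** ⊗ X* ⟶ X` of the Drinfeld isomorphism, where the
middle morphism is the inverse of the half-braiding `σ_{X**}`. -/
def drinfeldInv [RightRigidCategory C] (X : Center C) : dd (ob X) ⟶ ob X :=
  (ρ_ _).inv ≫ dd (ob X) ◁ η_ (ob X) (ldual (ob X)) ≫ (α_ _ _ _).inv ≫
    hbInv X (dd (ob X)) ▷ ldual (ob X) ≫ (α_ _ _ _).hom ≫
      ob X ◁ ε_ (ldual (ob X)) (dd (ob X)) ≫ (ρ_ _).hom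

theorem drinfeldInv_eq [RightRigidCategory C] (X : Center C) :
    drinfeldInv X = (ρ_ _).inv ≫ dd (ob X) ◁ coevHat X ≫ (α_ _ _ _).inv ≫
      ε_ (ldual (ob X)) (dd (ob X)) ▷ ob X ≫ (λ_ _).hom := by
  have h := hbInv_copoint X (ε_ (ldual (ob X)) (dd (ob X)))
  calc
    _ = (ρ_ _).inv ≫ dd (ob X) ◁ η_ (ob X) (ldual (ob X)) ⊗≫
          (𝟙 ((dd (ob X) ⊗ ob X) ⊗ ldual (ob X)) ⊗≫ hbInv X (dd (ob X)) ▷ ldual (ob X) ⊗≫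
            ob X ◁ ε_ (ldual (ob X)) (dd (ob X)) ⊗≫ 𝟙 (ob X)) := by
      rw [drinfeldInv]; monoidal
    _ = _ := by
      rw [h, coevHat]; monoidal

theorem mate_comp_drinfeldInv [RightRigidCategory C] (X : Center C) {Z R : C}
    (p : ExactPairing R Z) (k : ldual (ob X) ⟶ R) :
    mate (exL (ldual (ob X))) p k ≫ drinfeldInv X =
      𝟙 _ ⊗≫ Z ◁ (η_ (ob X) (ldual (ob X)) ≫ ob X ◁ k ≫ hb X R) ⊗≫ ε_ R Z ▷ ob X ⊗≫ 𝟙 _ := by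
  have h : mate (exL (ldual (ob X))) p k ▷ ldual (ob X) ≫ ε_ (ldual (ob X)) (dd (ob X)) =
      Z ◁ k ≫ ε_ R Z := mate_ev _ _ _
  calc
    _ = 𝟙 _ ⊗≫ (mate (exL (ldual (ob X))) p k ▷ 𝟙_ C ≫ _ ◁ coevHat X) ⊗≫
          ε_ (ldual (ob X)) (dd (ob X)) ▷ ob X ⊗≫ 𝟙 _ := by
      rw [drinfeldInv_eq]; monoidal
    _ = 𝟙 _ ⊗≫ Z ◁ coevHat X ⊗≫
          (mate (exL (ldual (ob X))) p k ▷ ldual (ob X) ≫ ε_ (ldual (ob X)) (dd (ob X))) ▷ ob X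
          ⊗≫ 𝟙 _ := by
      rw [← whisker_exchange]; monoidal
    _ = _ := by
      rw [h, hb_natural, coevHat]; monoidal

theorem exists_comp_drinfeldInv [RigidCategory C] (X : Center C) :
    ∃ h : ob X ⟶ dd (ob X), h ≫ drinfeldInv X = 𝟙 _ := by
  let R : C := HasLeftDual.leftDual (ob X)
  let p : ExactPairing R (ob X) := HasLeftDual.exact
  let s : 𝟙_ C ⟶ ob X ⊗ R := η_ R (ob X) ≫ hbInv X R
  let k : ldual (ob X) ⟶ R := 𝟙 _ ⊗≫ ldual (ob X) ◁ s ⊗≫ ε_ (ob X) (ldual (ob X)) ▷ R ⊗≫ 𝟙 _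
  have hk : η_ (ob X) (ldual (ob X)) ≫ ob X ◁ k = s := by
    calc
      _ = 𝟙 _ ⊗≫ (η_ (ob X) (ldual (ob X)) ▷ 𝟙_ C ≫ _ ◁ s) ⊗≫
          ob X ◁ ε_ (ob X) (ldual (ob X)) ▷ R ⊗≫ 𝟙 _ := by
        simp only [k]; monoidal
      _ = 𝟙 _ ⊗≫ s ⊗≫ (η_ (ob X) (ldual (ob X)) ▷ ob X ⊗≫
          ob X ◁ ε_ (ob X) (ldual (ob X))) ▷ R ⊗≫ 𝟙 _ := by
        rw [← whisker_exchange]; monoidal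
      _ = _ := by
        rw [ExactPairing.evaluation_coevaluation'']; monoidal
  refine ⟨mate (exL (ldual (ob X))) p k, ?_⟩
  have hs : s ≫ hb X R = η_ R (ob X) := by simp [s]
  rw [mate_comp_drinfeldInv, reassoc_of% hk, hs]
  calc
    _ = 𝟙 _ ⊗≫ (ob X ◁ η_ R (ob X) ⊗≫ ε_ R (ob X) ▷ ob X) ⊗≫ 𝟙 _ := by monoidal
    _ = _ := by rw [ExactPairing.coevaluation_evaluation'']; monoidal

theorem coev_ext {X X' Z : C} (p : ExactPairing X X') {g h : X' ⟶ Z}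
    (w : η_ X X' ≫ X ◁ g = η_ X X' ≫ X ◁ h) : g = h := by
  have key : ∀ k : X' ⟶ Z, k = 𝟙 _ ⊗≫ X' ◁ (η_ X X' ≫ X ◁ k) ⊗≫ ε_ X X' ▷ Z ⊗≫ 𝟙 _ := by
    intro k
    calc k = 𝟙 X' ⊗≫ (X' ◁ η_ X X' ⊗≫ ε_ X X' ▷ X') ⊗≫ k := by
          rw [ExactPairing.coevaluation_evaluation'']; monoidal
      _ = 𝟙 _ ⊗≫ X' ◁ η_ X X' ⊗≫ (ε_ X X' ▷ X' ≫ _ ◁ k) ⊗≫ 𝟙 _ := by monoidal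
      _ = _ := by rw [← whisker_exchange]; monoidal
  rw [key g, key h, w]

theorem coev_comp_ext {X X' W : C} (p : ExactPairing X X') {g h : 𝟙_ C ⟶ X ⊗ W}
    (w : 𝟙 X' ⊗≫ X' ◁ g ⊗≫ ε_ X X' ▷ W ⊗≫ 𝟙 W = 𝟙 X' ⊗≫ X' ◁ h ⊗≫ ε_ X X' ▷ W ⊗≫ 𝟙 W) : g = h := by
  have key : ∀ k : 𝟙_ C ⟶ X ⊗ W, k = η_ X X' ⊗≫
      X ◁ (𝟙 X' ⊗≫ X' ◁ k ⊗≫ ε_ X X' ▷ W ⊗≫ 𝟙 W) := by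
    intro k
    symm
    calc
      _ = 𝟙 _ ⊗≫ (η_ X X' ▷ 𝟙_ C ≫ _ ◁ k) ⊗≫ X ◁ ε_ X X' ▷ W ⊗≫ 𝟙 _ := by monoidal
      _ = 𝟙 _ ⊗≫ k ⊗≫ (η_ X X' ▷ X ⊗≫ X ◁ ε_ X X') ▷ W ⊗≫ 𝟙 _ := by
        rw [← whisker_exchange]; monoidal
      _ = _ := by rw [ExactPairing.evaluation_coevaluation'']; monoidal
  rw [key g, key h, w]

theorem comp_drinfeldInv_injective [RightRigidCategory C] (X : Center C) {Z R : C}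
    (p : ExactPairing R Z) {g h : Z ⟶ dd (ob X)} (w : g ≫ drinfeldInv X = h ≫ drinfeldInv X) :
    g = h := by
  obtain ⟨g, rfl⟩ := mate_surjective (exL (ldual (ob X))) p g
  obtain ⟨h, rfl⟩ := mate_surjective (exL (ldual (ob X))) p h
  rw [mate_comp_drinfeldInv, mate_comp_drinfeldInv] at w
  have := coev_comp_ext p w
  rw [← Category.assoc, ← Category.assoc, cancel_mono] at this
  rw [coev_ext _ this]

instance [RigidCategory C] (X : Center C) : IsIso (drinfeldInv X) := by
  obtain ⟨h, hh⟩ := exists_comp_drinfeldInv X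
  refine ⟨h, comp_drinfeldInv_injective X (HasLeftDual.exact : ExactPairing
    (HasLeftDual.leftDual (dd (ob X))) (dd (ob X))) ?_, hh⟩
  rw [Category.assoc, hh, Category.comp_id, Category.id_comp]

/-- The Drinfeld isomorphism `u : X ⟶ X**` of the Drinfeld centre, with respect to the braiding
`c_{(X, σ), (Y, τ)} = τ_X⁻¹`; see `drinfeld_eq`. -/
def drinfeld [RigidCategory C] (X : Center C) : ob X ⟶ dd (ob X) := inv (drinfeldInv X)

/-- The half-braiding `X* ⊗ U ⟶ X* ⊗ U ⊗ X ⊗ X* ⟶ X* ⊗ X ⊗ U ⊗ X* ⟶ U ⊗ X*` of the dual of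
`X = (X, σ)` in the Drinfeld centre. -/
def dualHb [RightRigidCategory C] (X : Center C) (U : C) :
    ldual (ob X) ⊗ U ⟶ U ⊗ ldual (ob X) :=
  𝟙 _ ⊗≫ (ldual (ob X) ⊗ U) ◁ η_ (ob X) (ldual (ob X)) ⊗≫
    ldual (ob X) ◁ hbInv X U ▷ ldual (ob X) ⊗≫ ε_ (ob X) (ldual (ob X)) ▷ (U ⊗ ldual (ob X)) ⊗≫ 𝟙 _

theorem dualHb_natural [RightRigidCategory C] (X : Center C) {U V : C} (f : U ⟶ V) :
    dualHb X U ≫ f ▷ ldual (ob X) = ldual (ob X) ◁ f ≫ dualHb X V := by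
  have h : hbInv X U ≫ ob X ◁ f = f ▷ ob X ≫ hbInv X V := by
    rw [Iso.inv_comp_eq, ← Category.assoc, ← hb_natural, Category.assoc, Iso.hom_inv_id,
      Category.comp_id]
  calc
    _ = 𝟙 _ ⊗≫ (ldual (ob X) ⊗ U) ◁ η_ (ob X) (ldual (ob X)) ⊗≫
          ldual (ob X) ◁ hbInv X U ▷ ldual (ob X) ⊗≫ (ε_ (ob X) (ldual (ob X)) ▷ _ ≫
          𝟙_ C ◁ (f ▷ ldual (ob X))) ⊗≫ 𝟙 _ := by rw [dualHb]; monoidal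
    _ = 𝟙 _ ⊗≫ (ldual (ob X) ⊗ U) ◁ η_ (ob X) (ldual (ob X)) ⊗≫
          ldual (ob X) ◁ (hbInv X U ≫ ob X ◁ f) ▷ ldual (ob X) ⊗≫
          ε_ (ob X) (ldual (ob X)) ▷ (V ⊗ ldual (ob X)) ⊗≫ 𝟙 _ := by
      rw [← whisker_exchange]; monoidal
    _ = 𝟙 _ ⊗≫ ((ldual (ob X) ⊗ U) ◁ η_ (ob X) (ldual (ob X)) ≫ (ldual (ob X) ◁ f) ▷ _) ⊗≫
          ldual (ob X) ◁ hbInv X V ▷ ldual (ob X) ⊗≫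
          ε_ (ob X) (ldual (ob X)) ▷ (V ⊗ ldual (ob X)) ⊗≫ 𝟙 _ := by
      rw [h]; monoidal
    _ = _ := by
      rw [whisker_exchange, dualHb]; monoidal

theorem dualHb_drinfeld [RigidCategory C] (X : Center C) :
    dualHb X (ob X) ≫ drinfeld X ▷ ldual (ob X) ≫ ε_ (ldual (ob X)) (dd (ob X)) =
      ε_ (ob X) (ldual (ob X)) := by
  have h : drinfeldInv X ≫ drinfeld X = 𝟙 _ := IsIso.hom_inv_id _
  rw [← Category.assoc, dualHb_natural, ← cancel_epi (ldual (ob X) ◁ drinfeldInv X),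
    ← Category.assoc, ← whiskerLeft_comp_assoc, h, whiskerLeft_id, Category.id_comp]
  symm
  calc
    _ = 𝟙 _ ⊗≫ (ldual (ob X) ⊗ dd (ob X)) ◁ η_ (ob X) (ldual (ob X)) ⊗≫
          ldual (ob X) ◁ hbInv X (dd (ob X)) ▷ ldual (ob X) ⊗≫
          ((ldual (ob X) ⊗ ob X) ◁ ε_ (ldual (ob X)) (dd (ob X)) ≫
            ε_ (ob X) (ldual (ob X)) ▷ 𝟙_ C) ⊗≫ 𝟙 _ := by
      rw [drinfeldInv]; monoidal
    _ = _ := by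
      rw [whisker_exchange, dualHb]; monoidal

/-- `u` is given by the usual formula `X ⟶ X ⊗ X* ⊗ X** ⟶ X* ⊗ X ⊗ X** ⟶ X**` for the braiding
`c_{(X, σ), (Y, τ)} = τ_X⁻¹` of the Drinfeld centre. -/
theorem drinfeld_eq [RigidCategory C] (X : Center C)
    (t : ob X ⊗ ldual (ob X) ⟶ ldual (ob X) ⊗ ob X) (ht : t ≫ dualHb X (ob X) = 𝟙 _) :
    drinfeld X = (ρ_ _).inv ≫ ob X ◁ η_ (ldual (ob X)) (dd (ob X)) ≫ (α_ _ _ _).inv ≫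
      t ▷ dd (ob X) ≫ ε_ (ob X) (ldual (ob X)) ▷ dd (ob X) ≫ (λ_ _).hom := by
  apply ev_ext (exL (ldual (ob X)))
  have h := dualHb_drinfeld X
  have h2 : drinfeld X ▷ ldual (ob X) ≫ ε_ (ldual (ob X)) (dd (ob X)) =
      t ≫ ε_ (ob X) (ldual (ob X)) := by
    rw [← h, reassoc_of% ht]
  rw [h2]
  symm
  calc
    _ = 𝟙 _ ⊗≫ ob X ◁ η_ (ldual (ob X)) (dd (ob X)) ▷ ldual (ob X) ⊗≫
          ((t ≫ ε_ (ob X) (ldual (ob X))) ▷ (dd (ob X) ⊗ ldual (ob X)) ≫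
            𝟙_ C ◁ ε_ (ldual (ob X)) (dd (ob X))) ⊗≫ 𝟙 _ := by monoidal
    _ = 𝟙 _ ⊗≫ ob X ◁ (η_ (ldual (ob X)) (dd (ob X)) ▷ ldual (ob X) ⊗≫
          ldual (ob X) ◁ ε_ (ldual (ob X)) (dd (ob X))) ⊗≫
          (t ≫ ε_ (ob X) (ldual (ob X))) ⊗≫ 𝟙 _ := by
      rw [← whisker_exchange]; monoidal
    _ = _ := by
      rw [ExactPairing.evaluation_coevaluation'']; monoidal

end Drinfeld

section DrinfeldProps
variable {C : Type u} [Category.{v} C] [MonoidalCategory C]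

theorem coev_mate {X X' Y Y' : C} (p : ExactPairing X X') (q : ExactPairing Y Y') (f : X ⟶ Y) :
    η_ Y Y' ≫ Y ◁ mate p q f = η_ X X' ≫ f ▷ X' :=
  @coevaluation_comp_rightAdjointMate C _ _ X Y ⟨X'⟩ ⟨Y'⟩ f

theorem pairTensor_coev {X X' Y Y' : C} (p : ExactPairing X X') (q : ExactPairing Y Y') :
    @ExactPairing.coevaluation _ _ _ (X ⊗ Y) (Y' ⊗ X') (pairTensor p q) =
      𝟙 _ ⊗≫ η_ X X' ⊗≫ X ◁ (η_ Y Y' ▷ X') ⊗≫ 𝟙 _ := by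
  have h : @ExactPairing.coevaluation _ _ _ (X ⊗ Y) (Y' ⊗ X') (pairTensor p q) =
    η_ X X' ⊗≫ (X ◁ η_ Y Y') ▷ X' ⊗≫ 𝟙 _ := rfl
  rw [h]; monoidal

variable [RightRigidCategory C]

theorem coevHat_mul (A : Center C) [MonObj A] [IsCommMonObj A] :
    η_ (ob A) (ldual (ob A)) ⊗≫ ob A ◁ (η_ (ob A) (ldual (ob A)) ▷ ldual (ob A)) ⊗≫
      ob A ◁ hb A (ldual (ob A) ⊗ ldual (ob A)) ⊗≫
      hb A (ldual (ob A) ⊗ ldual (ob A)) ▷ ob A ⊗≫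
      (ldual (ob A) ⊗ ldual (ob A)) ◁ mulMor A =
    coevHat A ⊗≫ ldual (ob A) ◁ (coevHat A ▷ ob A) ⊗≫
      (ldual (ob A) ⊗ ldual (ob A)) ◁ mulMor A := by
  set a := ob A with ha
  set b := ldual a with hb'
  have hH : η_ a b ≫ hb A b = coevHat A := rfl
  have L1 : a ◁ coevHat A ⊗≫ hb A b ▷ a ⊗≫ 𝟙 (b ⊗ a ⊗ a) =
      𝟙 _ ⊗≫ coevHat A ▷ a ⊗≫ b ◁ hbInv A a := by
    rw [← cancel_mono (b ◁ hb A a)]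
    have := hb_point A (coevHat A)
    calc
      _ = a ◁ coevHat A ⊗≫ hb A b ▷ a ⊗≫ b ◁ hb A a := by monoidal
      _ = 𝟙 _ ⊗≫ coevHat A ▷ a ⊗≫ b ◁ (hbInv A a ≫ hb A a) := by
        rw [this, Iso.inv_hom_id]; monoidal
      _ = _ := by monoidal
  calc
    _ = η_ a b ⊗≫ a ◁ (η_ a b ≫ hb A b) ▷ b ⊗≫ ((a ⊗ b) ◁ hb A b ≫ hb A b ▷ (b ⊗ a)) ⊗≫
          b ◁ (hb A b ▷ a) ⊗≫ (b ⊗ b) ◁ mulMor A := by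
      rw [hb_tensor]; monoidal
    _ = η_ a b ⊗≫ (a ◁ coevHat A ⊗≫ hb A b ▷ a ⊗≫ 𝟙 (b ⊗ a ⊗ a)) ▷ b ⊗≫ b ◁ a ◁ hb A b ⊗≫
          b ◁ (hb A b ▷ a) ⊗≫ (b ⊗ b) ◁ mulMor A := by
      rw [whisker_exchange, hH]; monoidal
    _ = 𝟙 _ ⊗≫ (𝟙_ C ◁ η_ a b ≫ coevHat A ▷ (a ⊗ b)) ⊗≫ b ◁ hbInv A a ▷ b ⊗≫
          b ◁ a ◁ hb A b ⊗≫ b ◁ (hb A b ▷ a) ⊗≫ (b ⊗ b) ◁ (hb A a ≫ mulMor A) := by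
      rw [L1, hb_mul_comm]; monoidal
    _ = 𝟙 _ ⊗≫ coevHat A ⊗≫ b ◁ a ◁ η_ a b ⊗≫ b ◁ hbInv A a ▷ b ⊗≫
          b ◁ (a ◁ hb A b ⊗≫ hb A b ▷ a ⊗≫ b ◁ hb A a) ⊗≫ (b ⊗ b) ◁ mulMor A := by
      rw [whisker_exchange]; monoidal
    _ = 𝟙 _ ⊗≫ coevHat A ⊗≫ b ◁ a ◁ η_ a b ⊗≫ b ◁ (hbInv A a ≫ hb A a) ▷ b ⊗≫
          b ◁ a ◁ hb A b ⊗≫ b ◁ hb A b ▷ a ⊗≫ (b ⊗ b) ◁ mulMor A := by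
      rw [hb_yb]; monoidal
    _ = 𝟙 _ ⊗≫ coevHat A ⊗≫ b ◁ a ◁ (η_ a b ≫ hb A b) ⊗≫ b ◁ hb A b ▷ a ⊗≫
          (b ⊗ b) ◁ (hb A a ≫ mulMor A) := by
      rw [Iso.inv_hom_id, hb_mul_comm]; monoidal
    _ = 𝟙 _ ⊗≫ coevHat A ⊗≫ b ◁ (a ◁ coevHat A ⊗≫ hb A b ▷ a ⊗≫ b ◁ hb A a) ⊗≫
          (b ⊗ b) ◁ mulMor A := by
      rw [hH]; monoidal
    _ = _ := by
      rw [hb_point]; monoidal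

theorem dd_mul_drinfeldInv (A : Center C) [MonObj A] [IsCommMonObj A] :
    (ddTensor (ob A) (ob A)).hom ≫ ddMap (mulMor A) ≫ drinfeldInv A =
      (drinfeldInv A ⊗ₘ drinfeldInv A) ≫ mulMor A := by
  set a := ob A with ha
  set b := ldual a with hb'
  have h : (ddTensor a a).hom ≫ ddMap (mulMor A) =
      mate (exL (ldual (ob A))) (pairTensor (exL b) (exL b))
        (mate (pairTensor (exL a) (exL a)) (exL a) (mulMor A)) := by
    have := (DDual.map_comp ((ddual a).tensor (ddual a)) (ddual (a ⊗ a)) (ddual a)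
      (𝟙 _) (mulMor A)).symm
    rw [Category.id_comp] at this
    exact this
  rw [reassoc_of% h, mate_comp_drinfeldInv]
  have h2 := coev_mate (pairTensor (exL a) (exL a)) (exL a) (mulMor A)
  rw [pairTensor_coev] at h2
  rw [reassoc_of% h2, hb_mul, pairTensor_ev]
  calc
    _ = 𝟙 _ ⊗≫ (dd a ⊗ dd a) ◁ (η_ a b ⊗≫ a ◁ (η_ a b ▷ b) ⊗≫ a ◁ hb A (b ⊗ b) ⊗≫
      hb A (b ⊗ b) ▷ a ⊗≫ (b ⊗ b) ◁ mulMor A) ⊗≫ dd a ◁ (ε_ b (dd a) ▷ b) ▷ a ⊗≫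
      ε_ b (dd a) ▷ a ⊗≫ 𝟙 _ := by monoidal
    _ = _ := by
      rw [coevHat_mul]
      symm
      calc
        _ = 𝟙 _ ⊗≫ dd a ◁ (dd a ◁ coevHat A ⊗≫ ε_ b (dd a) ▷ a) ⊗≫
            (dd a ◁ coevHat A ⊗≫ ε_ b (dd a) ▷ a) ▷ a ⊗≫ mulMor A := by
          rw [tensorHom_def', drinfeldInv_eq]; monoidal
        _ = 𝟙 _ ⊗≫ dd a ◁ dd a ◁ coevHat A ⊗≫ dd a ◁ (ε_ b (dd a) ▷ a ≫ 𝟙_ C ◁ (𝟙 _ ⊗≫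
              coevHat A ▷ a)) ⊗≫ (ε_ b (dd a) ▷ (a ⊗ a) ≫ 𝟙_ C ◁ mulMor A) ⊗≫ 𝟙 _ := by
          monoidal
        _ = 𝟙 _ ⊗≫ dd a ◁ dd a ◁ (coevHat A ⊗≫ b ◁ (coevHat A ▷ a)) ⊗≫
              dd a ◁ (ε_ b (dd a) ▷ (b ⊗ a ⊗ a) ≫ 𝟙_ C ◁ (b ◁ mulMor A)) ⊗≫
              ε_ b (dd a) ▷ a ⊗≫ 𝟙 _ := by
          rw [← whisker_exchange, ← whisker_exchange]; monoidal
        _ = _ := by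
          rw [← whisker_exchange]; monoidal

theorem dd_one_drinfeldInv (A : Center C) [MonObj A] :
    ddUnit.hom ≫ ddMap (unitMor A) ≫ drinfeldInv A = unitMor A := by
  set a := ob A with ha
  have h : ddUnit.hom ≫ ddMap (unitMor A) =
      mate (exL (ldual (ob A))) exactPairingUnit
        (mate exactPairingUnit (exL a) (unitMor A)) := by
    have := (DDual.map_comp DDual.unit (ddual (𝟙_ C)) (ddual a)
      (𝟙 _) (unitMor A)).symm
    rw [Category.id_comp] at this
    exact this
  have h2 := coev_mate exactPairingUnit (exL a) (unitMor A)
  have e1 : ε_ (𝟙_ C) (𝟙_ C) = (ρ_ _).hom := rfl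
  have e2 : η_ (𝟙_ C) (𝟙_ C) = (ρ_ _).inv := rfl
  rw [reassoc_of% h, mate_comp_drinfeldInv, reassoc_of% h2, hb_one, e1, e2]
  monoidal

theorem mate_hb (A : Center C) (V : C) :
    η_ (ob A) (ldual (ob A)) ▷ ldual V ⊗≫
      ob A ◁ mate (pairTensor (exL (ob A)) (exL V)) (pairTensor (exL V) (exL (ob A))) (hb A V) ⊗≫
        hb A (ldual V) ▷ ldual (ob A) ⊗≫ 𝟙 (ldual V ⊗ ob A ⊗ ldual (ob A)) =
      𝟙 _ ⊗≫ ldual V ◁ η_ (ob A) (ldual (ob A)) := by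
  set a := ob A with ha
  have h2 := coev_mate (pairTensor (exL a) (exL V)) (pairTensor (exL V) (exL a)) (hb A V)
  set s := mate (pairTensor (exL a) (exL V)) (pairTensor (exL V) (exL a)) (hb A V) with hs
  rw [pairTensor_coev, pairTensor_coev] at h2
  have w : η_ V (ldual V) ≫ V ◁ ((λ_ _).inv ≫ (η_ a (ldual a) ▷ ldual V ⊗≫
      a ◁ s ⊗≫ hb A (ldual V) ▷ ldual a ⊗≫ 𝟙 (ldual V ⊗ a ⊗ ldual a))) =
      η_ V (ldual V) ≫ V ◁ ((λ_ _).inv ≫ (𝟙 _ ⊗≫ ldual V ◁ η_ a (ldual a))) := by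
    calc
      _ = ((𝟙 _ ⊗≫ η_ V (ldual V) ⊗≫ V ◁ (η_ a (ldual a) ▷ ldual V) ⊗≫ 𝟙 _) ≫
          (V ⊗ a) ◁ s) ⊗≫ V ◁ hb A (ldual V) ▷ ldual a ⊗≫ 𝟙 _ := by monoidal
      _ = η_ a (ldual a) ⊗≫ (a ◁ η_ V (ldual V) ⊗≫ hb A V ▷ ldual V ⊗≫ V ◁ hb A (ldual V)) ▷
            ldual a ⊗≫ 𝟙 _ := by rw [h2]; monoidal
      _ = 𝟙 _ ⊗≫ (𝟙_ C ◁ η_ a (ldual a) ≫ η_ V (ldual V) ▷ (a ⊗ ldual a)) ⊗≫ 𝟙 _ := by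
        rw [hb_point]; monoidal
      _ = _ := by
        rw [whisker_exchange]; monoidal
  have := coev_ext (exL V) w
  exact (cancel_epi _).1 this


theorem dd_hb_drinfeldInv (A : Center C) (V : C) :
    (ddTensor (ob A) V).hom ≫ ddMap (hb A V) ≫ (ddTensor V (ob A)).inv ≫ dd V ◁ drinfeldInv A =
      drinfeldInv A ▷ dd V ≫ hb A (dd V) := by
  set a := ob A with ha
  set b := ldual a with hb'
  set s := mate (pairTensor (exL a) (exL V)) (pairTensor (exL V) (exL a)) (hb A V) with hs
  set T := mate (pairTensor (exL b) (exL (ldual V))) (pairTensor (exL (ldual V)) (exL b)) s with hT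
  have h : (ddTensor a V).hom ≫ ddMap (hb A V) ≫ (ddTensor V a).inv = T := by
    have e1 := (DDual.map_comp ((ddual a).tensor (ddual V)) (ddual (a ⊗ V)) (ddual (V ⊗ a))
      (𝟙 _) (hb A V)).symm
    have e2 := (DDual.map_comp ((ddual a).tensor (ddual V)) (ddual (V ⊗ a))
      ((ddual V).tensor (ddual a)) (hb A V) (𝟙 _)).symm
    rw [Category.id_comp] at e1
    rw [Category.comp_id, ← e1, Category.assoc] at e2
    exact e2
  have hT2 : T ▷ (b ⊗ ldual V) ≫ (𝟙 _ ⊗≫ dd V ◁ (ε_ b (dd a) ▷ ldual V) ⊗≫ ε_ (ldual V) (dd V)) =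
      (dd a ⊗ dd V) ◁ s ≫ (𝟙 _ ⊗≫ dd a ◁ (ε_ (ldual V) (dd V) ▷ b) ⊗≫ ε_ b (dd a)) :=
    mate_ev (pairTensor (exL b) (exL (ldual V))) (pairTensor (exL (ldual V)) (exL b)) s
  have hsV : η_ a b ▷ ldual V ⊗≫ a ◁ s ⊗≫ hb A (ldual V) ▷ b ⊗≫ 𝟙 (ldual V ⊗ a ⊗ b) =
      𝟙 _ ⊗≫ ldual V ◁ η_ a b := mate_hb A V
  have hH : η_ a b ≫ hb A b = coevHat A := rfl
  have L2 : 𝟙 ((dd V ⊗ a) ⊗ ldual V) ⊗≫ hbInv A (dd V) ▷ ldual V ⊗≫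
      a ◁ ε_ (ldual V) (dd V) ⊗≫ 𝟙 a =
      𝟙 ((dd V ⊗ a) ⊗ ldual V) ⊗≫ dd V ◁ hb A (ldual V) ⊗≫ ε_ (ldual V) (dd V) ▷ a ⊗≫ 𝟙 a :=
    hbInv_copoint A (ε_ (ldual V) (dd V))
  have L3 : 𝟙 (ldual V) ⊗≫ η_ a b ▷ ldual V ⊗≫ hb A b ▷ ldual V ⊗≫ b ◁ hb A (ldual V) ⊗≫ s ▷ a =
      𝟙 (ldual V) ⊗≫ ldual V ◁ coevHat A ⊗≫ 𝟙 ((ldual V ⊗ b) ⊗ a) := by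
    have := hb_natural A s
    rw [hb_tensor, hb_tensor] at this
    calc
      _ = 𝟙 _ ⊗≫ η_ a b ▷ ldual V ⊗≫ ((𝟙 (a ⊗ b ⊗ ldual V) ⊗≫ hb A b ▷ ldual V ⊗≫ b ◁ hb A (ldual V) ⊗≫ 𝟙 _)
            ≫ s ▷ a) := by monoidal
      _ = 𝟙 _ ⊗≫ (η_ a b ▷ ldual V ⊗≫ a ◁ s ⊗≫ hb A (ldual V) ▷ b ⊗≫ 𝟙 (ldual V ⊗ a ⊗ b)) ⊗≫
            ldual V ◁ hb A b ⊗≫ 𝟙 _ := by rw [← this]; monoidal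
      _ = _ := by rw [hsV, ← hH]; monoidal
  rw [reassoc_of% h, ← cancel_mono (hbInv A (dd V)), Category.assoc, Category.assoc,
    Iso.hom_inv_id, Category.comp_id]
  have key : 𝟙 ((dd a ⊗ dd V) ⊗ ldual V) ⊗≫ (T ≫ dd V ◁ drinfeldInv A ≫ hbInv A (dd V)) ▷ ldual V ⊗≫
      a ◁ ε_ (ldual V) (dd V) ⊗≫ 𝟙 a =
      𝟙 ((dd a ⊗ dd V) ⊗ ldual V) ⊗≫ drinfeldInv A ▷ (dd V ⊗ ldual V) ⊗≫ a ◁ ε_ (ldual V) (dd V) ⊗≫ 𝟙 a := by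
    calc
      _ = 𝟙 _ ⊗≫ T ▷ ldual V ⊗≫ dd V ◁ drinfeldInv A ▷ ldual V ⊗≫
            (𝟙 ((dd V ⊗ a) ⊗ ldual V) ⊗≫ hbInv A (dd V) ▷ ldual V ⊗≫ a ◁ ε_ (ldual V) (dd V) ⊗≫ 𝟙 a) := by
        monoidal
      _ = 𝟙 _ ⊗≫ T ▷ ldual V ⊗≫ dd V ◁ dd a ◁ coevHat A ▷ ldual V ⊗≫
            dd V ◁ (ε_ b (dd a) ▷ (a ⊗ ldual V) ≫ 𝟙_ C ◁ hb A (ldual V)) ⊗≫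
            ε_ (ldual V) (dd V) ▷ a ⊗≫ 𝟙 a := by
        rw [L2, drinfeldInv_eq]; monoidal
      _ = 𝟙 _ ⊗≫ (T ▷ ldual V ≫ (dd V ⊗ dd a) ◁ (𝟙 (ldual V) ⊗≫ η_ a b ▷ ldual V ⊗≫
            hb A b ▷ ldual V ⊗≫ b ◁ hb A (ldual V) ⊗≫ 𝟙 ((b ⊗ ldual V) ⊗ a))) ⊗≫
            (𝟙 ((dd V ⊗ dd a) ⊗ (b ⊗ ldual V)) ⊗≫ dd V ◁ (ε_ b (dd a) ▷ ldual V) ⊗≫ ε_ (ldual V) (dd V)) ▷ a ⊗≫ 𝟙 a := by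
        rw [← whisker_exchange, ← hH]; monoidal
      _ = 𝟙 _ ⊗≫ (dd a ⊗ dd V) ◁ (𝟙 (ldual V) ⊗≫ η_ a b ▷ ldual V ⊗≫
            hb A b ▷ ldual V ⊗≫ b ◁ hb A (ldual V) ⊗≫ 𝟙 ((b ⊗ ldual V) ⊗ a)) ⊗≫
            (T ▷ (b ⊗ ldual V) ≫ (𝟙 ((dd V ⊗ dd a) ⊗ (b ⊗ ldual V)) ⊗≫ dd V ◁ (ε_ b (dd a) ▷ ldual V) ⊗≫
              ε_ (ldual V) (dd V))) ▷ a ⊗≫ 𝟙 a := by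
        rw [← whisker_exchange]; monoidal
      _ = 𝟙 _ ⊗≫ (dd a ⊗ dd V) ◁ (𝟙 (ldual V) ⊗≫ η_ a b ▷ ldual V ⊗≫
            hb A b ▷ ldual V ⊗≫ b ◁ hb A (ldual V) ⊗≫ s ▷ a) ⊗≫
            (𝟙 ((dd a ⊗ dd V) ⊗ (ldual V ⊗ b)) ⊗≫ dd a ◁ (ε_ (ldual V) (dd V) ▷ b) ⊗≫ ε_ b (dd a)) ▷ a ⊗≫ 𝟙 a := by
        rw [hT2]; monoidal
      _ = 𝟙 _ ⊗≫ dd a ◁ ((dd V ⊗ ldual V) ◁ coevHat A ≫ ε_ (ldual V) (dd V) ▷ (b ⊗ a)) ⊗≫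
            ε_ b (dd a) ▷ a ⊗≫ 𝟙 a := by
        rw [L3]; monoidal
      _ = 𝟙 _ ⊗≫ (dd a ◁ ε_ (ldual V) (dd V) ≫ drinfeldInv A ▷ 𝟙_ C) ⊗≫ 𝟙 a := by
        rw [whisker_exchange, drinfeldInv_eq]; monoidal
      _ = _ := by
        rw [whisker_exchange]; monoidal
  have inj : ∀ f : dd a ⊗ dd V ⟶ a ⊗ dd V, f = 𝟙 _ ⊗≫ (dd a ⊗ dd V) ◁ η_ (ldual V) (dd V) ⊗≫
      (𝟙 ((dd a ⊗ dd V) ⊗ ldual V) ⊗≫ f ▷ ldual V ⊗≫ a ◁ ε_ (ldual V) (dd V) ⊗≫ 𝟙 a) ▷ dd V ⊗≫ 𝟙 _ := by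
    intro f
    symm
    calc
      _ = 𝟙 _ ⊗≫ ((dd a ⊗ dd V) ◁ η_ (ldual V) (dd V) ≫ f ▷ _) ⊗≫
            a ◁ ε_ (ldual V) (dd V) ▷ dd V ⊗≫ 𝟙 _ := by monoidal
      _ = f ⊗≫ a ◁ (dd V ◁ η_ (ldual V) (dd V) ⊗≫ ε_ (ldual V) (dd V) ▷ dd V) ⊗≫ 𝟙 _ := by
        rw [whisker_exchange]; monoidal
      _ = _ := by rw [ExactPairing.coevaluation_evaluation'']; monoidal
  rw [inj (T ≫ _), inj (drinfeldInv A ▷ _), key]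
  congr 3
  monoidal

end DrinfeldProps

section Twist
variable {C : Type u} [Category.{v} C] [MonoidalCategory C] [RigidCategory C]

instance (X : Center C) : IsIso (drinfeld X) := inferInstanceAs (IsIso (inv _))

theorem mul_drinfeld (A : Center C) [MonObj A] [IsCommMonObj A] :
    mulMor A ≫ drinfeld A = (drinfeld A ⊗ₘ drinfeld A) ≫ (ddTensor (ob A) (ob A)).hom ≫
      ddMap (mulMor A) := by
  have h : drinfeld A ≫ drinfeldInv A = 𝟙 _ := IsIso.inv_hom_id _
  rw [← cancel_mono (drinfeldInv A), Category.assoc, h, Category.comp_id, Category.assoc,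
    Category.assoc, dd_mul_drinfeldInv, tensorHom_comp_tensorHom_assoc, h, id_tensorHom_id,
    Category.id_comp]

theorem one_drinfeld (A : Center C) [MonObj A] :
    unitMor A ≫ drinfeld A = ddUnit.hom ≫ ddMap (unitMor A) := by
  have h : drinfeld A ≫ drinfeldInv A = 𝟙 _ := IsIso.inv_hom_id _
  rw [← cancel_mono (drinfeldInv A), Category.assoc, h, Category.comp_id, Category.assoc,
    dd_one_drinfeldInv]

theorem drinfeld_hb (A : Center C) (V : C) :
    drinfeld A ▷ dd V ≫ (ddTensor (ob A) V).hom ≫ ddMap (hb A V) =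
      hb A (dd V) ≫ dd V ◁ drinfeld A ≫ (ddTensor V (ob A)).hom := by
  have h : drinfeld A ≫ drinfeldInv A = 𝟙 _ := IsIso.inv_hom_id _
  have h' : drinfeldInv A ≫ drinfeld A = 𝟙 _ := IsIso.hom_inv_id _
  have h3 := dd_hb_drinfeldInv A V
  have h4 : (ddTensor (ob A) V).hom ≫ ddMap (hb A V) =
      drinfeldInv A ▷ dd V ≫ hb A (dd V) ≫ dd V ◁ drinfeld A ≫ (ddTensor V (ob A)).hom := by
    rw [← reassoc_of% h3, ← whiskerLeft_comp_assoc, h', whiskerLeft_id, Category.id_comp,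
      Iso.inv_hom_id, Category.comp_id]
  rw [h4, ← comp_whiskerRight_assoc, h, id_whiskerRight, Category.id_comp]

variable (A : Center C) [MonObj A] [IsCommMonObj A]

/-- The left `A`-action on `M**` twisted by `u`. -/
def twistLeft (M : Bimod (alg A) (alg A)) : ob A ⊗ dd M.X ⟶ dd M.X :=
  drinfeld A ▷ dd M.X ≫ (ddTensor (ob A) M.X).hom ≫ ddMap M.actLeft

/-- The right `A`-action on `M**` twisted by `u`. -/
def twistRight (M : Bimod (alg A) (alg A)) : dd M.X ⊗ ob A ⟶ dd M.X :=
  dd M.X ◁ drinfeld A ≫ (ddTensor M.X (ob A)).hom ≫ ddMap M.actRight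

theorem twist_one_actLeft (M : Bimod (alg A) (alg A)) :
    unitMor A ▷ dd M.X ≫ twistLeft A M = (λ_ _).hom := by
  have h : unitMor A ▷ M.X ≫ M.actLeft = (λ_ M.X).hom := M.one_actLeft
  rw [twistLeft, ← comp_whiskerRight_assoc, one_drinfeld, comp_whiskerRight_assoc,
    ddTensor_natural_left_assoc, ← ddMap_comp, h, dd_left_unitality]

theorem twist_actRight_one (M : Bimod (alg A) (alg A)) :
    dd M.X ◁ unitMor A ≫ twistRight A M = (ρ_ _).hom := by
  have h : M.X ◁ unitMor A ≫ M.actRight = (ρ_ M.X).hom := M.actRight_one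
  rw [twistRight, ← whiskerLeft_comp_assoc, one_drinfeld, whiskerLeft_comp_assoc,
    ddTensor_natural_right_assoc, ← ddMap_comp, h, dd_right_unitality]

theorem twist_left_assoc (M : Bimod (alg A) (alg A)) :
    mulMor A ▷ dd M.X ≫ twistLeft A M =
      (α_ _ _ _).hom ≫ ob A ◁ twistLeft A M ≫ twistLeft A M := by
  have h : mulMor A ▷ M.X ≫ M.actLeft =
    (α_ (ob A) (ob A) M.X).hom ≫ ob A ◁ M.actLeft ≫ M.actLeft := M.left_assoc
  have hT := ddTensor_associativity (ob A) (ob A) M.X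
  calc
    _ = (drinfeld A ⊗ₘ drinfeld A) ▷ dd M.X ≫ (ddTensor (ob A) (ob A)).hom ▷ dd M.X ≫
          (ddTensor (ob A ⊗ ob A) M.X).hom ≫ ddMap (mulMor A ▷ M.X ≫ M.actLeft) := by
      rw [twistLeft, ← comp_whiskerRight_assoc, mul_drinfeld, ddMap_comp,
        ← ddTensor_natural_left_assoc]
      simp only [comp_whiskerRight, Category.assoc]
    _ = (drinfeld A ⊗ₘ drinfeld A) ▷ dd M.X ≫ (α_ _ _ _).hom ≫ dd (ob A) ◁ (ddTensor (ob A) M.X).hom ≫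
          (ddTensor (ob A) (ob A ⊗ M.X)).hom ≫ ddMap (ob A ◁ M.actLeft) ≫ ddMap M.actLeft := by
      rw [h, ddMap_comp, ddMap_comp, reassoc_of% hT]
    _ = (α_ _ _ _).hom ≫ ob A ◁ (drinfeld A ▷ dd M.X) ≫ drinfeld A ▷ (dd (ob A) ⊗ dd M.X) ≫
          dd (ob A) ◁ ((ddTensor (ob A) M.X).hom ≫ ddMap M.actLeft) ≫ (ddTensor (ob A) M.X).hom ≫
          ddMap M.actLeft := by
      rw [← ddTensor_natural_right_assoc, MonoidalCategory.tensorHom_def']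
      simp
    _ = (α_ _ _ _).hom ≫ ob A ◁ (drinfeld A ▷ dd M.X) ≫
          (ob A ◁ ((ddTensor (ob A) M.X).hom ≫ ddMap M.actLeft) ≫ drinfeld A ▷ _) ≫
          (ddTensor (ob A) M.X).hom ≫ ddMap M.actLeft := by
      rw [whisker_exchange]; simp only [Category.assoc]
    _ = _ := by
      simp only [twistLeft, whiskerLeft_comp, Category.assoc]

theorem twist_right_assoc (M : Bimod (alg A) (alg A)) :
    dd M.X ◁ mulMor A ≫ twistRight A M =
      (α_ _ _ _).inv ≫ twistRight A M ▷ ob A ≫ twistRight A M := by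
  have h : M.X ◁ mulMor A ≫ M.actRight =
    (α_ M.X (ob A) (ob A)).inv ≫ M.actRight ▷ ob A ≫ M.actRight := M.right_assoc
  have hT := ddTensor_associativity M.X (ob A) (ob A)
  calc
    _ = dd M.X ◁ (drinfeld A ⊗ₘ drinfeld A) ≫ dd M.X ◁ (ddTensor (ob A) (ob A)).hom ≫
          (ddTensor M.X (ob A ⊗ ob A)).hom ≫ ddMap (M.X ◁ mulMor A ≫ M.actRight) := by
      rw [twistRight, ← whiskerLeft_comp_assoc, mul_drinfeld, ddMap_comp,
        ← ddTensor_natural_right_assoc]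
      simp only [whiskerLeft_comp, Category.assoc]
    _ = dd M.X ◁ (drinfeld A ⊗ₘ drinfeld A) ≫ (α_ _ _ _).inv ≫ ((α_ _ _ _).hom ≫
          dd M.X ◁ (ddTensor (ob A) (ob A)).hom ≫ (ddTensor M.X (ob A ⊗ ob A)).hom) ≫
          ddMap ((α_ M.X (ob A) (ob A)).inv ≫ M.actRight ▷ ob A ≫ M.actRight) := by
      rw [h]; simp only [Category.assoc, Iso.inv_hom_id_assoc]
    _ = dd M.X ◁ (drinfeld A ⊗ₘ drinfeld A) ≫ (α_ _ _ _).inv ≫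
          (ddTensor M.X (ob A)).hom ▷ dd (ob A) ≫ (ddTensor (M.X ⊗ ob A) (ob A)).hom ≫
          ddMap (M.actRight ▷ ob A) ≫ ddMap M.actRight := by
      rw [← hT]
      simp only [Category.assoc]
      rw [← ddMap_comp, Iso.hom_inv_id_assoc, ddMap_comp]
    _ = (α_ _ _ _).inv ≫ (dd M.X ◁ drinfeld A) ▷ ob A ≫ (dd M.X ⊗ dd (ob A)) ◁ drinfeld A ≫
          ((ddTensor M.X (ob A)).hom ≫ ddMap M.actRight) ▷ dd (ob A) ≫
          (ddTensor M.X (ob A)).hom ≫ ddMap M.actRight := by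
      rw [← ddTensor_natural_left_assoc, MonoidalCategory.tensorHom_def]
      simp
    _ = (α_ _ _ _).inv ≫ (dd M.X ◁ drinfeld A) ▷ ob A ≫
          (((ddTensor M.X (ob A)).hom ≫ ddMap M.actRight) ▷ ob A ≫ _ ◁ drinfeld A) ≫
          (ddTensor M.X (ob A)).hom ≫ ddMap M.actRight := by
      rw [← whisker_exchange]; simp only [Category.assoc]
    _ = _ := by
      simp only [twistRight, comp_whiskerRight, Category.assoc]

theorem twist_middle_assoc (M : Bimod (alg A) (alg A)) :
    twistLeft A M ▷ ob A ≫ twistRight A M =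
      (α_ _ _ _).hom ≫ ob A ◁ twistRight A M ≫ twistLeft A M := by
  have h : M.actLeft ▷ ob A ≫ M.actRight =
    (α_ (ob A) M.X (ob A)).hom ≫ ob A ◁ M.actRight ≫ M.actLeft := M.middle_assoc
  have hT := ddTensor_associativity (ob A) M.X (ob A)
  calc
    _ = drinfeld A ▷ dd M.X ▷ ob A ≫ (((ddTensor (ob A) M.X).hom ≫ ddMap M.actLeft) ▷ ob A ≫
          _ ◁ drinfeld A) ≫ (ddTensor M.X (ob A)).hom ≫ ddMap M.actRight := by
      simp only [twistRight, twistLeft, comp_whiskerRight, Category.assoc]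
    _ = drinfeld A ▷ dd M.X ▷ ob A ≫ _ ◁ drinfeld A ≫ (ddTensor (ob A) M.X).hom ▷ dd (ob A) ≫
          (ddTensor (ob A ⊗ M.X) (ob A)).hom ≫ ddMap (M.actLeft ▷ ob A ≫ M.actRight) := by
      rw [← whisker_exchange, ddMap_comp, ← ddTensor_natural_left_assoc]
      simp only [comp_whiskerRight, Category.assoc]
    _ = drinfeld A ▷ dd M.X ▷ ob A ≫ _ ◁ drinfeld A ≫ (α_ _ _ _).hom ≫
          dd (ob A) ◁ ((ddTensor M.X (ob A)).hom ≫ ddMap M.actRight) ≫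
          (ddTensor (ob A) M.X).hom ≫ ddMap M.actLeft := by
      rw [h, ddMap_comp, ddMap_comp, reassoc_of% hT, ← ddTensor_natural_right_assoc]
      simp only [whiskerLeft_comp, Category.assoc]
    _ = (α_ _ _ _).hom ≫ (drinfeld A ▷ (dd M.X ⊗ ob A) ≫ dd (ob A) ◁ (dd M.X ◁ drinfeld A ≫
          (ddTensor M.X (ob A)).hom ≫ ddMap M.actRight)) ≫
          (ddTensor (ob A) M.X).hom ≫ ddMap M.actLeft := by
      simp
    _ = _ := by
      rw [← whisker_exchange]
      simp only [twistRight, twistLeft, Category.assoc]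

/-- The bimodule `(M**)_(u)`: the double dual `M**` with its `A**`-actions restricted along
`u : A ⟶ A**`. -/
abbrev twist (M : Bimod (alg A) (alg A)) : Bimod (alg A) (alg A) where
  X := dd M.X
  actLeft := twistLeft A M
  actRight := twistRight A M
  one_actLeft := twist_one_actLeft A M
  left_assoc := twist_left_assoc A M
  actRight_one := twist_actRight_one A M
  right_assoc := twist_right_assoc A M
  middle_assoc := twist_middle_assoc A M

end Twist

section TwistFunctor
variable {C : Type u} [Category.{v} C] [MonoidalCategory C] [RigidCategory C] [HasCoequalizers C]
  (A : Center C) [MonObj A] [IsCommMonObj A]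

/-- The morphism `f**` of twisted bimodules. -/
def twistMap {M N : Bimod (alg A) (alg A)} (f : M ⟶ N) : twist A M ⟶ twist A N where
  hom := ddMap f.hom
  left_act_hom := by
    have h : M.actLeft ≫ f.hom = ob A ◁ f.hom ≫ N.actLeft := f.left_act_hom
    change twistLeft A M ≫ _ = ob A ◁ _ ≫ twistLeft A N
    simp only [twistLeft, Category.assoc]
    rw [← ddMap_comp, h, ddMap_comp, ← ddTensor_natural_right_assoc, whisker_exchange_assoc]
  right_act_hom := by
    have h : M.actRight ≫ f.hom = f.hom ▷ ob A ≫ N.actRight := f.right_act_hom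
    change twistRight A M ≫ _ = _ ▷ ob A ≫ twistRight A N
    simp only [twistRight, Category.assoc]
    rw [← ddMap_comp, h, ddMap_comp, ← ddTensor_natural_left_assoc, whisker_exchange_assoc]

theorem tensor_twist_condition (M N : Bimod (alg A) (alg A)) :
    (twist A M).actRight ▷ (twist A N).X ≫ (ddTensor M.X N.X).hom ≫ ddMap (tp M N) =
      ((α_ _ _ _).hom ≫ (twist A M).X ◁ (twist A N).actLeft) ≫
        (ddTensor M.X N.X).hom ≫ ddMap (tp M N) := by
  change twistRight A M ▷ dd N.X ≫ _ = ((α_ (dd M.X) (ob A) (dd N.X)).hom ≫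
    dd M.X ◁ twistLeft A N) ≫ _
  have h : M.actRight ▷ N.X ≫ tp M N =
    (α_ M.X (ob A) N.X).hom ≫ M.X ◁ N.actLeft ≫ tp M N := tp_condition M N
  have hT := ddTensor_associativity M.X (ob A) N.X
  rw [twistRight, twistLeft]
  simp only [comp_whiskerRight, whiskerLeft_comp, Category.assoc]
  rw [ddTensor_natural_left_assoc, ddTensor_natural_right_assoc, ← ddMap_comp, ← ddMap_comp, h,
    ddMap_comp, reassoc_of% hT]
  simp

/-- The morphism `g_{M,N} : (M**)_(u) ⊗_A (N**)_(u) ⟶ ((M ⊗_A N)**)_(u)` on underlying objects,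
determined by `g_{M,N} ∘ π = π**`. -/
def twistTensorHom (M N : Bimod (alg A) (alg A)) :
    (twist A M ⊗ twist A N).X ⟶ dd (M ⊗ N).X :=
  Cofork.IsColimit.desc (tpIsColimit (twist A M) (twist A N)) _ (tensor_twist_condition A M N)

theorem tp_twistTensorHom (M N : Bimod (alg A) (alg A)) :
    tp (twist A M) (twist A N) ≫ twistTensorHom A M N =
      (ddTensor M.X N.X).hom ≫ ddMap (tp M N) :=
  Cofork.IsColimit.π_desc' (tpIsColimit (twist A M) (twist A N)) _ (tensor_twist_condition A M N)

instance (M N : Bimod (alg A) (alg A)) : IsIso (twistTensorHom A M N) := by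
  have w : ddMap (M.actRight ▷ N.X) ≫ ddMap (tp M N) =
      ddMap ((α_ _ _ _).hom ≫ M.X ◁ N.actLeft) ≫ ddMap (tp M N) := by
    rw [← ddMap_comp, ← ddMap_comp, tp_condition, Category.assoc]
  have hc : IsColimit (Cofork.ofπ (ddMap (tp M N)) w) :=
    isColimitCoforkMapOfIsColimit (doubleDual C) _ (tpIsColimit M N)
  have hw : ddMap (M.actRight ▷ N.X) ≫ (ddTensor M.X N.X).inv ≫ tp (twist A M) (twist A N) =
      ddMap ((α_ M.X (ob A) N.X).hom ≫ M.X ◁ N.actLeft) ≫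
        (ddTensor M.X N.X).inv ≫ tp (twist A M) (twist A N) := by
    rw [← cancel_epi (ddTensor (M.X ⊗ ob A) N.X).hom,
      ← cancel_epi ((ddTensor M.X (ob A)).hom ▷ dd N.X),
      ← cancel_epi ((dd M.X ◁ drinfeld A) ▷ dd N.X)]
    have h := tp_condition (twist A M) (twist A N)
    have hT := ddTensor_associativity M.X (ob A) N.X
    have h' : (dd M.X ◁ drinfeld A) ▷ dd N.X ≫ (ddTensor M.X (ob A)).hom ▷ dd N.X ≫
        ddMap M.actRight ▷ dd N.X ≫ tp (twist A M) (twist A N) =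
        (α_ (dd M.X) (ob A) (dd N.X)).hom ≫ dd M.X ◁ (drinfeld A ▷ dd N.X ≫
          (ddTensor (ob A) N.X).hom ≫ ddMap N.actLeft) ≫ tp (twist A M) (twist A N) := by
      rw [← comp_whiskerRight_assoc, ← comp_whiskerRight_assoc]
      simp only [Category.assoc]
      exact h
    rw [← ddTensor_natural_left_assoc, Iso.hom_inv_id_assoc, h', ddMap_comp, Category.assoc,
      reassoc_of% hT, ← ddTensor_natural_right_assoc, Iso.hom_inv_id_assoc]
    simp
  let g : dd (M ⊗ N).X ⟶ (twist A M ⊗ twist A N).X :=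
    Cofork.IsColimit.desc hc ((ddTensor M.X N.X).inv ≫ tp (twist A M) (twist A N)) hw
  have hg : ddMap (tp M N) ≫ g = (ddTensor M.X N.X).inv ≫ tp (twist A M) (twist A N) :=
    Cofork.IsColimit.π_desc' hc _ hw
  refine ⟨g, ?_, ?_⟩
  · rw [← cancel_epi (tp (twist A M) (twist A N)), ← Category.assoc, tp_twistTensorHom,
      Category.assoc, hg, Iso.hom_inv_id_assoc, Category.comp_id]
  · apply Cofork.IsColimit.hom_ext hc
    change ddMap (tp M N) ≫ _ = ddMap (tp M N) ≫ _
    rw [← Category.assoc, hg, Category.assoc, tp_twistTensorHom, Iso.inv_hom_id_assoc,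
      Category.comp_id]

end TwistFunctor

section TwistMonoidal
variable {C : Type u} [Category.{v} C] [MonoidalCategory C] [RigidCategory C] [HasCoequalizers C]
  (A : Center C) [MonObj A] [IsCommMonObj A]

theorem twistTensorHom_left (M N : Bimod (alg A) (alg A)) :
    (twist A M ⊗ twist A N).actLeft ≫ twistTensorHom A M N =
      ob A ◁ twistTensorHom A M N ≫ twistLeft A (M ⊗ N) := by
  rw [← cancel_epi (ob A ◁ tp (twist A M) (twist A N))]
  have h1 : ob A ◁ tp (twist A M) (twist A N) ≫ (twist A M ⊗ twist A N).actLeft =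
    (α_ (ob A) (dd M.X) (dd N.X)).inv ≫ twistLeft A M ▷ dd N.X ≫ tp (twist A M) (twist A N) :=
    tp_actLeft (twist A M) (twist A N)
  have h2 : ob A ◁ tp M N ≫ (M ⊗ N).actLeft =
    (α_ (ob A) M.X N.X).inv ≫ M.actLeft ▷ N.X ≫ tp M N := tp_actLeft M N
  have hT := ddTensor_associativity (ob A) M.X N.X
  rw [reassoc_of% h1, tp_twistTensorHom, ← whiskerLeft_comp_assoc, tp_twistTensorHom, twistLeft,
    twistLeft, whisker_exchange_assoc, whiskerLeft_comp, Category.assoc,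
    ddTensor_natural_right_assoc, ← ddMap_comp, h2]
  have h3 : dd (ob A) ◁ (ddTensor M.X N.X).hom ≫ (ddTensor (ob A) (M.X ⊗ N.X)).hom ≫
      ddMap (α_ (ob A) M.X N.X).inv = (α_ _ _ _).inv ≫ (ddTensor (ob A) M.X).hom ▷ dd N.X ≫
        (ddTensor (ob A ⊗ M.X) N.X).hom := by
    rw [← cancel_epi (α_ _ _ _).hom, ← reassoc_of% hT, ← ddMap_comp, Iso.hom_inv_id, ddMap_id,
      Category.comp_id, Iso.hom_inv_id_assoc]
  rw [ddMap_comp, reassoc_of% h3, ddMap_comp, ← ddTensor_natural_left_assoc]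
  simp

theorem twistTensorHom_right (M N : Bimod (alg A) (alg A)) :
    (twist A M ⊗ twist A N).actRight ≫ twistTensorHom A M N =
      twistTensorHom A M N ▷ ob A ≫ twistRight A (M ⊗ N) := by
  rw [← cancel_epi (tp (twist A M) (twist A N) ▷ ob A)]
  have h1 : tp (twist A M) (twist A N) ▷ ob A ≫ (twist A M ⊗ twist A N).actRight =
    (α_ (dd M.X) (dd N.X) (ob A)).hom ≫ dd M.X ◁ twistRight A N ≫ tp (twist A M) (twist A N) :=
    tp_actRight (twist A M) (twist A N)
  have h2 : tp M N ▷ ob A ≫ (M ⊗ N).actRight =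
    (α_ M.X N.X (ob A)).hom ≫ M.X ◁ N.actRight ≫ tp M N := tp_actRight M N
  have hT := ddTensor_associativity M.X N.X (ob A)
  rw [reassoc_of% h1, tp_twistTensorHom, ← comp_whiskerRight_assoc, tp_twistTensorHom, twistRight,
    twistRight, ← whisker_exchange_assoc, comp_whiskerRight, Category.assoc,
    ddTensor_natural_left_assoc, ← ddMap_comp, h2, ddMap_comp, reassoc_of% hT, ddMap_comp,
    ← ddTensor_natural_right_assoc]
  simp

/-- The isomorphism `g_{M,N} : (M**)_(u) ⊗_A (N**)_(u) ≅ ((M ⊗_A N)**)_(u)`. -/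
def twistTensor (M N : Bimod (alg A) (alg A)) : twist A M ⊗ twist A N ≅ twist A (M ⊗ N) :=
  Bimod.isoOfIso (asIso (twistTensorHom A M N)) (twistTensorHom_left A M N)
    (twistTensorHom_right A M N)

/-- The Drinfeld isomorphism as an isomorphism. -/
abbrev drinfeldIso (A : Center C) : ob A ≅ dd (ob A) := asIso (drinfeld A)

/-- The isomorphism `g_0 = u : A ≅ (A**)_(u)`. -/
def twistUnit : 𝟙_ (Bimod (alg A) (alg A)) ≅ twist A (𝟙_ (Bimod (alg A) (alg A))) :=
  Bimod.isoOfIso (P := Bimod.regular (alg A)) (Q := twist A (Bimod.regular (alg A)))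
    (drinfeldIso A)
    (by
      change mulMor A ≫ drinfeld A = ob A ◁ drinfeld A ≫ drinfeld A ▷ dd (ob A) ≫
        (ddTensor (ob A) (ob A)).hom ≫ ddMap (mulMor A)
      rw [mul_drinfeld, MonoidalCategory.tensorHom_def', Category.assoc])
    (by
      change mulMor A ≫ drinfeld A = drinfeld A ▷ ob A ≫ dd (ob A) ◁ drinfeld A ≫
        (ddTensor (ob A) (ob A)).hom ≫ ddMap (mulMor A)
      rw [mul_drinfeld, MonoidalCategory.tensorHom_def, Category.assoc])

/-- The functor `M ↦ (M**)_(u)` on bimodules. -/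
def twistFunctor : Bimod (alg A) (alg A) ⥤ Bimod (alg A) (alg A) where
  obj M := twist A M
  map f := twistMap A f
  map_id M := Bimod.hom_ext _ _ (ddMap_id M.X)
  map_comp f g := Bimod.hom_ext _ _ (ddMap_comp f.hom g.hom)

theorem twist_natural_left {M N : Bimod (alg A) (alg A)} (f : M ⟶ N) (P : Bimod (alg A) (alg A)) :
    twistMap A f ▷ twist A P ≫ (twistTensor A N P).hom =
      (twistTensor A M P).hom ≫ twistMap A (f ▷ P) := by
  apply Bimod.hom_ext
  change (twistMap A f ▷ twist A P).hom ≫ twistTensorHom A N P =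
    twistTensorHom A M P ≫ ddMap (f ▷ P).hom
  have e1 := tp_whiskerRight (twistMap A f) (twist A P)
  have e2 := tp_twistTensorHom A M P
  rw [← cancel_epi (tp (twist A M) (twist A P)), reassoc_of% e1, tp_twistTensorHom,
    reassoc_of% e2, ← ddMap_comp, tp_whiskerRight, ddMap_comp, ← ddTensor_natural_left_assoc]
  rfl

theorem twist_natural_right (P : Bimod (alg A) (alg A)) {M N : Bimod (alg A) (alg A)} (f : M ⟶ N) :
    twist A P ◁ twistMap A f ≫ (twistTensor A P N).hom =
      (twistTensor A P M).hom ≫ twistMap A (P ◁ f) := by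
  apply Bimod.hom_ext
  change (twist A P ◁ twistMap A f).hom ≫ twistTensorHom A P N =
    twistTensorHom A P M ≫ ddMap (P ◁ f).hom
  have e1 := tp_whiskerLeft (twist A P) (twistMap A f)
  have e2 := tp_twistTensorHom A P M
  rw [← cancel_epi (tp (twist A P) (twist A M)), reassoc_of% e1, tp_twistTensorHom,
    reassoc_of% e2, ← ddMap_comp, tp_whiskerLeft, ddMap_comp, ← ddTensor_natural_right_assoc]
  rfl

theorem twist_associativity (M N P : Bimod (alg A) (alg A)) :
    (twistTensor A M N).hom ▷ twist A P ≫ (twistTensor A (M ⊗ N) P).hom ≫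
        twistMap A (α_ M N P).hom =
      (α_ (twist A M) (twist A N) (twist A P)).hom ≫ twist A M ◁ (twistTensor A N P).hom ≫
        (twistTensor A M (N ⊗ P)).hom := by
  apply Bimod.hom_ext
  change ((twistTensor A M N).hom ▷ twist A P).hom ≫ twistTensorHom A (M ⊗ N) P ≫
      ddMap (α_ M N P).hom.hom = (α_ (twist A M) (twist A N) (twist A P)).hom.hom ≫
      (twist A M ◁ (twistTensor A N P).hom).hom ≫ twistTensorHom A M (N ⊗ P)
  have e1 := tp_whiskerRight (twistTensor A M N).hom (twist A P)
  have e2 := tp_twistTensorHom A (M ⊗ N) P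
  have e3 := tp_associator M N P
  have e4 := tp_associator (twist A M) (twist A N) (twist A P)
  have e5 := tp_whiskerLeft (twist A M) (twistTensor A N P).hom
  have e6 := tp_twistTensorHom A M (N ⊗ P)
  have e7 : tp (twist A M) (twist A N) ▷ dd P.X ≫ (twistTensor A M N).hom.hom ▷ dd P.X =
      ((ddTensor M.X N.X).hom ≫ ddMap (tp M N)) ▷ dd P.X := by
    rw [← comp_whiskerRight]; exact congrArg (· ▷ dd P.X) (tp_twistTensorHom A M N)
  have e8 : dd M.X ◁ tp (twist A N) (twist A P) ≫ dd M.X ◁ (twistTensor A N P).hom.hom =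
      dd M.X ◁ ((ddTensor N.X P.X).hom ≫ ddMap (tp N P)) := by
    rw [← whiskerLeft_comp]; exact congrArg (dd M.X ◁ ·) (tp_twistTensorHom A N P)
  have hT := ddTensor_associativity M.X N.X P.X
  rw [← cancel_epi (tp (twist A M ⊗ twist A N) (twist A P)),
    ← cancel_epi (tp (twist A M) (twist A N) ▷ dd P.X)]
  calc
    _ = ((ddTensor M.X N.X).hom ≫ ddMap (tp M N)) ▷ dd P.X ≫ (ddTensor _ P.X).hom ≫
          ddMap (tp (M ⊗ N) P) ≫ ddMap (α_ M N P).hom.hom := by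
      rw [← e7, reassoc_of% e1, reassoc_of% e2, Category.assoc]
    _ = ((ddTensor M.X N.X).hom ▷ dd P.X ≫ (ddTensor _ P.X).hom ≫ ddMap (α_ _ _ _).hom) ≫
          ddMap (M.X ◁ tp N P) ≫ ddMap (tp M (N ⊗ P)) := by
      rw [comp_whiskerRight, Category.assoc, ddTensor_natural_left_assoc, ← ddMap_comp,
        ← ddMap_comp, e3, ddMap_comp, ddMap_comp]
      simp only [Category.assoc]
    _ = (α_ _ _ _).hom ≫ dd M.X ◁ ((ddTensor N.X P.X).hom ≫ ddMap (tp N P)) ≫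
          (ddTensor _ _).hom ≫ ddMap (tp M (N ⊗ P)) := by
      rw [hT, whiskerLeft_comp, Category.assoc, Category.assoc, Category.assoc,
        ddTensor_natural_right_assoc]
    _ = _ := by
      rw [reassoc_of% e4, reassoc_of% e5, e6, ← e8, Category.assoc]

theorem twist_left_unitality (M : Bimod (alg A) (alg A)) :
    (λ_ (twist A M)).hom = (twistUnit A).hom ▷ twist A M ≫
      (twistTensor A (𝟙_ _) M).hom ≫ twistMap A (λ_ M).hom := by
  apply Bimod.hom_ext
  change (λ_ (twist A M)).hom.hom = ((twistUnit A).hom ▷ twist A M).hom ≫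
      twistTensorHom A (𝟙_ _) M ≫ ddMap (λ_ M).hom.hom
  have e1 := tp_whiskerRight (twistUnit A).hom (twist A M)
  have e2 := tp_twistTensorHom A (𝟙_ _) M
  rw [← cancel_epi (tp (𝟙_ _) (twist A M)), tp_leftUnitor, reassoc_of% e1, reassoc_of% e2,
    ← ddMap_comp, tp_leftUnitor]
  rfl

theorem twist_right_unitality (M : Bimod (alg A) (alg A)) :
    (ρ_ (twist A M)).hom = twist A M ◁ (twistUnit A).hom ≫
      (twistTensor A M (𝟙_ _)).hom ≫ twistMap A (ρ_ M).hom := by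
  apply Bimod.hom_ext
  change (ρ_ (twist A M)).hom.hom = (twist A M ◁ (twistUnit A).hom).hom ≫
      twistTensorHom A M (𝟙_ _) ≫ ddMap (ρ_ M).hom.hom
  have e1 := tp_whiskerLeft (twist A M) (twistUnit A).hom
  have e2 := tp_twistTensorHom A M (𝟙_ _)
  rw [← cancel_epi (tp (twist A M) (𝟙_ _)), tp_rightUnitor, reassoc_of% e1, reassoc_of% e2,
    ← ddMap_comp, tp_rightUnitor]
  rfl

theorem sigmaProp_twist (M : Bimod (alg A) (alg A)) (hM : sigmaProp A M) :
    sigmaProp A (twist A M) := by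
  change twistLeft A M = hb A (dd M.X) ≫ twistRight A M
  have h : M.actLeft = hb A M.X ≫ M.actRight := hM
  have h2 := drinfeld_hb A M.X
  rw [twistLeft, h, ddMap_comp, reassoc_of% h2, twistRight]

/-- The functor `M ↦ (M**)_(u)` on `C_A^σ`. -/
def G : CSigma A ⥤ CSigma A :=
  (sigmaProp A).lift ((sigmaProp A).ι ⋙ twistFunctor A) (fun M => sigmaProp_twist A M.1 M.2)

/-- The monoidal structure of `M ↦ (M**)_(u)`: the unit constraint is `u`, and the tensor
constraint is induced by `π_{M,N}**`. -/
instance : (G A).Monoidal := Functor.CoreMonoidal.toMonoidal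
  { εIso := (sigmaProp A).isoMk (twistUnit A)
    μIso := fun M N => (sigmaProp A).isoMk (twistTensor A M.1 N.1)
    μIso_hom_natural_left := fun f P =>
      ObjectProperty.hom_ext _ (twist_natural_left A f.hom P.1)
    μIso_hom_natural_right := fun P f =>
      ObjectProperty.hom_ext _ (twist_natural_right A P.1 f.hom)
    associativity := fun M N P => ObjectProperty.hom_ext _ (twist_associativity A M.1 N.1 P.1)
    left_unitality := fun M => ObjectProperty.hom_ext _ (twist_left_unitality A M.1)
    right_unitality := fun M => ObjectProperty.hom_ext _ (twist_right_unitality A M.1) }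

end TwistMonoidal

section Dagger
variable {C : Type u} [Category.{v} C] [MonoidalCategory C] [RigidCategory C] [HasCoequalizers C]
  (A : Center C) [MonObj A] [IsCommMonObj A]

/-- The morphism `A ⊗ M* ⟶ A ⊗ A* ⊗ M*` given by the dual of the right action of `M`. -/
def homLeft (M : CSigma A) :
    ob A ⊗ ldual M.obj.X ⟶ ob A ⊗ (ldual (ob A) ⊗ ldual M.obj.X) :=
  ob A ◁ mate (pairTensor (exL M.obj.X) (exL (ob A))) (exL M.obj.X) M.obj.actRight

/-- The morphism `A ⊗ M* ⟶ A ⊗ A ⊗ A* ⊗ M* ⟶ A ⊗ A* ⊗ M*` given by the coevaluation of `A` and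
the multiplication of `A`. -/
def homRight (M : CSigma A) :
    ob A ⊗ ldual M.obj.X ⟶ ob A ⊗ (ldual (ob A) ⊗ ldual M.obj.X) :=
  𝟙 _ ⊗≫ ob A ◁ η_ (ob A) (ldual (ob A)) ▷ ldual M.obj.X ⊗≫
    mulMor A ▷ (ldual (ob A) ⊗ ldual M.obj.X)

variable [RightRigidCategory (CSigma A)]

/-- The evaluation `M† ⊗ M ⟶ M† ⊗_A M ⟶ A`, for a left dual `M†` of `M` in `C_A^σ`. -/
def evDagger (M : CSigma A) : (ldual M).obj.X ⊗ M.obj.X ⟶ ob A :=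
  tp (ldual M).obj M.obj ≫ (ε_ M (ldual M)).hom.hom

/-- The morphism `i_M : M† ⟶ A ⊗ M*` of `C` corresponding to the evaluation. -/
def inclDagger (M : CSigma A) : (ldual M).obj.X ⟶ ob A ⊗ ldual M.obj.X :=
  𝟙 _ ⊗≫ (ldual M).obj.X ◁ η_ M.obj.X (ldual M.obj.X) ⊗≫ evDagger A M ▷ ldual M.obj.X

end Dagger

end

end BimodDual

open BimodDual

/-! The engine is one universal property. Let `p` be an exact pairing of bimodules `M`, `N`, with
evaluation e : N ⊗ M ⟶ N ⊗_A M ⟶ A. For every object Z of C, the assignment f ↦ e ∘ (f ⊗ M) is a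
bijection from morphisms Z ⟶ N of C to right linear morphisms Z ⊗ M ⟶ A; in other words N is the
internal Hom_A(M, A). The pairing itself only sees bimodule maps, so Z is replaced by the free
bimodule A ⊗ Z ⊗ A; this gives uniqueness (`evMor_ext`) and existence (`exists_whiskerRight_evMor`).

Rigidity: under e, the left action of N corresponds to a^r ∘ σ on M, because A is commutative, while
a^r ∘ σ on N corresponds to the left action of M, because e is balanced. Since e is nondegenerate on
both sides, M satisfies the σ-condition exactly when N does. So C_A^σ is closed under both kinds of
duals in _AC_A, and being full it inherits the pairings.

Equalizer: transposing Z ⊗ M ⟶ A to Z ⟶ A ⊗ M* turns right linearity into the equality of the two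
parallel composites, so the universal property above becomes that of the equalizer. From here on the
left duals M† in C_A^σ are an arbitrary choice.

Double dual: put j = σ_{M*} ∘ i_M : M† ⟶ M* ⊗ A (`daggerHom`) and pair its first leg with M** to get
`evTwist` : M** ⊗ M† ⟶ A. It is right linear because j is. For balancedness, the equalizer condition
together with σ produces σ_{A*} ∘ coev_A, and pairing A** with its first leg is ū, the inverse of u;
hence the action on M** that balances is the one restricted along u. Left linearity is automatic in
C_A^σ. The result is a morphism G(M) ⊗_A M† ⟶ A, that is, a natural morphism G(M) ⟶ M††. It is
monoidal because the pairing for M ⊗_A N is the nested one (`evTwist_tensor`) and the pairing for A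
composed with u is μ (`drinfeld_evTwist`). No inverse is built by hand: a monoidal transformation is
invertible at every object that has a dual (`isIso_app_of_isMonoidal`). -/

namespace BimodDual
noncomputable section

/-! ### Transposition along a dual, and its interaction with half-braidings. -/

section Transpose
variable {C : Type u} [Category.{v} C] [MonoidalCategory C]

/-- The morphism `N ⟶ K ⊗ X'` corresponding to `e : N ⊗ X ⟶ K` for a left dual `X'` of `X`. -/
def transpose {X X' : C} (p : ExactPairing X X') {N K : C} (e : N ⊗ X ⟶ K) : N ⟶ K ⊗ X' :=
  𝟙 _ ⊗≫ N ◁ η_ X X' ⊗≫ e ▷ X'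

theorem transpose_ev {X X' : C} (p : ExactPairing X X') {N K : C} (e : N ⊗ X ⟶ K) :
    transpose p e ▷ X ⊗≫ K ◁ ε_ X X' ⊗≫ 𝟙 K = e := by
  calc
    _ = 𝟙 _ ⊗≫ N ◁ η_ X X' ▷ X ⊗≫ (e ▷ (X' ⊗ X) ≫ K ◁ ε_ X X') ⊗≫ 𝟙 _ := by
      rw [transpose]; monoidal
    _ = 𝟙 _ ⊗≫ N ◁ (η_ X X' ▷ X ⊗≫ X ◁ ε_ X X') ⊗≫ e := by
      rw [← whisker_exchange]; monoidal
    _ = _ := by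
      rw [ExactPairing.evaluation_coevaluation'']; monoidal

theorem transpose_injective {X X' : C} (p : ExactPairing X X') {N K : C} {e e' : N ⊗ X ⟶ K}
    (h : transpose p e = transpose p e') : e = e' := by
  rw [← transpose_ev p e, h, transpose_ev]

theorem transpose_untranspose {X X' : C} (p : ExactPairing X X') {N K : C} (k : N ⟶ K ⊗ X') :
    transpose p (k ▷ X ⊗≫ K ◁ ε_ X X' ⊗≫ 𝟙 K) = k := by
  calc
    _ = 𝟙 _ ⊗≫ (N ◁ η_ X X' ≫ k ▷ _) ⊗≫ K ◁ ε_ X X' ▷ X' ⊗≫ 𝟙 _ := by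
      rw [transpose]; monoidal
    _ = k ⊗≫ K ◁ (X' ◁ η_ X X' ⊗≫ ε_ X X' ▷ X') ⊗≫ 𝟙 _ := by
      rw [whisker_exchange]; monoidal
    _ = _ := by
      rw [ExactPairing.coevaluation_evaluation'']; monoidal

theorem comp_transpose {X X' : C} (p : ExactPairing X X') {N N' K : C} (f : N' ⟶ N)
    (e : N ⊗ X ⟶ K) : f ≫ transpose p e = transpose p (f ▷ X ≫ e) := by
  calc
    _ = 𝟙 _ ⊗≫ (f ▷ _ ≫ N ◁ η_ X X') ⊗≫ e ▷ X' := by rw [transpose]; monoidal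
    _ = _ := by rw [← whisker_exchange, transpose]; monoidal

theorem transpose_comp {X X' : C} (p : ExactPairing X X') {N K K' : C}
    (e : N ⊗ X ⟶ K) (k : K ⟶ K') : transpose p e ≫ k ▷ X' = transpose p (e ≫ k) := by
  rw [transpose, transpose]; monoidal

/-- A dual morphism slides through the coevaluation and becomes the original morphism on the other
leg. -/
theorem transpose_mate {X X' Y Y' : C} (p : ExactPairing X X') (q : ExactPairing Y Y') {N K : C}
    (f : Y ⟶ X) (e : N ⊗ X ⟶ K) :
    transpose p e ≫ K ◁ mate q p f = transpose q (N ◁ f ≫ e) := by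
  have h := coev_mate q p f
  calc
    _ = 𝟙 _ ⊗≫ N ◁ η_ X X' ⊗≫ (e ▷ X' ≫ K ◁ mate q p f) := by rw [transpose]; monoidal
    _ = 𝟙 _ ⊗≫ N ◁ (η_ X X' ≫ X ◁ mate q p f) ⊗≫ e ▷ Y' := by
      rw [← whisker_exchange]; monoidal
    _ = _ := by rw [h, transpose]; monoidal

/-- Transposition across X ⊗ Y can be done in two stages when the morphism consumes X first and Y
afterwards. Both `homRight` and the dual of M ⊗_A N are analysed this way. -/
theorem transpose_tensor {X X' Y Y' : C} (p : ExactPairing X X') (q : ExactPairing Y Y')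
    {N L K : C} (d : N ⊗ X ⟶ L) (e : L ⊗ Y ⟶ K) :
    transpose (pairTensor p q) ((α_ _ _ _).inv ≫ d ▷ Y ≫ e) =
      transpose p d ≫ transpose q e ▷ X' ≫ (α_ _ _ _).hom := by
  calc
    _ = 𝟙 _ ⊗≫ N ◁ η_ X X' ⊗≫ ((N ⊗ X) ◁ η_ Y Y' ≫ d ▷ _) ▷ X' ⊗≫ e ▷ Y' ▷ X' ⊗≫ 𝟙 _ := by
      rw [transpose, pairTensor_coev]; monoidal
    _ = _ := by
      rw [whisker_exchange, transpose, transpose]; monoidal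

/-- Passing A through both legs of the coevaluation is trivial by naturality of σ, so passing it
through the first leg only is the inverse of passing it through the second. -/
theorem hb_coev (A : Center C) {X X' : C} (p : ExactPairing X X') :
    ob A ◁ η_ X X' ⊗≫ hb A X ▷ X' ⊗≫ 𝟙 (X ⊗ ob A ⊗ X') =
      𝟙 _ ⊗≫ η_ X X' ▷ ob A ⊗≫ X ◁ hbInv A X' ⊗≫ 𝟙 (X ⊗ ob A ⊗ X') := by
  have h := hb_point A (η_ X X')
  calc
    _ = (ob A ◁ η_ X X' ⊗≫ hb A X ▷ X' ⊗≫ X ◁ hb A X') ≫ X ◁ hbInv A X' := by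
      rw [← cancel_mono (X ◁ hb A X')]
      simp only [Category.assoc, ← whiskerLeft_comp, Iso.inv_hom_id]
      monoidal
    _ = _ := by rw [h]; monoidal

/-- Transposition exchanges σ at X with the inverse of σ at X'. This is how the σ-condition on M
becomes visible on M*. -/
theorem transpose_hb (A : Center C) {X X' : C} (p : ExactPairing X X') {N K : C}
    (e : N ⊗ X ⟶ K) :
    transpose p ((α_ _ _ _).hom ≫ N ◁ hb A X ≫ (α_ _ _ _).inv ≫ e ▷ ob A) =
      transpose p e ▷ ob A ≫ (α_ _ _ _).hom ≫ K ◁ hbInv A X' ≫ (α_ _ _ _).inv := by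
  have h := hb_coev A p
  calc
    _ = 𝟙 _ ⊗≫ N ◁ (ob A ◁ η_ X X' ⊗≫ hb A X ▷ X' ⊗≫ 𝟙 (X ⊗ ob A ⊗ X')) ⊗≫ e ▷ ob A ▷ X' := by
      rw [transpose]; monoidal
    _ = 𝟙 _ ⊗≫ N ◁ η_ X X' ▷ ob A ⊗≫ ((N ⊗ X) ◁ hbInv A X' ≫ e ▷ _) ⊗≫ 𝟙 _ := by
      rw [h]; monoidal
    _ = _ := by
      rw [whisker_exchange, transpose]; monoidal

/-- The morphism `Z ⟶ X'` corresponding to `k : Z ⊗ X ⟶ 𝟙` for a left dual `X'` of `X`. -/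
def evLift {X X' : C} (p : ExactPairing X X') {Z : C} (k : Z ⊗ X ⟶ 𝟙_ C) : Z ⟶ X' :=
  transpose p k ≫ (λ_ X').hom

theorem evLift_ev {X X' : C} (p : ExactPairing X X') {Z : C} (k : Z ⊗ X ⟶ 𝟙_ C) :
    evLift p k ▷ X ≫ ε_ X X' = k := by
  conv_rhs => rw [← transpose_ev p k]
  rw [evLift, comp_whiskerRight]
  monoidal

theorem coev_ext_right {X X' Z : C} (p : ExactPairing X X') {g h : X ⟶ Z}
    (w : η_ X X' ≫ g ▷ X' = η_ X X' ≫ h ▷ X') : g = h := by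
  have key : ∀ k : X ⟶ Z, k = 𝟙 _ ⊗≫ (η_ X X' ≫ k ▷ X') ▷ X ⊗≫ Z ◁ ε_ X X' ⊗≫ 𝟙 _ := by
    intro k
    calc k = 𝟙 X ⊗≫ (η_ X X' ▷ X ⊗≫ X ◁ ε_ X X') ⊗≫ k := by
          rw [ExactPairing.evaluation_coevaluation'']; monoidal
      _ = 𝟙 _ ⊗≫ η_ X X' ▷ X ⊗≫ (X ◁ ε_ X X' ≫ k ▷ _) ⊗≫ 𝟙 _ := by monoidal
      _ = _ := by rw [whisker_exchange]; monoidal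
  rw [key g, key h, w]

end Transpose

/-! ### Monoidal transformations are invertible at dualizable objects. -/

section MonoidalTransformations
universe v₁ u₁ v₂ u₂
open Functor.LaxMonoidal Functor.OplaxMonoidal
variable {C : Type u₁} [Category.{v₁} C] [MonoidalCategory C]
  {D : Type u₂} [Category.{v₂} D] [MonoidalCategory D]

/-- A monoidal functor preserves duals. -/
@[reducible]
def mapPairing (F : C ⥤ D) [F.Monoidal] {X Y : C} (p : ExactPairing X Y) :
    ExactPairing (F.obj X) (F.obj Y) where
  coevaluation' := ε F ≫ F.map (η_ X Y) ≫ δ F X Y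
  evaluation' := μ F Y X ≫ F.map (ε_ X Y) ≫ η F
  coevaluation_evaluation' := by
    have h := congrArg F.map (ExactPairing.coevaluation_evaluation X Y)
    simp only [Functor.map_comp, Functor.Monoidal.map_whiskerLeft, Functor.Monoidal.map_whiskerRight,
      Functor.Monoidal.map_associator_inv,
      Functor.Monoidal.map_rightUnitor, Functor.Monoidal.map_leftUnitor_inv, Category.assoc,
      Functor.Monoidal.μ_δ_assoc] at h
    -- Composing with the invertible constraints of F turns the goal into the image under F of the
    -- zigzag identity of `p`.
    rw [← cancel_epi (F.obj Y ◁ η F), ← cancel_epi (δ F Y (𝟙_ C)),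
      ← cancel_mono (ε F ▷ F.obj Y), ← cancel_mono (μ F (𝟙_ C) Y)]
    simpa using h
  evaluation_coevaluation' := by
    have h := congrArg F.map (ExactPairing.evaluation_coevaluation X Y)
    simp only [Functor.map_comp, Functor.Monoidal.map_whiskerLeft, Functor.Monoidal.map_whiskerRight,
      Functor.Monoidal.map_associator,
      Functor.Monoidal.map_leftUnitor, Functor.Monoidal.map_rightUnitor_inv, Category.assoc,
      Functor.Monoidal.μ_δ_assoc] at h
    rw [← cancel_epi (η F ▷ F.obj X), ← cancel_epi (δ F (𝟙_ C) X),
      ← cancel_mono (F.obj X ◁ ε F), ← cancel_mono (μ F X (𝟙_ C))]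
    simpa using h

/-- A monoidal natural transformation is invertible on objects with duals. -/
theorem isIso_app_of_isMonoidal {F F' : C ⥤ D} [F.Monoidal] [F'.Monoidal] (τ : F ⟶ F')
    [NatTrans.IsMonoidal τ] {X Y : C} (p : ExactPairing X Y) : IsIso (τ.app X) := by
  let q := mapPairing F p
  let q' := mapPairing F' p
  -- The inverse of τ_X is the morphism F' X ⟶ F X whose dual is τ_Y.
  obtain ⟨ψ, hψ⟩ := mate_surjective q' q (τ.app Y)
  have e : ε_ (F.obj X) (F.obj Y) = μ F Y X ≫ F.map (ε_ X Y) ≫ η F := rfl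
  have e' : ε_ (F'.obj X) (F'.obj Y) = μ F' Y X ≫ F'.map (ε_ X Y) ≫ η F' := rfl
  have n : η_ (F.obj X) (F.obj Y) = ε F ≫ F.map (η_ X Y) ≫ δ F X Y := rfl
  have n' : η_ (F'.obj X) (F'.obj Y) = ε F' ≫ F'.map (η_ X Y) ≫ δ F' X Y := rfl
  have hε : (τ.app Y ⊗ₘ τ.app X) ≫ ε_ (F'.obj X) (F'.obj Y) = ε_ (F.obj X) (F.obj Y) := by
    have h1 : τ.app (𝟙_ C) ≫ η F' = η F := by
      rw [← cancel_epi (ε F), ← Category.assoc, NatTrans.IsMonoidal.unit,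
        Functor.Monoidal.ε_η, Functor.Monoidal.ε_η]
    rw [e, e', ← NatTrans.IsMonoidal.tensor_assoc, ← τ.naturality_assoc, h1]
  have hη : η_ (F.obj X) (F.obj Y) ≫ (τ.app X ⊗ₘ τ.app Y) = η_ (F'.obj X) (F'.obj Y) := by
    rw [n, n', ← cancel_mono (μ F' X Y)]
    simp only [Category.assoc, ← NatTrans.IsMonoidal.tensor, Functor.Monoidal.δ_μ_assoc,
      Functor.Monoidal.δ_μ, Category.comp_id]
    rw [τ.naturality, NatTrans.IsMonoidal.unit_assoc]
  have m1 := mate_ev q' q ψ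
  have m2 := coev_mate q' q ψ
  rw [hψ] at m1 m2
  -- Compatibility of τ with evaluations gives one composite, compatibility with coevaluations the
  -- other.
  refine ⟨ψ, ev_ext' q ?_, ?_⟩
  · rw [whiskerLeft_comp, Category.assoc, ← m1, whisker_exchange_assoc,
      ← MonoidalCategory.tensorHom_def_assoc, hε, whiskerLeft_id, Category.id_comp]
  · apply coev_ext_right q'
    rw [comp_whiskerRight, ← reassoc_of% m2, ← MonoidalCategory.tensorHom_def', hη,
      id_whiskerRight, Category.comp_id]


end MonoidalTransformations

/-! ### Bimodule maps out of M ⊗_A N. -/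

section TensorDesc
variable {C : Type u} [Category.{v} C] [MonoidalCategory C] [RigidCategory C] [HasCoequalizers C]
  {A : Mon C}

/-- The morphism of bimodules `M ⊗_A N ⟶ P` given by a balanced bilinear morphism
`M ⊗ N ⟶ P`. -/
def tensorDesc {M N P : Bimod A A} (b : M.X ⊗ N.X ⟶ P.X)
    (balanced : M.actRight ▷ N.X ≫ b = (α_ _ _ _).hom ≫ M.X ◁ N.actLeft ≫ b)
    (left : M.actLeft ▷ N.X ≫ b = (α_ _ _ _).hom ≫ A.X ◁ b ≫ P.actLeft)
    (right : M.X ◁ N.actRight ≫ b = (α_ _ _ _).inv ≫ b ▷ A.X ≫ P.actRight) : M ⊗ N ⟶ P where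
  hom := Cofork.IsColimit.desc (tpIsColimit M N) b (balanced.trans (Category.assoc _ _ _).symm)
  left_act_hom := by
    have h : tp M N ≫ Cofork.IsColimit.desc (tpIsColimit M N) b
      (balanced.trans (Category.assoc _ _ _).symm) = b := Cofork.IsColimit.π_desc' (tpIsColimit M N) _ _
    have h2 := tp_actLeft M N
    rw [← cancel_epi (A.X ◁ tp M N), reassoc_of% h2, h, left, ← whiskerLeft_comp_assoc, h]
    simp
  right_act_hom := by
    have h : tp M N ≫ Cofork.IsColimit.desc (tpIsColimit M N) b
      (balanced.trans (Category.assoc _ _ _).symm) = b := Cofork.IsColimit.π_desc' (tpIsColimit M N) _ _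
    have h2 := tp_actRight M N
    rw [← cancel_epi (tp M N ▷ A.X), reassoc_of% h2, h, right, ← comp_whiskerRight_assoc, h]
    simp

theorem tp_tensorDesc {M N P : Bimod A A} (b : M.X ⊗ N.X ⟶ P.X)
    (balanced : M.actRight ▷ N.X ≫ b = (α_ _ _ _).hom ≫ M.X ◁ N.actLeft ≫ b)
    (left : M.actLeft ▷ N.X ≫ b = (α_ _ _ _).hom ≫ A.X ◁ b ≫ P.actLeft)
    (right : M.X ◁ N.actRight ≫ b = (α_ _ _ _).inv ≫ b ▷ A.X ≫ P.actRight) :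
    tp M N ≫ (tensorDesc b balanced left right).hom = b :=
  Cofork.IsColimit.π_desc' (tpIsColimit M N) _ _

theorem tensor_hom_ext {M N P : Bimod A A} {f g : M ⊗ N ⟶ P}
    (h : tp M N ≫ f.hom = tp M N ≫ g.hom) : f = g :=
  Bimod.hom_ext _ _ ((cancel_epi _).1 h)

end TensorDesc

/-! ### The free bimodule A ⊗ Z ⊗ A. -/

section FreeBimodules
variable {C : Type u} [Category.{v} C] [MonoidalCategory C] {A : Mon C}

/-- The multiplication of an algebra. -/
abbrev mulA (A : Mon C) : A.X ⊗ A.X ⟶ A.X := MonObj.mul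

/-- The unit of an algebra. -/
abbrev oneA (A : Mon C) : 𝟙_ C ⟶ A.X := MonObj.one

/-- The free bimodule `A ⊗ Z ⊗ A`. -/
abbrev freeBimod (A : Mon C) (Z : C) : Bimod A A where
  X := A.X ⊗ Z ⊗ A.X
  actLeft := (α_ _ _ _).inv ≫ mulA A ▷ (Z ⊗ A.X)
  actRight := 𝟙 _ ⊗≫ (A.X ⊗ Z) ◁ mulA A ⊗≫ 𝟙 _
  one_actLeft := by
    calc
      _ = 𝟙 _ ⊗≫ (oneA A ▷ A.X ≫ mulA A) ▷ (Z ⊗ A.X) := by monoidal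
      _ = _ := by rw [MonObj.one_mul]; monoidal
  left_assoc := by
    calc
      _ = 𝟙 _ ⊗≫ (mulA A ▷ A.X ≫ mulA A) ▷ (Z ⊗ A.X) := by monoidal
      _ = _ := by rw [MonObj.mul_assoc]; monoidal
  actRight_one := by
    calc
      _ = 𝟙 _ ⊗≫ (A.X ⊗ Z) ◁ (A.X ◁ oneA A ≫ mulA A) ⊗≫ 𝟙 _ := by monoidal
      _ = _ := by rw [MonObj.mul_one]; monoidal
  right_assoc := by
    have h : mulA A ▷ A.X ≫ mulA A = (α_ _ _ _).hom ≫ A.X ◁ mulA A ≫ mulA A :=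
      MonObj.mul_assoc A.X
    calc
      _ = 𝟙 ((A.X ⊗ Z ⊗ A.X) ⊗ A.X ⊗ A.X) ⊗≫ (A.X ⊗ Z) ◁ ((α_ _ _ _).inv ≫
          (α_ _ _ _).hom ≫ A.X ◁ mulA A ≫ mulA A) ⊗≫ 𝟙 _ := by
        monoidal
      _ = 𝟙 _ ⊗≫ (A.X ⊗ Z) ◁ ((α_ _ _ _).inv ≫ mulA A ▷ A.X ≫ mulA A) ⊗≫ 𝟙 _ := by
        rw [h]
      _ = _ := by monoidal
  middle_assoc := by
    calc
      _ = 𝟙 _ ⊗≫ (mulA A ▷ (Z ⊗ A.X ⊗ A.X) ≫ A.X ◁ Z ◁ mulA A) ⊗≫ 𝟙 _ := by monoidal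
      _ = _ := by rw [← whisker_exchange]; monoidal

/-- The inclusion `Z ⟶ A ⊗ Z ⊗ A`. -/
def freeUnit (A : Mon C) (Z : C) : Z ⟶ A.X ⊗ Z ⊗ A.X :=
  𝟙 _ ⊗≫ oneA A ▷ Z ▷ 𝟙_ C ⊗≫ (A.X ⊗ Z) ◁ oneA A ⊗≫ 𝟙 _

/-- The morphism `A ⊗ Z ⊗ A ⟶ M` which extends `Z ⟶ M`. -/
def freeExt {Z : C} (M : Bimod A A) (f : Z ⟶ M.X) : A.X ⊗ Z ⊗ A.X ⟶ M.X :=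
  A.X ◁ (f ▷ A.X ≫ M.actRight) ≫ M.actLeft

/-- The morphism of bimodules `A ⊗ Z ⊗ A ⟶ M` which extends `Z ⟶ M`. -/
def freeDesc {Z : C} {M : Bimod A A} (f : Z ⟶ M.X) : freeBimod A Z ⟶ M where
  hom := freeExt M f
  left_act_hom := by
    have h := M.left_assoc
    change ((α_ _ _ _).inv ≫ mulA A ▷ (Z ⊗ A.X)) ≫ _ = A.X ◁ freeExt M f ≫ M.actLeft
    calc
      _ = (α_ _ _ _).inv ≫ (mulA A ▷ _ ≫ A.X ◁ (f ▷ A.X ≫ M.actRight)) ≫ M.actLeft := by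
        simp only [freeExt, Category.assoc]
      _ = 𝟙 _ ⊗≫ (A.X ⊗ A.X) ◁ (f ▷ A.X ≫ M.actRight) ⊗≫ mulA A ▷ M.X ≫ M.actLeft := by
        rw [← whisker_exchange]; monoidal
      _ = _ := by
        rw [h, freeExt]; monoidal
  right_act_hom := by
    have h1 := M.right_assoc
    have h2 := M.middle_assoc
    change (𝟙 ((A.X ⊗ Z ⊗ A.X) ⊗ A.X) ⊗≫ (A.X ⊗ Z) ◁ mulA A ⊗≫ 𝟙 (A.X ⊗ Z ⊗ A.X)) ≫ _ =
      freeExt M f ▷ A.X ≫ M.actRight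
    calc
      _ = 𝟙 _ ⊗≫ A.X ◁ (Z ◁ mulA A ≫ f ▷ A.X) ⊗≫ A.X ◁ M.actRight ≫ M.actLeft := by
        rw [freeExt]; monoidal
      _ = 𝟙 _ ⊗≫ A.X ◁ f ▷ (A.X ⊗ A.X) ⊗≫ A.X ◁ (M.X ◁ mulA A ≫ M.actRight) ≫ M.actLeft := by
        rw [whisker_exchange]; monoidal
      _ = 𝟙 _ ⊗≫ A.X ◁ (f ▷ A.X ≫ M.actRight) ▷ A.X ⊗≫
          ((α_ _ _ _).hom ≫ A.X ◁ M.actRight ≫ M.actLeft) := by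
        rw [h1]; monoidal
      _ = _ := by
        rw [← h2, freeExt]; monoidal

theorem freeUnit_freeExt {Z : C} {M : Bimod A A} (f : Z ⟶ M.X) :
    freeUnit A Z ≫ freeExt M f = f := by
  have h1 : M.X ◁ oneA A ≫ M.actRight = _ := M.actRight_one
  have h2 : oneA A ▷ M.X ≫ M.actLeft = _ := M.one_actLeft
  calc
    _ = 𝟙 _ ⊗≫ oneA A ▷ Z ▷ 𝟙_ C ⊗≫ A.X ◁ (Z ◁ oneA A ≫ f ▷ A.X) ⊗≫
        A.X ◁ M.actRight ≫ M.actLeft := by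
      rw [freeExt, freeUnit]; monoidal
    _ = 𝟙 Z ⊗≫ (oneA A ▷ Z ≫ A.X ◁ f) ⊗≫ A.X ◁ (M.X ◁ oneA A ≫ M.actRight) ≫ M.actLeft := by
      rw [whisker_exchange]; monoidal
    _ = f ⊗≫ (oneA A ▷ M.X ≫ M.actLeft) := by
      rw [← whisker_exchange, h1]; monoidal
    _ = _ := by rw [h2]; monoidal

end FreeBimodules

/-! ### A dual bimodule N of M represents the right linear morphisms Z ⊗ M ⟶ A. -/

section Evaluation
variable {C : Type u} [Category.{v} C] [MonoidalCategory C] [RigidCategory C] [HasCoequalizers C]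
  {A : Mon C}

/-- The morphism of `C` underlying an evaluation of bimodules. -/
def evHom {M N : Bimod A A} (p : ExactPairing M N) : (N ⊗ M).X ⟶ A.X := (ε_ M N).hom

/-- The morphism `N ⊗ M ⟶ N ⊗_A M ⟶ A` given by an evaluation of bimodules. -/
def evMor {M N : Bimod A A} (p : ExactPairing M N) : N.X ⊗ M.X ⟶ A.X :=
  tp N M ≫ evHom p

variable {M N : Bimod A A} (p : ExactPairing M N)

theorem evMor_balanced :
    N.actRight ▷ M.X ≫ evMor p = (α_ _ _ _).hom ≫ N.X ◁ M.actLeft ≫ evMor p := by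
  have h := tp_condition N M
  rw [evMor, reassoc_of% h]

theorem evMor_left :
    N.actLeft ▷ M.X ≫ evMor p = (α_ _ _ _).hom ≫ A.X ◁ evMor p ≫ mulA A := by
  have h := tp_actLeft N M
  have h2 : (N ⊗ M).actLeft ≫ evHom p = A.X ◁ evHom p ≫ mulA A :=
    (ε_ M N).left_act_hom
  rw [evMor, whiskerLeft_comp_assoc, ← h2, reassoc_of% h, Iso.hom_inv_id_assoc]

theorem evMor_right :
    N.X ◁ M.actRight ≫ evMor p = (α_ _ _ _).inv ≫ evMor p ▷ A.X ≫ mulA A := by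
  have h := tp_actRight N M
  have h2 : (N ⊗ M).actRight ≫ evHom p = evHom p ▷ A.X ≫ mulA A :=
    (ε_ M N).right_act_hom
  rw [evMor, comp_whiskerRight_assoc, ← h2, reassoc_of% h, Iso.inv_hom_id_assoc]

theorem tp_whiskerRight_ev {P : Bimod A A} (h : P ⟶ N) :
    tp P M ≫ (h ▷ M ≫ ε_ M N).hom = h.hom ▷ M.X ≫ evMor p := by
  have := tp_whiskerRight h M
  exact (reassoc_of% this) _

theorem tp_whiskerLeft_ev {P : Bimod A A} (h : P ⟶ M) :
    tp N P ≫ (N ◁ h ≫ ε_ M N).hom = N.X ◁ h.hom ≫ evMor p := by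
  have := tp_whiskerLeft N h
  exact (reassoc_of% this) _

/-- Left linearity pulls the left copy of A out of the evaluation, and balancing moves the right
copy onto M. What remains depends on f only through its pairing with M, which is what `evMor_ext`
needs. -/
theorem freeExt_evMor {Z : C} (f : Z ⟶ N.X) :
    freeExt N f ▷ M.X ≫ evMor p =
      𝟙 _ ⊗≫ A.X ◁ Z ◁ M.actLeft ⊗≫ A.X ◁ (f ▷ M.X ≫ evMor p) ⊗≫ mulA A := by
  have h1 := evMor_left p
  have h2 := evMor_balanced p
  calc
    _ = 𝟙 _ ⊗≫ A.X ◁ (f ▷ A.X ≫ N.actRight) ▷ M.X ⊗≫ (N.actLeft ▷ M.X ≫ evMor p) := by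
      rw [freeExt]; monoidal
    _ = 𝟙 _ ⊗≫ A.X ◁ f ▷ A.X ▷ M.X ⊗≫ A.X ◁ (N.actRight ▷ M.X ≫ evMor p) ⊗≫ mulA A := by
      rw [h1]; monoidal
    _ = 𝟙 _ ⊗≫ A.X ◁ (f ▷ (A.X ⊗ M.X) ≫ N.X ◁ M.actLeft) ⊗≫ A.X ◁ evMor p ⊗≫ mulA A := by
      rw [h2]; monoidal
    _ = _ := by
      rw [← whisker_exchange]; monoidal

theorem evMor_freeExt {Z : C} (f : Z ⟶ M.X) :
    N.X ◁ freeExt M f ≫ evMor p =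
      𝟙 _ ⊗≫ N.actRight ▷ Z ▷ A.X ⊗≫ (N.X ◁ f ≫ evMor p) ▷ A.X ⊗≫ mulA A := by
  have h1 := evMor_right p
  have h2 := evMor_balanced p
  have h3 := M.middle_assoc
  calc
    _ = 𝟙 _ ⊗≫ N.X ◁ A.X ◁ f ▷ A.X ⊗≫ N.X ◁ ((α_ _ _ _).hom ≫ A.X ◁ M.actRight ≫ M.actLeft) ⊗≫
        evMor p := by
      rw [freeExt]; monoidal
    _ = 𝟙 _ ⊗≫ N.X ◁ A.X ◁ f ▷ A.X ⊗≫ N.X ◁ M.actLeft ▷ A.X ⊗≫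
        (N.X ◁ M.actRight ≫ evMor p) := by
      rw [← h3]; monoidal
    _ = 𝟙 _ ⊗≫ N.X ◁ A.X ◁ f ▷ A.X ⊗≫ ((α_ _ _ _).hom ≫ N.X ◁ M.actLeft ≫ evMor p) ▷ A.X ⊗≫
        mulA A := by
      rw [h1]; monoidal
    _ = 𝟙 _ ⊗≫ ((N.X ⊗ A.X) ◁ f ≫ N.actRight ▷ M.X) ▷ A.X ⊗≫ evMor p ▷ A.X ⊗≫ mulA A := by
      rw [← h2]; monoidal
    _ = _ := by
      rw [whisker_exchange]; monoidal

/-- The duality of bimodules separates only bimodule maps. It is applied to the extensions of f and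
g to A ⊗ Z ⊗ A, and the result is restricted to Z. -/
theorem evMor_ext {Z : C} {f g : Z ⟶ N.X} (h : f ▷ M.X ≫ evMor p = g ▷ M.X ≫ evMor p) :
    f = g := by
  have key : freeDesc f = freeDesc g := by
    refine ev_ext p (tensor_hom_ext ?_)
    rw [tp_whiskerRight_ev, tp_whiskerRight_ev]
    refine (freeExt_evMor p f).trans (Eq.trans ?_ (freeExt_evMor p g).symm)
    rw [h]
  have key2 : freeExt N f = freeExt N g := congrArg Bimod.Hom.hom key
  rw [← freeUnit_freeExt f, key2, freeUnit_freeExt]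

theorem evMor_ext' {Z : C} {f g : Z ⟶ M.X} (h : N.X ◁ f ≫ evMor p = N.X ◁ g ≫ evMor p) :
    f = g := by
  have key : freeDesc f = freeDesc g := by
    refine ev_ext' p (tensor_hom_ext ?_)
    rw [tp_whiskerLeft_ev, tp_whiskerLeft_ev]
    refine (evMor_freeExt p f).trans (Eq.trans ?_ (evMor_freeExt p g).symm)
    rw [h]
  have key2 : freeExt M f = freeExt M g := congrArg Bimod.Hom.hom key
  rw [← freeUnit_freeExt f, key2, freeUnit_freeExt]

/-- The extension of a morphism `Z ⊗ M ⟶ A` to `(A ⊗ Z ⊗ A) ⊗ M`. -/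
def freePair {Z : C} (M : Bimod A A) (k : Z ⊗ M.X ⟶ A.X) : (A.X ⊗ Z ⊗ A.X) ⊗ M.X ⟶ A.X :=
  𝟙 ((A.X ⊗ Z ⊗ A.X) ⊗ M.X) ⊗≫ A.X ◁ (Z ◁ M.actLeft ≫ k) ≫ mulA A

/-- The morphism `(A ⊗ Z ⊗ A) ⊗_A M ⟶ A` which extends a right linear morphism `Z ⊗ M ⟶ A`. -/
def freePairDesc {Z : C} (M : Bimod A A) (k : Z ⊗ M.X ⟶ A.X)
    (hk : Z ◁ M.actRight ≫ k = (α_ _ _ _).inv ≫ k ▷ A.X ≫ mulA A) :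
    freeBimod A Z ⊗ M ⟶ Bimod.regular A :=
  tensorDesc (P := Bimod.regular A) (freePair M k)
    (by
      have h1 : mulA A ▷ M.X ≫ M.actLeft = _ := M.left_assoc
      change (𝟙 ((A.X ⊗ Z ⊗ A.X) ⊗ A.X) ⊗≫ (A.X ⊗ Z) ◁ mulA A ⊗≫ 𝟙 (A.X ⊗ Z ⊗ A.X)) ▷ M.X ≫
        freePair M k = (α_ (A.X ⊗ Z ⊗ A.X) A.X M.X).hom ≫
          (A.X ⊗ Z ⊗ A.X) ◁ M.actLeft ≫ freePair M k
      calc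
        _ = 𝟙 _ ⊗≫ A.X ◁ Z ◁ (mulA A ▷ M.X ≫ M.actLeft) ⊗≫ A.X ◁ k ≫ mulA A := by
          rw [freePair]; monoidal
        _ = _ := by
          rw [h1, freePair]; monoidal)
    (by
      have h3 : mulA A ▷ A.X ≫ mulA A = (α_ _ _ _).hom ≫ A.X ◁ mulA A ≫ mulA A :=
        MonObj.mul_assoc A.X
      change ((α_ _ _ _).inv ≫ mulA A ▷ (Z ⊗ A.X)) ▷ M.X ≫ freePair M k =
        (α_ A.X (A.X ⊗ Z ⊗ A.X) M.X).hom ≫ A.X ◁ freePair M k ≫ mulA A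
      calc
        _ = 𝟙 _ ⊗≫ (mulA A ▷ (Z ⊗ A.X ⊗ M.X) ≫ A.X ◁ (Z ◁ M.actLeft ≫ k)) ≫ mulA A := by
          rw [freePair]; monoidal
        _ = 𝟙 _ ⊗≫ A.X ◁ A.X ◁ (Z ◁ M.actLeft ≫ k) ⊗≫ (mulA A ▷ A.X ≫ mulA A) := by
          rw [← whisker_exchange]; monoidal
        _ = _ := by
          rw [h3, freePair]; monoidal)
    (by
      -- Right linearity of k is needed here: once the two actions on M are interchanged, k carries
      -- the right action to the multiplication of A.
      have h2 := M.middle_assoc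
      have h3 : mulA A ▷ A.X ≫ mulA A = (α_ _ _ _).hom ≫ A.X ◁ mulA A ≫ mulA A :=
        MonObj.mul_assoc A.X
      change (A.X ⊗ Z ⊗ A.X) ◁ M.actRight ≫ freePair M k =
        (α_ (A.X ⊗ Z ⊗ A.X) M.X A.X).inv ≫ freePair M k ▷ A.X ≫ mulA A
      calc
        _ = 𝟙 _ ⊗≫ A.X ◁ Z ◁ ((α_ _ _ _).hom ≫ A.X ◁ M.actRight ≫ M.actLeft) ⊗≫
            A.X ◁ k ≫ mulA A := by
          rw [freePair]; monoidal
        _ = 𝟙 _ ⊗≫ A.X ◁ Z ◁ M.actLeft ▷ A.X ⊗≫ A.X ◁ (Z ◁ M.actRight ≫ k) ≫ mulA A := by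
          rw [← h2]; monoidal
        _ = 𝟙 _ ⊗≫ A.X ◁ Z ◁ M.actLeft ▷ A.X ⊗≫ A.X ◁ k ▷ A.X ⊗≫
            ((α_ _ _ _).hom ≫ A.X ◁ mulA A ≫ mulA A) := by
          rw [hk]; monoidal
        _ = _ := by
          rw [← h3, freePair]; monoidal)

/-- Existence half of the universal property N = Hom_A(M, A); uniqueness is `evMor_ext`. Only right
linearity of k is asked, because the left linearity required of a bimodule map is supplied by the
free left factor A. -/
theorem exists_whiskerRight_evMor {Z : C} (k : Z ⊗ M.X ⟶ A.X)
    (hk : Z ◁ M.actRight ≫ k = (α_ _ _ _).inv ≫ k ▷ A.X ≫ mulA A) :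
    ∃ f : Z ⟶ N.X, f ▷ M.X ≫ evMor p = k := by
  let h := evLift p (freePairDesc M k hk)
  have hh : h ▷ M ≫ ε_ M N = freePairDesc M k hk := evLift_ev _ _
  let h' : A.X ⊗ Z ⊗ A.X ⟶ N.X := h.hom
  -- The bimodule map A ⊗ Z ⊗ A ⟶ N obtained by duality is restricted to the generators Z; the unit
  -- axioms then reduce `freePair M k` to k.
  refine ⟨freeUnit A Z ≫ h', ?_⟩
  have e : h' ▷ M.X ≫ evMor p = freePair M k := by
    refine (tp_whiskerRight_ev p h).symm.trans ?_
    rw [hh]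
    exact tp_tensorDesc _ _ _ _
  have h4 : oneA A ▷ M.X ≫ M.actLeft = _ := M.one_actLeft
  have h5 : oneA A ▷ A.X ≫ mulA A = (λ_ _).hom := MonObj.one_mul A.X
  rw [comp_whiskerRight, Category.assoc, e]
  calc
    _ = 𝟙 _ ⊗≫ oneA A ▷ (Z ⊗ M.X) ⊗≫ A.X ◁ Z ◁ (oneA A ▷ M.X ≫ M.actLeft) ⊗≫
        A.X ◁ k ≫ mulA A := by
      rw [freePair, freeUnit]; monoidal
    _ = 𝟙 (Z ⊗ M.X) ⊗≫ (oneA A ▷ (Z ⊗ M.X) ≫ A.X ◁ k) ≫ mulA A := by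
      rw [h4]; monoidal
    _ = 𝟙 _ ⊗≫ k ⊗≫ (oneA A ▷ A.X ≫ mulA A) := by
      rw [← whisker_exchange]; monoidal
    _ = _ := by
      rw [h5]; monoidal

end Evaluation

/-! ### Rigidity of C_A^σ. -/

section SigmaDuals
variable {C : Type u} [Category.{v} C] [MonoidalCategory C] [RigidCategory C] [HasCoequalizers C]
  (A : Center C) [MonObj A]

/-- The left action `a^r ∘ σ_M` of `A` on `M`. -/
def sigmaLeft (M : Bimod (alg A) (alg A)) : ob A ⊗ M.X ⟶ M.X := hb A M.X ≫ M.actRight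

variable {A}

theorem sigmaLeft_evMor {M N : Bimod (alg A) (alg A)} (p : ExactPairing M N) :
    sigmaLeft A N ▷ M.X ≫ evMor p =
      hb A N.X ▷ M.X ≫ (α_ _ _ _).hom ≫ N.X ◁ M.actLeft ≫ evMor p := by
  have h : N.actRight ▷ M.X ≫ evMor p = (α_ N.X (ob A) M.X).hom ≫ N.X ◁ M.actLeft ≫ evMor p :=
    evMor_balanced p
  rw [sigmaLeft, comp_whiskerRight, Category.assoc, h]

variable [IsCommMonObj A]

/-- By left linearity the action becomes multiplication on the value in A. Commutativity inserts σ_A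
there, naturality and the hexagon pull it back as σ past N and then past M, and right linearity
turns the multiplication into the right action of M. With `sigmaLeft_evMor` this shows that the
evaluation interchanges the two left actions: the given one on either side corresponds to a^r ∘ σ on
the other. -/
theorem actLeft_evMor {M N : Bimod (alg A) (alg A)} (p : ExactPairing M N) :
    N.actLeft ▷ M.X ≫ evMor p =
      hb A N.X ▷ M.X ≫ (α_ _ _ _).hom ≫ N.X ◁ sigmaLeft A M ≫ evMor p := by
  have h1 : N.actLeft ▷ M.X ≫ evMor p = (α_ (ob A) N.X M.X).hom ≫ ob A ◁ evMor p ≫ mulMor A :=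
    evMor_left p
  have h2 : N.X ◁ M.actRight ≫ evMor p = (α_ N.X M.X (ob A)).inv ≫ evMor p ▷ ob A ≫ mulMor A :=
    evMor_right p
  have h3 : ob A ◁ evMor p ≫ hb A (ob A) = hb A (N.X ⊗ M.X) ≫ evMor p ▷ ob A :=
    hb_natural A (evMor p)
  rw [h1, ← hb_mul_comm, reassoc_of% h3, sigmaLeft, whiskerLeft_comp, Category.assoc, h2,
    hb_tensor]
  monoidal

/-- If the two left actions of M agree, then so do the morphisms to which those of N correspond
under the evaluation, and nondegeneracy concludes. The converse direction below uses nondegeneracy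
in the other variable. -/
theorem sigmaProp_of_exactPairing {M N : Bimod (alg A) (alg A)} (p : ExactPairing M N)
    (hM : sigmaProp A M) : sigmaProp A N := by
  have hM : M.actLeft = sigmaLeft A M := hM
  change N.actLeft = sigmaLeft A N
  apply evMor_ext p
  have h1 := actLeft_evMor p
  have h2 := sigmaLeft_evMor p
  rw [h2, hM]
  exact h1

theorem sigmaProp_of_exactPairing' {M N : Bimod (alg A) (alg A)} (p : ExactPairing M N)
    (hN : sigmaProp A N) : sigmaProp A M := by
  have hN : N.actLeft = sigmaLeft A N := hN
  change M.actLeft = sigmaLeft A M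
  apply evMor_ext' p
  have h1 := actLeft_evMor p
  have h2 := sigmaLeft_evMor p
  rw [← hN, h1, cancel_epi, cancel_epi] at h2
  exact h2.symm

/-- Duals in `_AC_A` of objects of `C_A^σ` are duals in `C_A^σ`. -/
@[reducible]
def sigmaPairing {M N : CSigma A} (p : ExactPairing M.obj N.obj) : ExactPairing M N where
  coevaluation' := ObjectProperty.homMk (η_ M.obj N.obj)
  evaluation' := ObjectProperty.homMk (ε_ M.obj N.obj)
  coevaluation_evaluation' :=
    ObjectProperty.hom_ext _ (ExactPairing.coevaluation_evaluation M.obj N.obj)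
  evaluation_coevaluation' :=
    ObjectProperty.hom_ext _ (ExactPairing.evaluation_coevaluation M.obj N.obj)

/-- Duals in `C_A^σ` are duals in `_AC_A`. -/
@[reducible]
def bimodPairing {M N : CSigma A} (p : ExactPairing M N) : ExactPairing M.obj N.obj where
  coevaluation' := (η_ M N).hom
  evaluation' := (ε_ M N).hom
  coevaluation_evaluation' :=
    congrArg InducedCategory.Hom.hom (ExactPairing.coevaluation_evaluation M N)
  evaluation_coevaluation' :=
    congrArg InducedCategory.Hom.hom (ExactPairing.evaluation_coevaluation M N)

variable (A) in
theorem nonempty_rigidCategory_cSigma [RigidCategory (Bimod (alg A) (alg A))] :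
    Nonempty (RigidCategory (CSigma A)) :=
  ⟨{ rightDual := fun M =>
      { rightDual := ⟨ldual M.obj, sigmaProp_of_exactPairing HasRightDual.exact M.property⟩
        exact := sigmaPairing HasRightDual.exact }
     leftDual := fun M =>
      { leftDual := ⟨HasLeftDual.leftDual M.obj,
          sigmaProp_of_exactPairing' HasLeftDual.exact M.property⟩
        exact := sigmaPairing HasLeftDual.exact } }⟩

end SigmaDuals

/-! ### The two parallel morphisms of the equalizer, and the transpose of the multiplication. -/

section MulTranspose
variable {C : Type u} [Category.{v} C] [MonoidalCategory C] [RigidCategory C]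
  (A : Center C) [MonObj A] [IsCommMonObj A]

/-- The morphism `A ⟶ A ⊗ A*` given by the multiplication. -/
def mulTranspose : ob A ⟶ ob A ⊗ ldual (ob A) := transpose (exL (ob A)) (mulMor A)

theorem homRight_eq (M : CSigma A) :
    homRight A M = mulTranspose A ▷ ldual M.obj.X ≫ (α_ _ _ _).hom := by
  rw [homRight, mulTranspose, transpose]; monoidal

/-- With `transpose_homRight`: the two composites with the transpose of k are the transposes of the
two sides of right linearity of k. -/
theorem transpose_homLeft (M : CSigma A) {Z : C} (k : Z ⊗ M.obj.X ⟶ ob A) :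
    transpose (exL M.obj.X) k ≫ homLeft A M =
      transpose (pairTensor (exL M.obj.X) (exL (ob A))) (Z ◁ M.obj.actRight ≫ k) :=
  transpose_mate _ _ _ _

theorem transpose_homRight (M : CSigma A) {Z : C} (k : Z ⊗ M.obj.X ⟶ ob A) :
    transpose (exL M.obj.X) k ≫ homRight A M =
      transpose (pairTensor (exL M.obj.X) (exL (ob A)))
        ((α_ _ _ _).inv ≫ k ▷ ob A ≫ mulMor A) := by
  rw [homRight_eq, transpose_tensor]; rfl

/-- The half-braiding splits over the product; its first factor turns the coevaluation into
`coevHat`. Commutativity supplies a further σ_A, so that the outer A passes the whole point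
`coevHat` : 𝟙 ⟶ A* ⊗ A and slides through it. Since `coevHat` also defines the inverse of u, this is
the source of the Drinfeld isomorphism in the argument. -/
theorem mulTranspose_hb :
    mulTranspose A ≫ hb A (ldual (ob A)) =
      𝟙 _ ⊗≫ coevHat A ▷ ob A ⊗≫ ldual (ob A) ◁ mulMor A := by
  calc
    _ = 𝟙 _ ⊗≫ ob A ◁ η_ (ob A) (ldual (ob A)) ⊗≫ (mulMor A ▷ ldual (ob A) ≫
        hb A (ldual (ob A))) := by
      rw [mulTranspose, transpose]; monoidal
    _ = 𝟙 _ ⊗≫ ob A ◁ coevHat A ⊗≫ hb A (ldual (ob A)) ▷ ob A ⊗≫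
        ldual (ob A) ◁ (hb A (ob A) ≫ mulMor A) := by
      rw [hb_mul, hb_mul_comm, coevHat]; monoidal
    _ = 𝟙 _ ⊗≫ (ob A ◁ coevHat A ⊗≫ hb A (ldual (ob A)) ▷ ob A ⊗≫
        ldual (ob A) ◁ hb A (ob A)) ⊗≫ ldual (ob A) ◁ mulMor A := by
      monoidal
    _ = _ := by
      rw [hb_point]; monoidal

end MulTranspose

/-! ### M† as the equalizer Hom_A(M, A). -/

section Equalizer
variable {C : Type u} [Category.{v} C] [MonoidalCategory C] [RigidCategory C] [HasCoequalizers C]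
  (A : Center C) [MonObj A] [IsCommMonObj A] [RightRigidCategory (CSigma A)]

/-- The pairing of `M` with its left dual `M†`, in `_AC_A`. -/
abbrev daggerPairing (M : CSigma A) : ExactPairing M.obj (ldual M).obj :=
  bimodPairing (exL M)

theorem evDagger_ext {M : CSigma A} {Z : C} {f g : Z ⟶ (ldual M).obj.X}
    (h : f ▷ M.obj.X ≫ evDagger A M = g ▷ M.obj.X ≫ evDagger A M) : f = g :=
  evMor_ext (daggerPairing A M) h

theorem evDagger_right (M : CSigma A) :
    (ldual M).obj.X ◁ M.obj.actRight ≫ evDagger A M =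
      (α_ _ _ _).inv ≫ evDagger A M ▷ ob A ≫ mulMor A := evMor_right (daggerPairing A M)

theorem evDagger_left (M : CSigma A) :
    (ldual M).obj.actLeft ▷ M.obj.X ≫ evDagger A M =
      (α_ _ _ _).hom ≫ ob A ◁ evDagger A M ≫ mulMor A := evMor_left (daggerPairing A M)

theorem evDagger_balanced (M : CSigma A) :
    (ldual M).obj.actRight ▷ M.obj.X ≫ evDagger A M =
      (α_ _ _ _).hom ≫ (ldual M).obj.X ◁ M.obj.actLeft ≫ evDagger A M :=
  evMor_balanced (daggerPairing A M)

theorem inclDagger_eq (M : CSigma A) :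
    inclDagger A M = transpose (exL M.obj.X) (evDagger A M) := rfl

theorem inclDagger_condition (M : CSigma A) :
    inclDagger A M ≫ homLeft A M = inclDagger A M ≫ homRight A M := by
  rw [inclDagger_eq, transpose_homLeft, transpose_homRight, evDagger_right]

/-- A morphism to A ⊗ M* equalizes the pair exactly when its transpose is right linear, and right
linear morphisms Z ⊗ M ⟶ A are the morphisms Z ⟶ M†. -/
theorem nonempty_isLimit_inclDagger (M : CSigma A) :
    Nonempty (IsLimit (Fork.ofι (inclDagger A M) (inclDagger_condition A M))) := by
  have key : ∀ {Z : C} (k : Z ⟶ ob A ⊗ ldual M.obj.X), k ≫ homLeft A M = k ≫ homRight A M →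
      ∃ f : Z ⟶ (ldual M).obj.X, f ≫ inclDagger A M = k := by
    intro Z k hk
    -- Presenting k as a transpose lets `hk` be read as right linearity of the transposed morphism.
    rw [← transpose_untranspose (exL M.obj.X) k] at hk ⊢
    rw [transpose_homLeft, transpose_homRight] at hk
    obtain ⟨f, hf⟩ := exists_whiskerRight_evMor (daggerPairing A M) _
      (transpose_injective _ hk)
    refine ⟨f, ?_⟩
    rw [inclDagger_eq, comp_transpose]
    exact congrArg _ hf
  choose f hf using fun s : Fork (homLeft A M) (homRight A M) => key s.ι s.condition
  refine ⟨Fork.IsLimit.mk _ f hf fun s m hm => evDagger_ext A ?_⟩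
  apply transpose_injective (exL M.obj.X)
  rw [← comp_transpose, ← comp_transpose, ← inclDagger_eq]
  exact hm.trans (hf s).symm

end Equalizer

/-! ### Double duals of bilinear morphisms. -/

section DoubleDualMaps
variable {C : Type u} [Category.{v} C] [MonoidalCategory C] [RightRigidCategory C]

/-- The double dual of a morphism out of a tensor product. -/
theorem ddTensor_ddMap {X Y Z : C} (f : X ⊗ Y ⟶ Z) :
    (ddTensor X Y).hom ≫ ddMap f =
      mate (exL (ldual Z)) (pairTensor (exL (ldual Y)) (exL (ldual X)))
        (mate (pairTensor (exL X) (exL Y)) (exL Z) f) := by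
  have := (DDual.map_comp ((ddual X).tensor (ddual Y)) (ddual (X ⊗ Y)) (ddual Z)
    (𝟙 _) f).symm
  rw [Category.id_comp] at this
  exact this

theorem ddTensor_ddMap_ev {X Y Z : C} (f : X ⊗ Y ⟶ Z) :
    ((ddTensor X Y).hom ≫ ddMap f) ▷ ldual Z ≫ ε_ (ldual Z) (dd Z) =
      (dd X ⊗ dd Y) ◁ mate (pairTensor (exL X) (exL Y)) (exL Z) f ⊗≫
        dd X ◁ (ε_ (ldual Y) (dd Y) ▷ ldual X) ⊗≫ ε_ (ldual X) (dd X) := by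
  rw [ddTensor_ddMap, mate_ev, pairTensor_ev]
  monoidal

end DoubleDualMaps

/-! ### The pairing of M** with M†. -/

section DaggerHom
variable {C : Type u} [Category.{v} C] [MonoidalCategory C] [RigidCategory C] [HasCoequalizers C]
  (A : Center C) [MonObj A] [IsCommMonObj A] [RightRigidCategory (CSigma A)]

theorem actLeft_inclDagger (M : CSigma A) :
    (ldual M).obj.actLeft ≫ inclDagger A M =
      ob A ◁ inclDagger A M ≫ (α_ _ _ _).inv ≫ mulMor A ▷ ldual M.obj.X := by
  rw [inclDagger_eq, comp_transpose]
  have h := evDagger_left A M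
  refine (congrArg (transpose _) h).trans ?_
  rw [transpose, transpose]
  monoidal

/-- The morphism `M† ⟶ A ⊗ M* ⟶ M* ⊗ A`. -/
def daggerHom (M : CSigma A) : (ldual M).obj.X ⟶ ldual M.obj.X ⊗ ob A :=
  inclDagger A M ≫ hb A (ldual M.obj.X)

/-- Balancing moves the right action of M† to the left action of M, which is a^r ∘ σ_M by the
σ-condition; right linearity of the evaluation then turns a^r into μ. Transposed, σ_M becomes the
inverse half-braiding at M*. -/
theorem actRight_inclDagger (M : CSigma A) :
    (ldual M).obj.actRight ≫ inclDagger A M =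
      inclDagger A M ▷ ob A ≫ (α_ _ _ _).hom ≫ ob A ◁ hbInv A (ldual M.obj.X) ≫ (α_ _ _ _).inv ≫
        mulMor A ▷ ldual M.obj.X := by
  have h1 := transpose_hb A (exL M.obj.X) (evDagger A M)
  have h2 : M.obj.actLeft = hb A M.obj.X ≫ M.obj.actRight := M.property
  have h3 := evDagger_balanced A M
  have h4 := evDagger_right A M
  rw [inclDagger_eq, ← reassoc_of% h1, transpose_comp, comp_transpose]
  refine congrArg (transpose _) (h3.trans ?_)
  rw [h2]
  refine Eq.trans (b := (α_ (ldual M).obj.X (ob A) M.obj.X).hom ≫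
    (ldual M).obj.X ◁ hb A M.obj.X ≫ (ldual M).obj.X ◁ M.obj.actRight ≫ evDagger A M) ?_ ?_
  · exact congrArg _ ((congrArg (· ≫ _) (whiskerLeft_comp _ _ _)).trans (Category.assoc _ _ _))
  · refine (congrArg (fun t => (α_ (ldual M).obj.X (ob A) M.obj.X).hom ≫
      (ldual M).obj.X ◁ hb A M.obj.X ≫ t) h4).trans ?_
    simp only [Category.assoc]

/-- Applying σ after i_M cancels the inverse half-braiding of `actRight_inclDagger`, so the action
is plain multiplication on the last factor. This is the reason for using M* ⊗ A instead of A ⊗ M*.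
-/
theorem actRight_daggerHom (M : CSigma A) :
    (ldual M).obj.actRight ≫ daggerHom A M =
      daggerHom A M ▷ ob A ≫ (α_ _ _ _).hom ≫ ldual M.obj.X ◁ mulMor A := by
  have h := actRight_inclDagger A M
  rw [daggerHom, reassoc_of% h, hb_mul]
  calc
    _ = inclDagger A M ▷ ob A ⊗≫ ob A ◁ (hbInv A (ldual M.obj.X) ≫ hb A (ldual M.obj.X)) ⊗≫
        hb A (ldual M.obj.X) ▷ ob A ⊗≫ ldual M.obj.X ◁ mulMor A := by monoidal
    _ = _ := by
      rw [Iso.inv_hom_id]; monoidal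

/-- The dual `M* ⟶ A* ⊗ M*` of the right action of `M`. -/
abbrev dualAct (M : CSigma A) : ldual M.obj.X ⟶ ldual (ob A) ⊗ ldual M.obj.X :=
  mate (pairTensor (exL M.obj.X) (exL (ob A))) (exL M.obj.X) M.obj.actRight

/-- This is the equalizer condition after σ has been applied. Past A* the half-braiding turns the
transposed multiplication into `coevHat`; past M* it rebuilds `daggerHom`, preceded by the left
action of M†. -/
theorem daggerHom_dualAct (M : CSigma A) :
    daggerHom A M ≫ dualAct A M ▷ ob A =
      𝟙 _ ⊗≫ coevHat A ▷ (ldual M).obj.X ⊗≫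
        ldual (ob A) ◁ ((ldual M).obj.actLeft ≫ daggerHom A M) ⊗≫ 𝟙 _ := by
  have h := inclDagger_condition A M
  rw [homRight_eq] at h
  have h1 := hb_natural A (dualAct A M)
  have h2 : inclDagger A M ≫ ob A ◁ dualAct A M = _ := h
  have h3 := actLeft_inclDagger A M
  rw [daggerHom, Category.assoc, ← h1, reassoc_of% h2, hb_tensor, reassoc_of% h3]
  calc
    _ = inclDagger A M ⊗≫ (mulTranspose A ≫ hb A (ldual (ob A))) ▷ ldual M.obj.X ⊗≫
        ldual (ob A) ◁ hb A (ldual M.obj.X) ⊗≫ 𝟙 _ := by monoidal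
    _ = 𝟙 _ ⊗≫ (𝟙_ C ◁ inclDagger A M ≫ coevHat A ▷ _) ⊗≫
        ldual (ob A) ◁ (mulMor A ▷ ldual M.obj.X ≫ hb A (ldual M.obj.X)) ⊗≫ 𝟙 _ := by
      rw [mulTranspose_hb]; monoidal
    _ = _ := by
      rw [whisker_exchange]; monoidal

/-- The morphism `M** ⊗ M† ⟶ M** ⊗ M* ⊗ A ⟶ A`. -/
def evTwist (M : CSigma A) : dd M.obj.X ⊗ (ldual M).obj.X ⟶ ob A :=
  dd M.obj.X ◁ daggerHom A M ⊗≫ ε_ (ldual M.obj.X) (dd M.obj.X) ▷ ob A ⊗≫ 𝟙 (ob A)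

theorem evTwist_right (M : CSigma A) :
    dd M.obj.X ◁ (ldual M).obj.actRight ≫ evTwist A M =
      (α_ _ _ _).inv ≫ evTwist A M ▷ ob A ≫ mulMor A := by
  calc
    _ = dd M.obj.X ◁ ((ldual M).obj.actRight ≫ daggerHom A M) ⊗≫
        ε_ (ldual M.obj.X) (dd M.obj.X) ▷ ob A ⊗≫ 𝟙 (ob A) := by
      rw [evTwist]; monoidal
    _ = (𝟙 (dd M.obj.X ⊗ (ldual M).obj.X ⊗ ob A)) ⊗≫ dd M.obj.X ◁ daggerHom A M ▷ ob A ⊗≫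
        ((dd M.obj.X ⊗ ldual M.obj.X) ◁ mulMor A ≫
          ε_ (ldual M.obj.X) (dd M.obj.X) ▷ ob A) ⊗≫ 𝟙 (ob A) := by
      rw [actRight_daggerHom]; monoidal
    _ = _ := by
      rw [whisker_exchange, evTwist]; monoidal

/-- Here u is forced. Without the twist, the double dual of a^r pairs with M† as the left action of
A on M† does, but through ū : A** ⟶ A. -/
theorem evTwist_balanced (M : CSigma A) :
    twistRight A M.obj ▷ (ldual M).obj.X ≫ evTwist A M =
      (α_ _ _ _).hom ≫ dd M.obj.X ◁ (ldual M).obj.actLeft ≫ evTwist A M := by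
  have h : drinfeldInv A ≫ drinfeld A = 𝟙 _ := IsIso.hom_inv_id _
  have h2 := ddTensor_ddMap_ev M.obj.actRight
  have h3 : dd M.obj.X ◁ drinfeldInv A ≫ twistRight A M.obj =
      (ddTensor M.obj.X (ob A)).hom ≫ ddMap M.obj.actRight := by
    rw [twistRight, ← whiskerLeft_comp_assoc, h, whiskerLeft_id, Category.id_comp]
  have h4 := daggerHom_dualAct A M
  -- Composition with the isomorphism ū removes u from the twisted action and leaves the double dual
  -- of a^r.
  rw [← cancel_epi ((dd M.obj.X ◁ drinfeldInv A) ▷ (ldual M).obj.X), ← comp_whiskerRight_assoc,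
    h3]
  set T := (ddTensor M.obj.X (ob A)).hom ≫ ddMap M.obj.actRight with hT
  calc
    _ = (T ▷ (ldual M).obj.X ≫ dd M.obj.X ◁ daggerHom A M) ⊗≫
        ε_ (ldual M.obj.X) (dd M.obj.X) ▷ ob A ⊗≫ 𝟙 _ := by
      rw [evTwist]; monoidal
    _ = (dd M.obj.X ⊗ dd (ob A)) ◁ daggerHom A M ⊗≫
        (T ▷ ldual M.obj.X ≫ ε_ (ldual M.obj.X) (dd M.obj.X)) ▷ ob A ⊗≫ 𝟙 _ := by
      rw [← whisker_exchange]; monoidal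
    _ = (dd M.obj.X ⊗ dd (ob A)) ◁ (daggerHom A M ≫ dualAct A M ▷ ob A) ⊗≫
        dd M.obj.X ◁ (ε_ (ldual (ob A)) (dd (ob A)) ▷ (ldual M.obj.X ⊗ ob A)) ⊗≫
        ε_ (ldual M.obj.X) (dd M.obj.X) ▷ ob A ⊗≫ 𝟙 _ := by
      rw [h2, dualAct]; monoidal
    _ = 𝟙 _ ⊗≫ (dd M.obj.X ⊗ dd (ob A)) ◁ (coevHat A ▷ (ldual M).obj.X) ⊗≫
        dd M.obj.X ◁ ((dd (ob A) ⊗ ldual (ob A)) ◁ ((ldual M).obj.actLeft ≫ daggerHom A M) ≫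
          ε_ (ldual (ob A)) (dd (ob A)) ▷ _) ⊗≫
        ε_ (ldual M.obj.X) (dd M.obj.X) ▷ ob A ⊗≫ 𝟙 _ := by
      rw [h4]; monoidal
    -- Pairing A** with the first leg of `coevHat` is ū.
    _ = _ := by
      rw [whisker_exchange, drinfeldInv_eq, evTwist]; monoidal

end DaggerHom

/-! ### Nested evaluations. -/

section Nested
variable {C : Type u} [Category.{v} C] [MonoidalCategory C]

/-- The morphism `(P ⊗ X) ⊗ Y ⊗ Q ⟶ P ⊗ Q ⟶ 𝟙`. -/
def nest {P Q X Y : C} (k : X ⊗ Y ⟶ 𝟙_ C) (l : P ⊗ Q ⟶ 𝟙_ C) : (P ⊗ X) ⊗ (Y ⊗ Q) ⟶ 𝟙_ C :=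
  (α_ _ _ _).hom ≫ P ◁ ((α_ _ _ _).inv ≫ k ▷ Q ≫ (λ_ Q).hom) ≫ l

theorem pairTensor_ev_eq_nest {X X' Y Y' : C} (p : ExactPairing X X') (q : ExactPairing Y Y') :
    @ExactPairing.evaluation _ _ _ (X ⊗ Y) (Y' ⊗ X') (pairTensor p q) =
      nest (ε_ X X') (ε_ Y Y') := by
  rw [pairTensor_ev, nest]; monoidal

theorem tensorHom_nest {P P' Q X X' Y : C} (f : P ⟶ P') (g : X ⟶ X') (k : X' ⊗ Y ⟶ 𝟙_ C)
    (l : P' ⊗ Q ⟶ 𝟙_ C) :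
    (f ⊗ₘ g) ▷ (Y ⊗ Q) ≫ nest k l = nest (g ▷ Y ≫ k) (f ▷ Q ≫ l) := by
  calc
    _ = 𝟙 _ ⊗≫ P ◁ g ▷ (Y ⊗ Q) ⊗≫ (f ▷ ((X' ⊗ Y) ⊗ Q) ≫ P' ◁ (k ▷ Q ≫ (λ_ Q).hom)) ≫ l := by
      rw [nest, MonoidalCategory.tensorHom_def']; monoidal
    _ = _ := by
      rw [← whisker_exchange, nest]; monoidal

end Nested

/-! ### Morphisms of C_A^σ as balanced right linear morphisms of C. -/

section SigmaLinear
variable {C : Type u} [Category.{v} C] [MonoidalCategory C]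
  (A : Center C) [MonObj A] [IsCommMonObj A]

variable {A} in
/-- For objects of `C_A^σ`, a balanced right linear morphism is left linear. -/
theorem actLeft_of_actRight {M N P : CSigma A} (b : M.obj.X ⊗ N.obj.X ⟶ P.obj.X)
    (balanced : M.obj.actRight ▷ N.obj.X ≫ b =
      (α_ _ _ _).hom ≫ M.obj.X ◁ N.obj.actLeft ≫ b)
    (right : M.obj.X ◁ N.obj.actRight ≫ b = (α_ _ _ _).inv ≫ b ▷ ob A ≫ P.obj.actRight) :
    M.obj.actLeft ▷ N.obj.X ≫ b = (α_ _ _ _).hom ≫ ob A ◁ b ≫ P.obj.actLeft := by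
  have hM : M.obj.actLeft = hb A M.obj.X ≫ M.obj.actRight := M.property
  have hN : N.obj.actLeft = hb A N.obj.X ≫ N.obj.actRight := N.property
  have hP : P.obj.actLeft = hb A P.obj.X ≫ P.obj.actRight := P.property
  have h := hb_natural A b
  have balanced' : M.obj.actRight ▷ N.obj.X ≫ b =
    (α_ M.obj.X (ob A) N.obj.X).hom ≫ M.obj.X ◁ N.obj.actLeft ≫ b := balanced
  calc
    _ = hb A M.obj.X ▷ N.obj.X ≫ M.obj.actRight ▷ N.obj.X ≫ b := by
      rw [hM]
      exact (congrArg (· ≫ b) (comp_whiskerRight _ _ _)).trans (Category.assoc _ _ _)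
    _ = hb A M.obj.X ▷ N.obj.X ≫ (α_ M.obj.X (ob A) N.obj.X).hom ≫ M.obj.X ◁ hb A N.obj.X ≫
        M.obj.X ◁ N.obj.actRight ≫ b := by
      rw [balanced', hN, whiskerLeft_comp, Category.assoc]
    -- The half-braidings past M and past N combine to the one past M ⊗ N, which is natural with
    -- respect to b.
    _ = (α_ (ob A) M.obj.X N.obj.X).hom ≫ (hb A (M.obj.X ⊗ N.obj.X) ≫ b ▷ ob A) ≫
        P.obj.actRight := by
      rw [right, hb_tensor]; monoidal
    _ = _ := by
      rw [← h, hP, Category.assoc]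

end SigmaLinear

section SigmaMaps
variable {C : Type u} [Category.{v} C] [MonoidalCategory C] [RigidCategory C] [HasCoequalizers C]
  (A : Center C) [MonObj A] [IsCommMonObj A]

/-- A morphism of `C_A^σ` given by a balanced right linear morphism. -/
def sigmaDesc {M N P : CSigma A} (b : M.obj.X ⊗ N.obj.X ⟶ P.obj.X)
    (balanced : M.obj.actRight ▷ N.obj.X ≫ b =
      (α_ _ _ _).hom ≫ M.obj.X ◁ N.obj.actLeft ≫ b)
    (right : M.obj.X ◁ N.obj.actRight ≫ b = (α_ _ _ _).inv ≫ b ▷ ob A ≫ P.obj.actRight) :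
    M ⊗ N ⟶ P :=
  ObjectProperty.homMk (tensorDesc b balanced (actLeft_of_actRight b balanced right) right)

variable {A} in
/-- The morphism `M ⊗ N ⟶ P` of `C` which underlies a morphism `M ⊗_A N ⟶ P`. -/
def bil {M N P : CSigma A} (k : M ⊗ N ⟶ P) : M.obj.X ⊗ N.obj.X ⟶ P.obj.X :=
  tp M.obj N.obj ≫ k.hom.hom

theorem bil_sigmaDesc {M N P : CSigma A} (b : M.obj.X ⊗ N.obj.X ⟶ P.obj.X)
    (balanced : M.obj.actRight ▷ N.obj.X ≫ b =
      (α_ _ _ _).hom ≫ M.obj.X ◁ N.obj.actLeft ≫ b)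
    (right : M.obj.X ◁ N.obj.actRight ≫ b = (α_ _ _ _).inv ≫ b ▷ ob A ≫ P.obj.actRight) :
    bil (sigmaDesc A b balanced right) = b :=
  tp_tensorDesc b balanced (actLeft_of_actRight b balanced right) right

variable {A}

theorem bil_ext {M N P : CSigma A} {k l : M ⊗ N ⟶ P} (h : bil k = bil l) : k = l :=
  ObjectProperty.hom_ext _ (tensor_hom_ext h)

variable (A) in
theorem bil_rightUnitor : bil (ρ_ (𝟙_ (CSigma A))).hom = mulMor A :=
  tp_rightUnitor (𝟙_ (Bimod (alg A) (alg A)))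

theorem bil_whiskerRight {M M' N P : CSigma A} (f : M ⟶ M') (k : M' ⊗ N ⟶ P) :
    bil (f ▷ N ≫ k) = f.hom.hom ▷ N.obj.X ≫ bil k := by
  have h := tp_whiskerRight f.hom N.obj
  exact (reassoc_of% h) k.hom.hom

theorem bil_whiskerLeft {M N N' P : CSigma A} (f : N ⟶ N') (k : M ⊗ N' ⟶ P) :
    bil (M ◁ f ≫ k) = M.obj.X ◁ f.hom.hom ≫ bil k := by
  have h := tp_whiskerLeft M.obj f.hom
  exact (reassoc_of% h) k.hom.hom

theorem bil_assoc {M N P Q R : CSigma A} (k : N ⊗ P ⟶ Q) (l : M ⊗ Q ⟶ R) :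
    tp M.obj N.obj ▷ P.obj.X ≫ bil ((α_ M N P).hom ≫ M ◁ k ≫ l) =
      (α_ _ _ _).hom ≫ M.obj.X ◁ bil k ≫ bil l := by
  have h := tp_associator M.obj N.obj P.obj
  have h2 := tp_whiskerLeft M.obj k.hom
  refine ((reassoc_of% h) _).trans ?_
  refine (congrArg (fun t => (α_ M.obj.X N.obj.X P.obj.X).hom ≫ M.obj.X ◁ tp N.obj P.obj ≫ t)
    ((reassoc_of% h2) l.hom.hom)).trans ?_
  rw [bil, bil, whiskerLeft_comp, Category.assoc]

theorem bil_assoc_inv {M N P : CSigma A} (k : M ⊗ N ⟶ 𝟙_ (CSigma A)) :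
    M.obj.X ◁ tp N.obj P.obj ≫ bil ((α_ M N P).inv ≫ k ▷ P ≫ (λ_ P).hom) =
      (α_ _ _ _).inv ≫ bil k ▷ P.obj.X ≫ P.obj.actLeft := by
  have h := tp_associator M.obj N.obj P.obj
  have h2 := tp_whiskerRight k.hom P.obj
  have h3 := tp_leftUnitor P.obj
  have h4 : M.obj.X ◁ tp N.obj P.obj ≫ tp M.obj (N.obj ⊗ P.obj) ≫
      (α_ M.obj N.obj P.obj).inv.hom = (α_ _ _ _).inv ≫ tp M.obj N.obj ▷ P.obj.X ≫
        tp (M.obj ⊗ N.obj) P.obj := by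
    have e : (α_ M.obj N.obj P.obj).hom.hom ≫ (α_ M.obj N.obj P.obj).inv.hom = 𝟙 _ :=
      congrArg Bimod.Hom.hom (α_ M.obj N.obj P.obj).hom_inv_id
    rw [Iso.eq_inv_comp, ← reassoc_of% h, e, Category.comp_id]
  refine ((reassoc_of% h4) _).trans ?_
  refine (congrArg (fun t => (α_ M.obj.X N.obj.X P.obj.X).inv ≫ tp M.obj N.obj ▷ P.obj.X ≫ t)
    (((reassoc_of% h2) _).trans (congrArg (_ ≫ ·) h3))).trans ?_
  rw [bil, comp_whiskerRight]
  exact congrArg (_ ≫ ·) (Category.assoc _ _ _).symm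

/-- The unit object of C_A^σ is A, so the value of the inner pairing is absorbed by the left action
on Q before the outer pairing is taken. The associators of ⊗_A are those of C once everything is
pulled back along the projections. -/
theorem bil_nest {M N P Q : CSigma A} (k : N ⊗ P ⟶ 𝟙_ (CSigma A)) (l : M ⊗ Q ⟶ 𝟙_ (CSigma A)) :
    tp M.obj N.obj ▷ (P.obj.X ⊗ Q.obj.X) ≫ (M ⊗ N).obj.X ◁ tp P.obj Q.obj ≫ bil (nest k l) =
      (α_ _ _ _).hom ≫ M.obj.X ◁ ((α_ _ _ _).inv ≫ bil k ▷ Q.obj.X ≫ Q.obj.actLeft) ≫ bil l := by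
  have h1 := bil_assoc ((α_ N P Q).inv ≫ k ▷ Q ≫ (λ_ Q).hom) l
  have h2 := bil_assoc_inv (P := Q) k
  refine (whisker_exchange_assoc _ _ _).symm.trans ?_
  refine (congrArg (_ ≫ ·) h1).trans ?_
  refine (associator_naturality_right_assoc _ _ _ _).trans ?_
  refine congrArg (_ ≫ ·) ?_
  rw [← whiskerLeft_comp_assoc]
  exact congrArg (fun t => M.obj.X ◁ t ≫ bil l) h2

theorem bil_tensor_ext {M N P Q R : CSigma A} {k l : (M ⊗ N) ⊗ (P ⊗ Q) ⟶ R}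
    (h : tp M.obj N.obj ▷ (P.obj.X ⊗ Q.obj.X) ≫ (M ⊗ N).obj.X ◁ tp P.obj Q.obj ≫ bil k =
      tp M.obj N.obj ▷ (P.obj.X ⊗ Q.obj.X) ≫ (M ⊗ N).obj.X ◁ tp P.obj Q.obj ≫ bil l) : k = l :=
  bil_ext ((cancel_epi ((M.obj ⊗ N.obj).X ◁ tp P.obj Q.obj)).1
    ((cancel_epi (tp M.obj N.obj ▷ (P.obj.X ⊗ Q.obj.X))).1 h))

end SigmaMaps

/-! ### The natural transformation G(M) ⟶ M††, and the dual of a tensor product. -/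

section EvaluationTwist
variable {C : Type u} [Category.{v} C] [MonoidalCategory C] [RigidCategory C] [HasCoequalizers C]
  (A : Center C) [MonObj A] [IsCommMonObj A] [RightRigidCategory (CSigma A)]

/-- The morphism `G(M) ⊗_A M† ⟶ A`. -/
def evG (M : CSigma A) : (G A).obj M ⊗ ldual M ⟶ 𝟙_ (CSigma A) :=
  sigmaDesc A (M := (G A).obj M) (N := ldual M) (P := 𝟙_ (CSigma A)) (evTwist A M)
    (evTwist_balanced A M) (evTwist_right A M)

theorem bil_evG (M : CSigma A) : bil (evG A M) = evTwist A M :=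
  bil_sigmaDesc A _ _ _

/-- The canonical morphism `G(M) ⟶ M††`. -/
def toDoubleDual (M : CSigma A) : (G A).obj M ⟶ dd M :=
  evLift (exL (ldual M)) (evG A M)

theorem toDoubleDual_ev (M : CSigma A) :
    toDoubleDual A M ▷ ldual M ≫ ε_ (ldual M) (dd M) = evG A M :=
  evLift_ev _ _

/-- The dual `f† : N† ⟶ M†` of `f : M ⟶ N`. -/
abbrev daggerMap {M N : CSigma A} (f : M ⟶ N) : ldual N ⟶ ldual M := mate (exL M) (exL N) f

theorem daggerMap_evDagger {M N : CSigma A} (f : M ⟶ N) :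
    (daggerMap A f).hom.hom ▷ M.obj.X ≫ evDagger A M =
      (ldual N).obj.X ◁ f.hom.hom ≫ evDagger A N := by
  have h := congrArg bil (mate_ev (exL M) (exL N) f)
  rw [bil_whiskerRight, bil_whiskerLeft] at h
  exact h

/-- Both i_M and σ are natural: the first by transposing the defining property of f†, the second by
definition. -/
theorem daggerMap_daggerHom {M N : CSigma A} (f : M ⟶ N) :
    (daggerMap A f).hom.hom ≫ daggerHom A M =
      daggerHom A N ≫ mate (exL M.obj.X) (exL N.obj.X) f.hom.hom ▷ ob A := by
  have h : (daggerMap A f).hom.hom ≫ inclDagger A M =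
      inclDagger A N ≫ ob A ◁ mate (exL M.obj.X) (exL N.obj.X) f.hom.hom := by
    rw [inclDagger_eq, comp_transpose, daggerMap_evDagger, inclDagger_eq, transpose_mate]
  rw [daggerHom, daggerHom, reassoc_of% h, hb_natural, Category.assoc]

theorem evG_natural {M N : CSigma A} (f : M ⟶ N) :
    (G A).map f ▷ ldual N ≫ evG A N = (G A).obj M ◁ daggerMap A f ≫ evG A M := by
  apply bil_ext
  rw [bil_whiskerRight, bil_whiskerLeft, bil_evG, bil_evG]
  change ddMap f.hom.hom ▷ (ldual N).obj.X ≫ evTwist A N =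
    dd M.obj.X ◁ (daggerMap A f).hom.hom ≫ evTwist A M
  have h : ddMap f.hom.hom ▷ ldual N.obj.X ≫ ε_ (ldual N.obj.X) (dd N.obj.X) =
      dd M.obj.X ◁ mate (exL M.obj.X) (exL N.obj.X) f.hom.hom ≫
        ε_ (ldual M.obj.X) (dd M.obj.X) := mate_ev _ _ _
  have h2 := daggerMap_daggerHom A f
  calc
    _ = (ddMap f.hom.hom ▷ (ldual N).obj.X ≫ dd N.obj.X ◁ daggerHom A N) ⊗≫
        ε_ (ldual N.obj.X) (dd N.obj.X) ▷ ob A ⊗≫ 𝟙 _ := by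
      rw [evTwist]; monoidal
    _ = dd M.obj.X ◁ daggerHom A N ⊗≫
        (ddMap f.hom.hom ▷ ldual N.obj.X ≫ ε_ (ldual N.obj.X) (dd N.obj.X)) ▷ ob A ⊗≫ 𝟙 _ := by
      rw [← whisker_exchange]; monoidal
    _ = dd M.obj.X ◁ (daggerHom A N ≫ mate (exL M.obj.X) (exL N.obj.X) f.hom.hom ▷ ob A) ⊗≫
        ε_ (ldual M.obj.X) (dd M.obj.X) ▷ ob A ⊗≫ 𝟙 _ := by
      rw [h]; monoidal
    _ = _ := by
      rw [← h2, evTwist]; monoidal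

/-- Morphisms into N†† are tested by pairing with N†, where naturality becomes `evG_natural`. -/
theorem toDoubleDual_natural {M N : CSigma A} (f : M ⟶ N) :
    (G A).map f ≫ toDoubleDual A N = toDoubleDual A M ≫ ddMap f := by
  apply ev_ext (exL (ldual N))
  have h : ddMap f ▷ ldual N ≫ ε_ (ldual N) (dd N) =
      dd M ◁ daggerMap A f ≫ ε_ (ldual M) (dd M) := mate_ev _ _ _
  rw [comp_whiskerRight, Category.assoc, toDoubleDual_ev, evG_natural, comp_whiskerRight,
    Category.assoc, h, ← whisker_exchange_assoc, toDoubleDual_ev]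

/-- The natural transformation `G(M) ⟶ M††`. -/
def toDoubleDualNat : G A ⟶ doubleDual (CSigma A) where
  app M := toDoubleDual A M
  naturality _ _ f := toDoubleDual_natural A f

/-- The isomorphism `N† ⊗_A M† ⟶ (M ⊗_A N)†`. -/
def daggerTensor (M N : CSigma A) : ldual N ⊗ ldual M ⟶ ldual (M ⊗ N) :=
  mate (exL (M ⊗ N)) (pairTensor (exL M) (exL N)) (𝟙 _)

/-- The isomorphism `(M ⊗_A N)† ⟶ N† ⊗_A M†`. -/
def daggerTensorInv (M N : CSigma A) : ldual (M ⊗ N) ⟶ ldual N ⊗ ldual M :=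
  mate (pairTensor (exL M) (exL N)) (exL (M ⊗ N)) (𝟙 _)

theorem daggerTensorInv_daggerTensor (M N : CSigma A) :
    daggerTensorInv A M N ≫ daggerTensor A M N = 𝟙 _ := by
  rw [daggerTensorInv, daggerTensor, ← mate_comp, Category.comp_id, mate_id]

/-- The morphism `N† ⊗ M† ⟶ (M ⊗_A N)†`. -/
def daggerTp (M N : CSigma A) : (ldual N).obj.X ⊗ (ldual M).obj.X ⟶ (ldual (M ⊗ N)).obj.X :=
  bil (daggerTensor A M N)

/-- The evaluation for a tensor product is nested. In element notation the pairing of n' ⊗ m' with m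
⊗ n is n'(m'(m)·n). -/
theorem daggerTp_evDagger (M N : CSigma A) :
    daggerTp A M N ▷ (M.obj.X ⊗ N.obj.X) ≫ _ ◁ tp M.obj N.obj ≫ evDagger A (M ⊗ N) =
      (α_ _ _ _).hom ≫ (ldual N).obj.X ◁ ((α_ _ _ _).inv ≫ evDagger A M ▷ N.obj.X ≫
        N.obj.actLeft) ≫ evDagger A N := by
  have h := bil_nest (ε_ M (ldual M)) (ε_ N (ldual N))
  have h2 : daggerTensor A M N ▷ (M ⊗ N) ≫ ε_ (M ⊗ N) (ldual (M ⊗ N)) =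
      nest (ε_ M (ldual M)) (ε_ N (ldual N)) := by
    rw [daggerTensor, mate_ev, whiskerLeft_id, Category.id_comp, pairTensor_ev_eq_nest]
  rw [← h2, bil_whiskerRight] at h
  refine Eq.trans ?_ h
  refine (congrArg (· ≫ _) (comp_whiskerRight _ _ _)).trans ((Category.assoc _ _ _).trans ?_)
  refine congrArg (_ ≫ ·) ?_
  exact (whisker_exchange_assoc _ _ _).symm

end EvaluationTwist

section
variable {C : Type u} [Category.{v} C] [MonoidalCategory C]

theorem whisker_comp_exchange {X Y Z U V W K : C} (a : X ⟶ Y) (g : Y ⟶ Z) (b : U ⟶ V) (t : V ⟶ W)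
    (e : Z ⊗ W ⟶ K) :
    a ▷ U ≫ Y ◁ b ≫ g ▷ V ≫ Z ◁ t ≫ e = (a ≫ g) ▷ U ≫ Z ◁ (b ≫ t) ≫ e := by
  rw [comp_whiskerRight, whiskerLeft_comp, Category.assoc, Category.assoc,
    whisker_exchange_assoc]

end

/-! ### Monoidality of the comparison, and its invertibility. -/

section MonoidalComparison
variable {C : Type u} [Category.{v} C] [MonoidalCategory C] [RigidCategory C] [HasCoequalizers C]
  (A : Center C) [MonObj A] [IsCommMonObj A] [RightRigidCategory (CSigma A)]

/-- The dual `(M ⊗_A N)* ⟶ N* ⊗ M*` of the projection. -/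
abbrev dualTp (M N : CSigma A) : ldual (M ⊗ N).obj.X ⟶ ldual N.obj.X ⊗ ldual M.obj.X :=
  mate (pairTensor (exL M.obj.X) (exL N.obj.X)) (exL (M ⊗ N).obj.X) (tp M.obj N.obj)

/-- In element notation, balancing rewrites n'(m'(m)·n) as (n'·m'(m))(n). In this form m is consumed
before n, so the transposition can be done in stages, first over M and then over N. -/
theorem daggerTp_inclDagger (M N : CSigma A) :
    daggerTp A M N ≫ inclDagger A (M ⊗ N) ≫ ob A ◁ dualTp A M N =
      (ldual N).obj.X ◁ inclDagger A M ≫ (α_ _ _ _).inv ≫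
        ((ldual N).obj.actRight ≫ inclDagger A N) ▷ ldual M.obj.X ≫ (α_ _ _ _).hom := by
  have h1 := daggerTp_evDagger A M N
  have h2 : (ldual N).obj.actRight ▷ N.obj.X ≫ evDagger A N =
    (α_ (ldual N).obj.X (ob A) N.obj.X).hom ≫ (ldual N).obj.X ◁ N.obj.actLeft ≫ evDagger A N :=
    evDagger_balanced A N
  let d : ((ldual N).obj.X ⊗ (ldual M).obj.X) ⊗ M.obj.X ⟶ (ldual N).obj.X :=
    (α_ _ _ _).hom ≫ (ldual N).obj.X ◁ evDagger A M ≫ (ldual N).obj.actRight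
  have h3 : (α_ (ldual N).obj.X (ldual M).obj.X (M.obj.X ⊗ N.obj.X)).hom ≫
      (ldual N).obj.X ◁ ((α_ _ _ _).inv ≫ evDagger A M ▷ N.obj.X ≫ N.obj.actLeft) ≫
        evDagger A N = (α_ _ _ _).inv ≫ d ▷ N.obj.X ≫ evDagger A N := by
    symm
    calc
      _ = 𝟙 _ ⊗≫ (ldual N).obj.X ◁ evDagger A M ▷ N.obj.X ⊗≫
          ((ldual N).obj.actRight ▷ N.obj.X ≫ evDagger A N) := by
        simp only [d]; monoidal
      _ = _ := by
        rw [h2]; monoidal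
  have h4 : transpose (exL M.obj.X) d = (ldual N).obj.X ◁ inclDagger A M ≫ (α_ _ _ _).inv ≫
      (ldual N).obj.actRight ▷ ldual M.obj.X := by
    rw [inclDagger_eq, transpose, transpose]; simp only [d]; monoidal
  have h5 := transpose_tensor (exL M.obj.X) (exL N.obj.X) d (evDagger A N)
  rw [inclDagger_eq A (M ⊗ N), transpose_mate, comp_transpose]
  refine (congrArg (transpose _) (h1.trans h3)).trans (h5.trans ?_)
  rw [h4, ← inclDagger_eq, comp_whiskerRight]
  simp only [Category.assoc]

/-- Right linearity of j_N takes the value of the inner pairing out as a factor multiplied onto the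
output of j_N. By `actLeft_inclDagger` that product can be read instead as the A-leg of j_N acting
on M† from the left before j_M is applied. -/
theorem daggerTp_daggerHom (M N : CSigma A) :
    daggerTp A M N ≫ daggerHom A (M ⊗ N) ≫ dualTp A M N ▷ ob A =
      daggerHom A N ▷ (ldual M).obj.X ⊗≫
        ldual N.obj.X ◁ ((ldual M).obj.actLeft ≫ daggerHom A M) ⊗≫ 𝟙 _ := by
  have h1 := daggerTp_inclDagger A M N
  have h2 := hb_natural A (dualTp A M N)
  have h3 : (ldual N).obj.actRight ≫ inclDagger A N ≫ hb A (ldual N.obj.X) =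
    daggerHom A N ▷ ob A ≫ (α_ _ _ _).hom ≫ ldual N.obj.X ◁ mulMor A := actRight_daggerHom A N
  have h4 := actLeft_inclDagger A M
  calc
    _ = (daggerTp A M N ≫ inclDagger A (M ⊗ N) ≫ ob A ◁ dualTp A M N) ≫
        hb A (ldual N.obj.X ⊗ ldual M.obj.X) := by
      rw [daggerHom, Category.assoc, Category.assoc, Category.assoc, h2]
    _ = (ldual N).obj.X ◁ inclDagger A M ⊗≫
        ((ldual N).obj.actRight ≫ inclDagger A N ≫ hb A (ldual N.obj.X)) ▷ ldual M.obj.X ⊗≫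
        ldual N.obj.X ◁ hb A (ldual M.obj.X) ⊗≫ 𝟙 _ := by
      rw [h1, hb_tensor]; monoidal
    _ = 𝟙 _ ⊗≫ ((ldual N).obj.X ◁ inclDagger A M ≫ daggerHom A N ▷ _) ⊗≫
        ldual N.obj.X ◁ (mulMor A ▷ ldual M.obj.X ≫ hb A (ldual M.obj.X)) ⊗≫ 𝟙 _ := by
      rw [h3]; monoidal
    _ = daggerHom A N ▷ (ldual M).obj.X ⊗≫ ldual N.obj.X ◁ ((ob A ◁ inclDagger A M ≫
        (α_ _ _ _).inv ≫ mulMor A ▷ ldual M.obj.X) ≫ hb A (ldual M.obj.X)) ⊗≫ 𝟙 _ := by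
      rw [whisker_exchange]; monoidal
    _ = _ := by
      rw [← h4, Category.assoc]; rfl

/-- The morphism `M** ⊗ N** ⟶ (M ⊗_A N)**`. -/
def ddTp (M N : CSigma A) : dd M.obj.X ⊗ dd N.obj.X ⟶ dd (M ⊗ N).obj.X :=
  (ddTensor M.obj.X N.obj.X).hom ≫ ddMap (tp M.obj N.obj)

/-- The double dual of the projection, paired with (M ⊗_A N)*, is the dual of the projection
followed by nested evaluations. `daggerTp_daggerHom` then lets N** meet j_N first and M** meet j_M
afterwards. -/
theorem evTwist_tensor (M N : CSigma A) :
    ddTp A M N ▷ _ ≫ dd (M ⊗ N).obj.X ◁ daggerTp A M N ≫ evTwist A (M ⊗ N) =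
    (α_ _ _ _).hom ≫ dd M.obj.X ◁ ((α_ _ _ _).inv ≫ evTwist A N ▷ (ldual M).obj.X ≫
      (ldual M).obj.actLeft) ≫ evTwist A M := by
  have h2 := daggerTp_daggerHom A M N
  set T := ddTp A M N with hT
  have h' : T ▷ ldual (M ⊗ N).obj.X ≫ ε_ (ldual (M ⊗ N).obj.X) (dd (M ⊗ N).obj.X) =
      (dd M.obj.X ⊗ dd N.obj.X) ◁ dualTp A M N ⊗≫
        dd M.obj.X ◁ (ε_ (ldual N.obj.X) (dd N.obj.X) ▷ ldual M.obj.X) ⊗≫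
          ε_ (ldual M.obj.X) (dd M.obj.X) := ddTensor_ddMap_ev (tp M.obj N.obj)
  calc
    _ = (T ▷ _ ≫ dd (M ⊗ N).obj.X ◁ (daggerTp A M N ≫ daggerHom A (M ⊗ N))) ⊗≫
        ε_ (ldual (M ⊗ N).obj.X) (dd (M ⊗ N).obj.X) ▷ ob A ⊗≫ 𝟙 (ob A) := by
      rw [evTwist]; monoidal
    _ = (dd M.obj.X ⊗ dd N.obj.X) ◁ (daggerTp A M N ≫ daggerHom A (M ⊗ N)) ⊗≫
        (T ▷ ldual (M ⊗ N).obj.X ≫ ε_ (ldual (M ⊗ N).obj.X) (dd (M ⊗ N).obj.X)) ▷ ob A ⊗≫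
          𝟙 (ob A) := by
      rw [← whisker_exchange]; monoidal
    _ = (dd M.obj.X ⊗ dd N.obj.X) ◁ (daggerTp A M N ≫ daggerHom A (M ⊗ N) ≫
          dualTp A M N ▷ ob A) ⊗≫
        dd M.obj.X ◁ (ε_ (ldual N.obj.X) (dd N.obj.X) ▷ (ldual M.obj.X ⊗ ob A)) ⊗≫
          ε_ (ldual M.obj.X) (dd M.obj.X) ▷ ob A ⊗≫ 𝟙 (ob A) := by
      rw [h']; monoidal
    _ = 𝟙 _ ⊗≫ dd M.obj.X ◁ dd N.obj.X ◁ daggerHom A N ▷ (ldual M).obj.X ⊗≫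
        dd M.obj.X ◁ ((dd N.obj.X ⊗ ldual N.obj.X) ◁ ((ldual M).obj.actLeft ≫ daggerHom A M) ≫
          ε_ (ldual N.obj.X) (dd N.obj.X) ▷ _) ⊗≫
          ε_ (ldual M.obj.X) (dd M.obj.X) ▷ ob A ⊗≫ 𝟙 (ob A) := by
      rw [h2]; monoidal
    _ = _ := by
      rw [whisker_exchange, evTwist, evTwist]; monoidal

open Functor.LaxMonoidal in
theorem evG_tensor (M N : CSigma A) :
    μ (G A) M N ▷ (ldual N ⊗ ldual M) ≫ (G A).obj (M ⊗ N) ◁ daggerTensor A M N ≫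
      evG A (M ⊗ N) = nest (evG A N) (evG A M) := by
  apply bil_tensor_ext
  rw [bil_nest, bil_evG, bil_evG, bil_whiskerRight, bil_whiskerLeft, bil_evG]
  have h := evTwist_tensor A M N
  have h2 : tp ((G A).obj M).obj ((G A).obj N).obj ≫ (μ (G A) M N).hom.hom =
    ddTp A M N := tp_twistTensorHom A M.obj N.obj
  refine Eq.trans ?_ h
  rw [← h2]
  exact whisker_comp_exchange _ _ _ _ _

/-- The isomorphism `A ⟶ A†`. -/
def daggerUnit : 𝟙_ (CSigma A) ⟶ ldual (𝟙_ (CSigma A)) :=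
  mate (exL (𝟙_ (CSigma A))) exactPairingUnit (𝟙 _)

/-- The isomorphism `A† ⟶ A`. -/
def daggerUnitInv : ldual (𝟙_ (CSigma A)) ⟶ 𝟙_ (CSigma A) :=
  mate exactPairingUnit (exL (𝟙_ (CSigma A))) (𝟙 _)

theorem daggerUnitInv_daggerUnit : daggerUnitInv A ≫ daggerUnit A = 𝟙 _ := by
  rw [daggerUnitInv, daggerUnit, ← mate_comp, Category.comp_id, mate_id]

theorem daggerUnit_ev :
    daggerUnit A ▷ 𝟙_ (CSigma A) ≫ ε_ (𝟙_ (CSigma A)) (ldual (𝟙_ (CSigma A))) = (ρ_ _).hom := by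
  rw [daggerUnit, mate_ev, whiskerLeft_id, Category.id_comp]; rfl

/-- The morphism `A ⟶ A†` of `C`. -/
def daggerUnitHom : ob A ⟶ (ldual (𝟙_ (CSigma A))).obj.X := (daggerUnit A).hom.hom

theorem daggerUnitHom_evDagger :
    daggerUnitHom A ▷ ob A ≫ evDagger A (𝟙_ (CSigma A)) = mulMor A := by
  have h := congrArg bil (daggerUnit_ev A)
  rw [bil_whiskerRight, bil_rightUnitor] at h
  exact h

/-- For M = A, identified with its own dual, i_M is the transpose of the multiplication, and σ
carries it to `coevHat` by `mulTranspose_hb`. -/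
theorem daggerUnitHom_daggerHom :
    daggerUnitHom A ≫ daggerHom A (𝟙_ (CSigma A)) =
      𝟙 _ ⊗≫ coevHat A ▷ ob A ⊗≫ ldual (ob A) ◁ mulMor A := by
  have h : daggerUnitHom A ≫ inclDagger A (𝟙_ (CSigma A)) = mulTranspose A := by
    rw [inclDagger_eq, comp_transpose, mulTranspose]
    exact congrArg (transpose (exL (ob A))) (daggerUnitHom_evDagger A)
  have h2 := mulTranspose_hb A
  rw [← h] at h2
  exact (Category.assoc _ _ _).symm.trans h2

/-- Pairing A** with `coevHat` gives ū followed by μ, and u cancels ū. This matches the unit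
constraint u of G. -/
theorem drinfeld_evTwist :
    drinfeld A ▷ ob A ≫ dd (ob A) ◁ daggerUnitHom A ≫ evTwist A (𝟙_ (CSigma A)) = mulMor A := by
  have h : drinfeld A ≫ drinfeldInv A = 𝟙 _ := IsIso.inv_hom_id _
  let j : (ldual (𝟙_ (CSigma A))).obj.X ⟶ ldual (ob A) ⊗ ob A := daggerHom A (𝟙_ (CSigma A))
  have e : evTwist A (𝟙_ (CSigma A)) =
    dd (ob A) ◁ j ⊗≫ ε_ (ldual (ob A)) (dd (ob A)) ▷ ob A ⊗≫ 𝟙 (ob A) := rfl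
  have h3 : daggerUnitHom A ≫ j = 𝟙 _ ⊗≫ coevHat A ▷ ob A ⊗≫ ldual (ob A) ◁ mulMor A :=
    daggerUnitHom_daggerHom A
  have h2 : dd (ob A) ◁ daggerUnitHom A ≫ evTwist A (𝟙_ (CSigma A)) =
      drinfeldInv A ▷ ob A ≫ mulMor A := by
    calc
      _ = dd (ob A) ◁ (daggerUnitHom A ≫ j) ⊗≫
          ε_ (ldual (ob A)) (dd (ob A)) ▷ ob A ⊗≫ 𝟙 (ob A) := by
        rw [e]; monoidal
      _ = 𝟙 _ ⊗≫ dd (ob A) ◁ coevHat A ▷ ob A ⊗≫ ((dd (ob A) ⊗ ldual (ob A)) ◁ mulMor A ≫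
          ε_ (ldual (ob A)) (dd (ob A)) ▷ ob A) ⊗≫ 𝟙 (ob A) := by
        rw [h3]; monoidal
      _ = _ := by
        rw [whisker_exchange, drinfeldInv_eq]; monoidal
  rw [h2, ← comp_whiskerRight_assoc, h, id_whiskerRight, Category.id_comp]

open Functor.LaxMonoidal in
theorem evG_unit :
    ε (G A) ▷ 𝟙_ (CSigma A) ≫ (G A).obj (𝟙_ (CSigma A)) ◁ daggerUnit A ≫
      evG A (𝟙_ (CSigma A)) = (ρ_ _).hom := by
  apply bil_ext
  rw [bil_whiskerRight, bil_whiskerLeft, bil_evG, bil_rightUnitor]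
  exact drinfeld_evTwist A

-- Both axioms are equalities of morphisms into a double dual, hence may be checked after pairing
-- with the dual. There the comparison becomes `evG`, and the identities are `evG_unit` and
-- `evG_tensor`, transported along A† ≅ A and (M ⊗_A N)† ≅ N† ⊗_A M†.
open Functor.LaxMonoidal in
instance : NatTrans.IsMonoidal (toDoubleDualNat A) where
  unit := by
    apply ev_ext (exL (ldual (𝟙_ (CSigma A))))
    have h : ddUnit.hom ▷ ldual (𝟙_ (CSigma A)) ≫ ε_ (ldual (𝟙_ (CSigma A))) (dd _) =
      𝟙_ _ ◁ daggerUnitInv A ≫ (ρ_ _).hom := mate_ev _ _ _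
    change (ε (G A) ≫ toDoubleDual A (𝟙_ (CSigma A))) ▷ ldual (𝟙_ (CSigma A)) ≫ _ =
      ddUnit.hom ▷ ldual (𝟙_ (CSigma A)) ≫ _
    rw [comp_whiskerRight, Category.assoc, toDoubleDual_ev, h, ← evG_unit,
      whisker_exchange_assoc, ← whiskerLeft_comp_assoc, daggerUnitInv_daggerUnit,
      whiskerLeft_id, Category.id_comp]
  tensor M N := by
    apply ev_ext (exL (ldual (M ⊗ N)))
    have h : (ddTensor M N).hom ▷ ldual (M ⊗ N) ≫ ε_ (ldual (M ⊗ N)) (dd (M ⊗ N)) =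
      (dd M ⊗ dd N) ◁ daggerTensorInv A M N ≫
        nest (ε_ (ldual N) (dd N)) (ε_ (ldual M) (dd M)) := by
      rw [← pairTensor_ev_eq_nest]
      exact mate_ev _ _ _
    change (μ (G A) M N ≫ toDoubleDual A (M ⊗ N)) ▷ ldual (M ⊗ N) ≫ _ =
      ((toDoubleDual A M ⊗ₘ toDoubleDual A N) ≫ (ddTensor M N).hom) ▷ ldual (M ⊗ N) ≫ _
    rw [comp_whiskerRight, Category.assoc, toDoubleDual_ev, comp_whiskerRight, Category.assoc, h,
      ← whisker_exchange_assoc, tensorHom_nest, toDoubleDual_ev, toDoubleDual_ev, ← evG_tensor,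
      whisker_exchange_assoc, ← whiskerLeft_comp_assoc, daggerTensorInv_daggerTensor,
      whiskerLeft_id, Category.id_comp]

/-- Every object of C_A^σ has a left dual, so monoidality alone makes each component invertible. -/
theorem isIso_toDoubleDualNat : IsIso (toDoubleDualNat A) := by
  have (M : CSigma A) : IsIso ((toDoubleDualNat A).app M) :=
    isIso_app_of_isMonoidal (toDoubleDualNat A) (exL M)
  exact NatIso.isIso_of_isIso_app _

end MonoidalComparison
end
end BimodDual

theorem mainTheorem5 {C : Type u} [Category.{v} C] [MonoidalCategory C] [RigidCategory C]
    [HasCoequalizers C] (A : Center C) [MonObj A] [IsCommMonObj A]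
    [RigidCategory (Bimod (alg A) (alg A))] :
    Nonempty (RigidCategory (CSigma A)) ∧
    ∀ [RightRigidCategory (CSigma A)],
      (∀ M : CSigma A, ∃ w : inclDagger A M ≫ homLeft A M = inclDagger A M ≫ homRight A M,
        Nonempty (IsLimit (Fork.ofι (inclDagger A M) w))) ∧
      ∃ φ : G A ≅ doubleDual (CSigma A), NatTrans.IsMonoidal φ.hom := by
  refine ⟨nonempty_rigidCategory_cSigma A, fun {_} => ⟨fun M =>
    ⟨inclDagger_condition A M, nonempty_isLimit_inclDagger A M⟩, ?_⟩⟩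
  have := isIso_toDoubleDualNat A
  exact ⟨asIso (toDoubleDualNat A), inferInstanceAs (NatTrans.IsMonoidal (toDoubleDualNat A))⟩
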